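/- Let $\mathcal H=\mathbb C^2\otimes\mathbb C^2$ with computational basis $|00\rangle,|01\rangle,|10\rangle,|11\rangle$. The two-qubit Pauli group is $$\mathcal P=\{(-1)^x i^k\,(X^{a_1}\otimes X^{a_2})(Z^{b_1}\otimes Z^{b_2}) : x,k,a_1,a_2,b_1,b_2\in\{0,1\}\}.$$ A Clifford operation is a unitary $C$ on $\mathcal H$ with $CPC^\dagger\in\mathcal P$ for all $P\in\mathcal P$ (in particular every global phase is one). Unit vectors $\psi,\varphi$ are Clifford-equivalent if $\varphi=C\psi$ for some Clifford operation $C$. A non-degenerate Clifford eigenstate is a unit vector that spans a one-dimensional eigenspace of some Clifford operation. A stabilizer state is a unit vector fixed by every element of an abelian subgroup of $\mathcal P$ of order $4$. The stabilizer fidelity of $\psi$ is $F(\psi)=\max_s|\langle\psi|s\rangle|^2$ over all stabilizer states $s$, and the nearest stabilizer states to $\psi$ are the stabilizer states, counted up to global phase, that attain this maximum. Put $$|H\rangle=|H_0\rangle=\sqrt{\tfrac{2+\sqrt2}{4}}\,|0\rangle+\sqrt{\tfrac{2-\sqrt2}{4}}\,|1\rangle,$$ $$|T\rangle=|T_0\rangle=\sqrt{\tfrac{3+\sqrt3}{6}}\,|0\rangle+e^{i\pi/4}\sqrt{\tfrac{3-\sqrt3}{6}}\,|1\rangle,\qquad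 |T_1\rangle=-\sqrt{\tfrac{3-\sqrt3}{6}}\,|0\rangle+e^{i\pi/4}\sqrt{\tfrac{3+\sqrt3}{6}}\,|1\rangle,$$ $$|G_4,2\rangle=\frac{2|00\rangle+|01\rangle+|10\rangle}{\sqrt6}.$$ With $\alpha_\pm=\frac{1}{\sqrt{10}}\bigl(10+3\sqrt5\pm2\sqrt{5(5+2\sqrt5)}\bigr)^{1/4}$, $\beta_\pm=\frac{1}{\sqrt{10}}\bigl(10-3\sqrt5\pm2\sqrt{5(5-2\sqrt5)}\bigr)^{1/4}$, $\gamma_\pm=\bigl(5(3+\sqrt5)\pm\sqrt{250+110\sqrt5}\bigr)^{-1/2}$, $\delta_+=\frac12\sqrt{\frac{5+\sqrt5+\sqrt{2(5+\sqrt5)}}{5}}$, $\delta_-=\frac12\sqrt{1+\frac1{\sqrt5}-\frac15\sqrt{2(5+\sqrt5)}}$ and $\varepsilon=\frac12\sqrt{\frac{5-\sqrt5+\sqrt{10-2\sqrt5}}{5}}$, put $$\begin{aligned} |G_{16},1\rangle&=-\alpha_-e^{i\pi/4}|00\rangle+\alpha_+e^{i\pi/4}|01\rangle+i\gamma_+|10\rangle+\gamma_-|11\rangle,\\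 |G_{16},2\rangle&=-\beta_-e^{i\pi/4}|00\rangle-\beta_+e^{i\pi/4}|01\rangle+i\delta_+|10\rangle+\delta_-|11\rangle,\\ |G_{16},3\rangle&=\beta_+e^{i\pi/4}|00\rangle-\beta_-e^{i\pi/4}|01\rangle-i\delta_-|10\rangle+\delta_+|11\rangle,\\ |G_{16},4\rangle&=-\alpha_+e^{i\pi/4}|00\rangle-\alpha_-e^{i\pi/4}|01\rangle-i\varepsilon|10\rangle+\gamma_+|11\rangle, \end{aligned}$$ $$\begin{aligned} |G_{20},1\rangle&=\tfrac{1}{2\sqrt2}\bigl(i|00\rangle-i|01\rangle-(1+2i)|10\rangle+|11\rangle\bigr),\\ |G_{20},2\rangle&=\tfrac{1}{2\sqrt{10}}\bigl(-(2-i)|00\rangle-(2-i)|01\rangle+(1+2i)|10\rangle+5|11\rangle\bigr),\\ |G_{20},3\rangle&=\tfrac{1}{2\sqrt2}\bigl(-i|00\rangle+(2+i)|01\rangle-|10\rangle+|11\rangle\bigr),\\ |G_{20},4\rangle&=\tfrac{1}{2\sqrt2}\bigl((2-i)|00\rangle-i|01\rangle+|10\rangle+|11\rangle\bigr). \end{aligned}$$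 Consider the following table. | Row | States | Stabilizer fidelity | Number of nearest stabilizer states | |---|---|---|---| | 1 | $\lvert 00\rangle$ | $1$ | 1 | | 2 | $\lvert H0\rangle$ | $\frac{2+\sqrt2}{4}$ | 2 | | 3 | $\lvert T0\rangle$ | $\frac{3+\sqrt3}{6}$ | 3 | | 4 | $\lvert HH\rangle$ | $\frac{3+2\sqrt2}{8}$ | 4 | | 5 | $\lvert TH\rangle$ | $\frac{(2+\sqrt2)(3+\sqrt3)}{24}$ | 6 | | 6 | $\lvert TT\rangle$ | $\frac{2+\sqrt3}{6}$ | 9 | | 7 | $\frac{\lvert T_0T_0\rangle-\lvert T_1T_1\rangle}{\sqrt2}$, $\lvert G_4,2\rangle$ | $\frac34$ | 2 | | 8 | $\lvert G_{16},1\rangle$, $\lvert G_{16},2\rangle$, $\lvert G_{16},3\rangle$, $\lvert G_{16},4\rangle$ | $\frac{5+\sqrt5+2\sqrt{5+2\sqrt5}}{20}$ | 5 | | 9 | $\lvert G_{20},1\rangle$, $\lvert G_{20},2\rangle$, $\lvert G_{20},3\rangle$, $\lvert G_{20},4\rangle$ | $\frac58$ | 8 | Then: 1. A vector of $\mathcal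 H$ is a non-degenerate Clifford eigenstate if and only if it is Clifford-equivalent to a state of the table. 2. Two states of the table are Clifford-equivalent if and only if they are in the same row. 3. Every state of the table is a non-degenerate Clifford eigenstate, with the stabilizer fidelity (the maximum is attained) and the number of nearest stabilizer states given in its row. -/

import Mathlib

open scoped Matrix Kronecker

noncomputable section

namespace TwoQubit

/-- Operators on one qubit. -/
abbrev Op₁ : Type := Matrix (Fin 2) (Fin 2) ℂ

/-- Operators on two qubits; the first index is the first qubit. -/
abbrev Op : Type := Matrix (Fin 2 × Fin 2) (Fin 2 × Fin 2) ℂ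

/-- Vectors of the two-qubit space, given by their amplitudes in the computational basis.
The inner product `⟨φ|ψ⟩` is written `star φ ⬝ᵥ ψ`. -/
abbrev Ket : Type := Fin 2 × Fin 2 → ℂ

/-! ### Pauli and Clifford operators -/

/-- The one-qubit shift operator. -/
def pauliX : Op₁ := !![0, 1; 1, 0]

/-- The one-qubit phase operator. -/
def pauliZ : Op₁ := !![1, 0; 0, -1]

/-- The two-qubit Pauli group: all operators
`(-1)^x i^k (X^a₁ ⊗ X^a₂) (Z^b₁ ⊗ Z^b₂)` with `x, k, a₁, a₂, b₁, b₂ ∈ {0, 1}`. -/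
def pauliGroup : Set Op :=
  {P | ∃ x k a₁ a₂ b₁ b₂ : Fin 2,
    P = ((-1 : ℂ) ^ (x : ℕ) * Complex.I ^ (k : ℕ)) •
      (((pauliX ^ (a₁ : ℕ)) ⊗ₖ (pauliX ^ (a₂ : ℕ))) *
        ((pauliZ ^ (b₁ : ℕ)) ⊗ₖ (pauliZ ^ (b₂ : ℕ))))}

/-- Clifford operations: unitaries that map the Pauli group to itself under conjugation. -/
def IsClifford (C : Op) : Prop :=
  C ∈ Matrix.unitaryGroup (Fin 2 × Fin 2) ℂ ∧ ∀ P ∈ pauliGroup, C * P * Cᴴ ∈ pauliGroup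

/-- `ψ` is a unit vector. -/
def IsState (ψ : Ket) : Prop := star ψ ⬝ᵥ ψ = 1

/-- Two state vectors are Clifford-equivalent if a Clifford operation maps one to the other.
Global phases are Clifford operations, so this is a relation between physical states. -/
def CliffordEquiv (ψ φ : Ket) : Prop := ∃ C : Op, IsClifford C ∧ C *ᵥ ψ = φ

/-- `ψ` is a unit vector spanning a one-dimensional eigenspace of some Clifford operation. -/
def IsNondegenerateCliffordEigenstate (ψ : Ket) : Prop :=
  IsState ψ ∧ ∃ (C : Op) (c : ℂ), IsClifford C ∧
    ψ ∈ Module.End.eigenspace (Matrix.toLin' C) c ∧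
    Module.finrank ℂ (Module.End.eigenspace (Matrix.toLin' C) c) = 1

/-! ### Stabilizer states and the stabilizer fidelity -/

/-- A stabilizer state: a common eigenvector, for the eigenvalue `1`, of all elements of an
abelian subgroup of order `4 = 2 ^ 2` of the Pauli group. -/
def IsStabilizerState (s : Ket) : Prop :=
  IsState s ∧ ∃ S : Subgroup (Matrix.unitaryGroup (Fin 2 × Fin 2) ℂ),
    (∀ g ∈ S, (g : Op) ∈ pauliGroup) ∧
    (∀ g ∈ S, ∀ h ∈ S, g * h = h * g) ∧
    Nat.card S = 4 ∧
    ∀ g ∈ S, (g : Op) *ᵥ s = s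

/-- The squared overlaps `|⟨ψ|s⟩|²` of `ψ` with the stabilizer states `s`. -/
def stabilizerOverlaps (ψ : Ket) : Set ℝ :=
  {x | ∃ s : Ket, IsStabilizerState s ∧ x = ‖star ψ ⬝ᵥ s‖ ^ 2}

/-- The stabilizer fidelity, the largest squared overlap with a stabilizer state. -/
def stabilizerFidelity (ψ : Ket) : ℝ := sSup (stabilizerOverlaps ψ)

/-- The density operator `|ψ⟩⟨ψ|`; it determines the state vector up to a global phase. -/
def density (ψ : Ket) : Op := Matrix.vecMulVec ψ (star ψ)

/-- The nearest stabilizer states to `ψ`, as density operators, so that stabilizer state vectors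
that differ by a global phase are identified. -/
def nearestStabilizerStates (ψ : Ket) : Set Op :=
  {ρ | ∃ s : Ket, IsStabilizerState s ∧ ‖star ψ ⬝ᵥ s‖ ^ 2 = stabilizerFidelity ψ ∧
    ρ = density s}

/-! ### The states -/

/-- The vector `a|00⟩ + b|01⟩ + c|10⟩ + d|11⟩`. -/
def ket (a b c d : ℂ) : Ket := fun p => !![a, b; c, d] p.1 p.2

/-- The tensor product of two one-qubit vectors. -/
def tensor (u v : Fin 2 → ℂ) : Ket := fun p => u p.1 * v p.2

/-- The phase `e^{iπ/4}`. -/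
def phase : ℂ := Complex.exp (Complex.I * Real.pi / 4)

def zero : Fin 2 → ℂ := ![1, 0]

def hZero : Fin 2 → ℂ := ![(√((2 + √2) / 4) : ℝ), (√((2 - √2) / 4) : ℝ)]

def tZero : Fin 2 → ℂ := ![(√((3 + √3) / 6) : ℝ), phase * (√((3 - √3) / 6) : ℝ)]

def tOne : Fin 2 → ℂ := ![-(√((3 - √3) / 6) : ℝ), phase * (√((3 + √3) / 6) : ℝ)]

/-- The state `(|T₀T₀⟩ - |T₁T₁⟩) / √2`. -/
def tMinus : Ket := ((1 / √2 : ℝ) : ℂ) • (tensor tZero tZero - tensor tOne tOne)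

/-- The state `(2|00⟩ + |01⟩ + |10⟩) / √6`. -/
def g4two : Ket := ((1 / √6 : ℝ) : ℂ) • ket 2 1 1 0

/-- The real fourth root of a nonnegative real number. -/
def fourthRoot (x : ℝ) : ℝ := √(√x)

def g16one : Ket := ket
  (-(fourthRoot (10 + 3 * √5 - 2 * √(5 * (5 + 2 * √5))) / √10 : ℝ) * phase)
  ((fourthRoot (10 + 3 * √5 + 2 * √(5 * (5 + 2 * √5))) / √10 : ℝ) * phase)
  (Complex.I * (1 / √(5 * (3 + √5) + √(250 + 110 * √5)) : ℝ))
  ((1 / √(5 * (3 + √5) - √(250 + 110 * √5)) : ℝ))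

def g16two : Ket := ket
  (-(fourthRoot (10 - 3 * √5 - 2 * √(5 * (5 - 2 * √5))) / √10 : ℝ) * phase)
  (-(fourthRoot (10 - 3 * √5 + 2 * √(5 * (5 - 2 * √5))) / √10 : ℝ) * phase)
  (Complex.I * (1 / 2 * √((5 + √5 + √(2 * (5 + √5))) / 5) : ℝ))
  ((1 / 2 * √(1 + 1 / √5 - 1 / 5 * √(2 * (5 + √5))) : ℝ))

def g16three : Ket := ket
  ((fourthRoot (10 - 3 * √5 + 2 * √(5 * (5 - 2 * √5))) / √10 : ℝ) * phase)
  (-(fourthRoot (10 - 3 * √5 - 2 * √(5 * (5 - 2 * √5))) / √10 : ℝ) * phase)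
  (-Complex.I * (1 / 2 * √(1 + 1 / √5 - 1 / 5 * √(2 * (5 + √5))) : ℝ))
  ((1 / 2 * √((5 + √5 + √(2 * (5 + √5))) / 5) : ℝ))

def g16four : Ket := ket
  (-(fourthRoot (10 + 3 * √5 + 2 * √(5 * (5 + 2 * √5))) / √10 : ℝ) * phase)
  (-(fourthRoot (10 + 3 * √5 - 2 * √(5 * (5 + 2 * √5))) / √10 : ℝ) * phase)
  (-Complex.I * (1 / 2 * √((5 - √5 + √(10 - 2 * √5)) / 5) : ℝ))
  ((1 / √(5 * (3 + √5) + √(250 + 110 * √5)) : ℝ))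

def g20one : Ket := ((1 / (2 * √2) : ℝ) : ℂ) •
  ket Complex.I (-Complex.I) (-(1 + 2 * Complex.I)) 1

def g20two : Ket := ((1 / (2 * √10) : ℝ) : ℂ) •
  ket (-(2 - Complex.I)) (-(2 - Complex.I)) (1 + 2 * Complex.I) 5

def g20three : Ket := ((1 / (2 * √2) : ℝ) : ℂ) •
  ket (-Complex.I) (2 + Complex.I) (-1) 1

def g20four : Ket := ((1 / (2 * √2) : ℝ) : ℂ) •
  ket (2 - Complex.I) (-Complex.I) 1 1

/-- The states in each of the nine rows of the table. The rows contain, in order,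
`|00⟩`; `|H0⟩`; `|T0⟩`; `|HH⟩`; `|TH⟩`; `|TT⟩`; `(|T₀T₀⟩ - |T₁T₁⟩)/√2` and `|G₄,2⟩`;
`|G₁₆,i⟩` for `1 ≤ i ≤ 4`; `|G₂₀,i⟩` for `1 ≤ i ≤ 4`. -/
def tableStates : Fin 9 → Set Ket :=
  ![{tensor zero zero},
    {tensor hZero zero},
    {tensor tZero zero},
    {tensor hZero hZero},
    {tensor tZero hZero},
    {tensor tZero tZero},
    {tMinus, g4two},
    {g16one, g16two, g16three, g16four},
    {g20one, g20two, g20three, g20four}]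

/-- The stabilizer fidelities in the rows of the table. -/
def tableFidelity : Fin 9 → ℝ :=
  ![1,
    (2 + √2) / 4,
    (3 + √3) / 6,
    (3 + 2 * √2) / 8,
    (2 + √2) * (3 + √3) / 24,
    (2 + √3) / 6,
    3 / 4,
    (5 + √5 + 2 * √(5 + 2 * √5)) / 20,
    5 / 8]

/-- The numbers of nearest stabilizer states in the rows of the table. -/
def tableCount : Fin 9 → ℕ := ![1, 2, 3, 4, 6, 9, 2, 5, 8]

end TwoQubit

end

open scoped Matrix Kronecker

noncomputable section

namespace TwoQubit

open Matrix

/-! ### Gaussian integer matrices -/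

/-! The action `A ↦ C A Cᵀ` on antisymmetric `4 × 4` matrices realises the isomorphism `SU(4)/±1 ≅
SO(6)`. In the basis `gam` of this six-dimensional space, the fifteen nontrivial Pauli operators
are, up to phases, the generators `bil i j` of the rotations in the fifteen coordinate planes. A
unit vector `ψ` is encoded by the real antisymmetric matrix `J = cs ψ` of its Pauli expectation
values. It satisfies `J² = -1` (`cs_mul_self`), determines `ψ` up to a phase (`eq_smul_of_cs_eq`),
and turns squared overlaps into inner products of such matrices (`overlap_eq`).

Clifford operations become signed permutations of the six coordinates
(`IsClifford.exists_implements`), and every signed permutation of determinant one occurs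
(`realizable_of_signedDet`). The complex structures of states all have the same orientation, so a
signed permutation relating two of them has determinant one automatically (`signedDet_eq_one`).
Clifford equivalence of states is therefore equivalence of complex structures under signed
permutations (`cliffordEquiv_of_signedConj`).

The antisymmetric matrices fixed by the signed permutation of `C` form the Lie algebra of the
centralizer of `C`. The state `ψ` spans an eigenspace of `C` exactly when `J` is fixed as well and
commutes with this whole algebra (`central_of_nondegenerate`, `nondegenerate_of_central`). This
makes the classification finite: up to a change of basis only the cycle type of the permutation and
the product of the signs along each cycle matter. For each of the eleven cycle types, the
fixed-point equations, centrality and `J² = -1` either contradict each other or force `J` into one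
of nine forms `rowForm` (`isRow_of_central`). Conversely each of these forms is central for an
explicit signed permutation (`central_rowForm`), and each listed state has the form of its row
(`hasRow_of_mem_tableStates`).

The complex structure of a stabilizer state is a perfect matching of the six coordinates with signs,
the third sign being forced by orientation. This gives `15 · 4 = 60` states
(`IsStabilizerState.exists_label`, `exists_stabilizerState`), and an overlap is a quarter of one
plus a signed sum of three entries of `J`. The fidelity is thus a maximum over sixty numbers
(`stabilizer_data_of_bounds`). The nine fidelities are distinct and Clifford invariant, so different
rows are inequivalent. -/

/-- Two-qubit operators with Gaussian integer entries, for which identities are decidable. -/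
abbrev IntOp : Type := Matrix (Fin 2 × Fin 2) (Fin 2 × Fin 2) GaussianInt

def IntOp.toOp : IntOp →+* Op := GaussianInt.toComplex.mapMatrix

lemma toOp_apply (A : IntOp) (p q : Fin 2 × Fin 2) :
    IntOp.toOp A p q = GaussianInt.toComplex (A p q) := rfl

lemma toOp_transpose (A : IntOp) : IntOp.toOp Aᵀ = (IntOp.toOp A)ᵀ := rfl

lemma toOp_conjTranspose (A : IntOp) : IntOp.toOp Aᴴ = (IntOp.toOp A)ᴴ := by
  ext p q
  simp [toOp_apply, GaussianInt.toComplex_star]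

/-! ### Six antisymmetric matrices and the Clifford relations -/

/-- These are the six tensor products of Pauli matrices with exactly one antisymmetric factor. The
first three anticommute with each other, so do the last three, and members of different triples
commute. The factor `i` on the last triple turns these commutations into the uniform relation `gam i
* (gam j)ᴴ + gam j * (gam i)ᴴ = 2δ`. -/
def gammaInt : Fin 6 → IntOp :=
  let e : Matrix (Fin 2) (Fin 2) GaussianInt := !![0, 1; -1, 0]
  let x : Matrix (Fin 2) (Fin 2) GaussianInt := !![0, 1; 1, 0]
  let z : Matrix (Fin 2) (Fin 2) GaussianInt := !![1, 0; 0, -1]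
  let i : GaussianInt := ⟨0, 1⟩
  ![fun p q => (1 : Matrix (Fin 2) (Fin 2) GaussianInt) p.1 q.1 * e p.2 q.2,
    fun p q => e p.1 q.1 * x p.2 q.2,
    fun p q => e p.1 q.1 * z p.2 q.2,
    fun p q => i * (e p.1 q.1 * (1 : Matrix (Fin 2) (Fin 2) GaussianInt) p.2 q.2),
    fun p q => i * (x p.1 q.1 * e p.2 q.2),
    fun p q => i * (z p.1 q.1 * e p.2 q.2)]

/-- An orthonormal basis of the antisymmetric matrices, consisting of Pauli operators.
The map `A ↦ C A Cᵀ` is the six-dimensional representation of `SU(4)`. -/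
def gam (k : Fin 6) : Op := IntOp.toOp (gammaInt k)

lemma gam_transpose (k : Fin 6) : (gam k)ᵀ = -gam k := by
  have : ∀ k, (gammaInt k)ᵀ = -gammaInt k := by decide +kernel
  rw [gam, ← toOp_transpose, this, map_neg]

lemma toOp_delta (i j : Fin 6) :
    IntOp.toOp (if i = j then 2 else 0) = (if i = j then 2 else 0 : ℂ) • (1 : Op) := by
  split_ifs
  · rw [map_ofNat, two_smul, one_add_one_eq_two]
  · simp

/-- The Clifford relation is solved for one product, so that it can serve as a rewriting rule
exchanging two indices. -/
lemma gam_mul_conjTranspose (i j : Fin 6) :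
    gam i * (gam j)ᴴ = (if i = j then 2 else 0 : ℂ) • 1 - gam j * (gam i)ᴴ := by
  have : ∀ i j, gammaInt i * (gammaInt j)ᴴ =
      (if i = j then 2 else 0) - gammaInt j * (gammaInt i)ᴴ := by decide +kernel
  simp only [gam, ← toOp_conjTranspose, ← map_mul, this i j, map_sub, toOp_delta]

lemma gam_conjTranspose_mul (i j : Fin 6) :
    (gam i)ᴴ * gam j = (if i = j then 2 else 0 : ℂ) • 1 - (gam j)ᴴ * gam i := by
  have : ∀ i j, (gammaInt i)ᴴ * gammaInt j =
      (if i = j then 2 else 0) - (gammaInt j)ᴴ * gammaInt i := by decide +kernel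
  simp only [gam, ← toOp_conjTranspose, ← map_mul, this i j, map_sub, toOp_delta]

lemma gam_mul_conjTranspose_self (i : Fin 6) : gam i * (gam i)ᴴ = 1 := by
  have : ∀ i, gammaInt i * (gammaInt i)ᴴ = 1 := by decide +kernel
  simp only [gam, ← toOp_conjTranspose, ← map_mul, this i, map_one]

lemma gam_conjTranspose_mul_self (i : Fin 6) : (gam i)ᴴ * gam i = 1 := by
  have : ∀ i, (gammaInt i)ᴴ * gammaInt i = 1 := by decide +kernel
  simp only [gam, ← toOp_conjTranspose, ← map_mul, this i, map_one]

/-- For `i ≠ j` the anti-Hermitian Pauli operator generating rotations in the plane `i, j`. -/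
def bil (i j : Fin 6) : Op := gam i * (gam j)ᴴ

lemma bil_self (i : Fin 6) : bil i i = 1 := gam_mul_conjTranspose_self i

lemma bil_conjTranspose (i j : Fin 6) : (bil i j)ᴴ = bil j i := by
  simp [bil, conjTranspose_mul]

lemma bil_swap {i j : Fin 6} (h : i ≠ j) : bil j i = -bil i j := by
  rw [bil, bil, gam_mul_conjTranspose j i]; simp [h.symm]

lemma bil_mul_self {i j : Fin 6} (h : i ≠ j) : bil i j * bil i j = -1 := by
  have h1 : bil i j * bil j i = 1 := by
    rw [bil, bil, Matrix.mul_assoc, ← Matrix.mul_assoc _ (gam j), gam_conjTranspose_mul_self,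
      Matrix.one_mul, gam_mul_conjTranspose_self]
  rw [bil_swap h] at h1
  rw [← h1]; simp

/-- These are the structure constants of `so(6)`. Four applications of the Clifford relations carry
`bil k l` past `bil i j`, and each contraction leaves one Kronecker delta. -/
lemma bil_commutator (i j k l : Fin 6) :
    bil i j * bil k l - bil k l * bil i j =
      (if j = k then 2 else 0 : ℂ) • bil i l - (if i = k then 2 else 0 : ℂ) • bil j l
       + (if j = l then 2 else 0 : ℂ) • bil k i - (if i = l then 2 else 0 : ℂ) • bil k j := by
  have e1 : bil i j * bil k l = gam i * ((gam j)ᴴ * gam k) * (gam l)ᴴ := by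
    simp only [bil, Matrix.mul_assoc]
  have e2 : gam i * ((gam k)ᴴ * gam j) * (gam l)ᴴ =
      (gam i * (gam k)ᴴ) * (gam j * (gam l)ᴴ) := by simp only [Matrix.mul_assoc]
  have e3 : gam k * (gam i)ᴴ * (gam j * (gam l)ᴴ) =
      (if j = l then 2 else 0 : ℂ) • bil k i - gam k * ((gam i)ᴴ * gam l) * (gam j)ᴴ := by
    rw [gam_mul_conjTranspose j l]
    simp only [bil, Matrix.mul_sub, Matrix.mul_smul, Matrix.mul_one, Matrix.mul_assoc]
  have e4 : gam k * ((gam i)ᴴ * gam l) * (gam j)ᴴ =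
      (if i = l then 2 else 0 : ℂ) • bil k j - bil k l * bil i j := by
    rw [gam_conjTranspose_mul i l]
    simp only [bil, Matrix.mul_sub, Matrix.sub_mul, Matrix.mul_smul, Matrix.smul_mul,
      Matrix.mul_one, Matrix.mul_assoc]
  rw [e1, gam_conjTranspose_mul j k, Matrix.mul_sub, Matrix.sub_mul, e2,
    gam_mul_conjTranspose i k, Matrix.sub_mul, e3, e4]
  simp only [Matrix.smul_mul, Matrix.mul_smul, Matrix.one_mul, Matrix.mul_one]
  simp only [bil]
  abel

/-! ### Completeness -/

/-- With the identity, the fifteen Pauli operators are an orthogonal basis of all operators. Ordered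
pairs count each of them twice, and being anti-Hermitian they enter with the opposite of the usual
sign. -/
lemma bil_completeness (p q r s : Fin 2 × Fin 2) :
    ∑ i, ∑ j, (if i = j then 0 else bil i j p q * bil i j r s) =
      (if p = q ∧ r = s then 2 else 0) - (if p = s ∧ q = r then 8 else 0) := by
  have : ∀ p q r s : Fin 2 × Fin 2,
    ∑ i, ∑ j, (if i = j then 0 else (gammaInt i * (gammaInt j)ᴴ) p q *
      (gammaInt i * (gammaInt j)ᴴ) r s) =
      (if p = q ∧ r = s then 2 else 0) - (if p = s ∧ q = r then 8 else 0) := by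
    decide +kernel
  have h := congrArg GaussianInt.toComplex (this p q r s)
  simp only [map_sum, apply_ite GaussianInt.toComplex, map_zero, map_mul, map_sub, map_ofNat] at h
  rw [← h]
  simp only [bil, gam, ← toOp_conjTranspose, ← map_mul, toOp_apply]

/-! ### The complex structure of a state -/

/-- The expectation value `⟨ψ|A|ψ⟩`. -/
def ev (ψ : Ket) (A : Op) : ℂ := star ψ ⬝ᵥ (A *ᵥ ψ)

lemma ev_add (ψ : Ket) (A B : Op) : ev ψ (A + B) = ev ψ A + ev ψ B := by
  simp [ev, add_mulVec, dotProduct_add]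

lemma ev_sub (ψ : Ket) (A B : Op) : ev ψ (A - B) = ev ψ A - ev ψ B := by
  simp [ev, sub_mulVec, dotProduct_sub]

lemma ev_smul (ψ : Ket) (c : ℂ) (A : Op) : ev ψ (c • A) = c * ev ψ A := by
  simp [ev, smul_mulVec, dotProduct_smul]

lemma ev_sum {ι : Type*} (s : Finset ι) (ψ : Ket) (A : ι → Op) :
    ev ψ (∑ i ∈ s, A i) = ∑ i ∈ s, ev ψ (A i) := by
  simp [ev, sum_mulVec, dotProduct_sum]

lemma ev_one (ψ : Ket) : ev ψ 1 = star ψ ⬝ᵥ ψ := by simp [ev]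

lemma star_ev (ψ : Ket) (A : Op) : star (ev ψ A) = ev ψ Aᴴ := by
  rw [ev, ev, star_dotProduct, star_star, star_mulVec, dotProduct_comm, dotProduct_mulVec]
  exact dotProduct_comm _ _

lemma ev_mulVec (ψ : Ket) (A C : Op) : ev (C *ᵥ ψ) A = ev ψ (Cᴴ * A * C) := by
  simp [ev, star_mulVec, dotProduct_mulVec, Matrix.mul_assoc]

/-- The real antisymmetric `6 × 6` matrix of the expectation values of the two-qubit Pauli
operators. For a unit vector it is an orthogonal complex structure on `ℝ⁶`, and it determines the
vector up to a phase. -/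
def cs (ψ : Ket) : Matrix (Fin 6) (Fin 6) ℝ :=
  -- The diagonal has to be set to zero separately, because `bil i i` is the identity.
  fun i j => if i = j then 0 else (Complex.I * ev ψ (bil i j)).re

lemma coe_cs (ψ : Ket) {i j : Fin 6} (h : i ≠ j) :
    (cs ψ i j : ℂ) = Complex.I * ev ψ (bil i j) := by
  have h1 : star (Complex.I * ev ψ (bil i j)) = Complex.I * ev ψ (bil i j) := by
    rw [star_mul', star_ev, bil_conjTranspose, bil_swap h, ev, ev, neg_mulVec, dotProduct_neg]
    simp
  simp only [cs, h, if_false]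
  exact Complex.conj_eq_iff_re.mp h1

lemma ev_bil (ψ : Ket) (i j : Fin 6) :
    ev ψ (bil i j) = -Complex.I * cs ψ i j + if i = j then star ψ ⬝ᵥ ψ else 0 := by
  by_cases h : i = j
  · subst h; simp [cs, bil_self, ev_one]
  · rw [coe_cs ψ h, ← mul_assoc]; simp [h]

lemma cs_transpose (ψ : Ket) : (cs ψ)ᵀ = -cs ψ := by
  ext i j
  by_cases h : i = j
  · subst h; simp [cs]
  · rw [transpose_apply, neg_apply]
    apply Complex.ofReal_injective
    rw [coe_cs ψ (Ne.symm h), Complex.ofReal_neg, coe_cs ψ h, bil_swap h, ev, ev, neg_mulVec,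
      dotProduct_neg, mul_neg]

lemma cs_swap (ψ : Ket) (i j : Fin 6) : cs ψ j i = -cs ψ i j := congrFun₂ (cs_transpose ψ) i j

lemma cs_self (ψ : Ket) (i : Fin 6) : cs ψ i i = 0 := by simp [cs]

/-- The element of the Lie algebra `su(4) ≅ so(6)` given by an antisymmetric matrix. -/
def hat (K : Matrix (Fin 6) (Fin 6) ℝ) : Op := ∑ i, ∑ j, (K i j : ℂ) • bil i j

lemma hat_conjTranspose (K : Matrix (Fin 6) (Fin 6) ℝ) : (hat K)ᴴ = hat Kᵀ := by
  simp only [hat, conjTranspose_sum, conjTranspose_smul, bil_conjTranspose, transpose_apply]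
  rw [Finset.sum_comm]
  simp

lemma sum_comm₄ {α β γ δ M : Type*} [Fintype α] [Fintype β] [Fintype γ] [Fintype δ]
    [AddCommMonoid M] (F : α → β → γ → δ → M) :
    ∑ i, ∑ j, ∑ r, ∑ s, F i j r s = ∑ r, ∑ s, ∑ i, ∑ j, F i j r s := by
  calc _ = ∑ x : α × β, ∑ y : γ × δ, F x.1 x.2 y.1 y.2 := by simp only [Fintype.sum_prod_type]
    _ = ∑ y : γ × δ, ∑ x : α × β, F x.1 x.2 y.1 y.2 := Finset.sum_comm
    _ = _ := by simp only [Fintype.sum_prod_type]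

/-- This is the Pauli expansion of the density operator. `hat` sums over ordered pairs, so each
Pauli operator occurs twice; hence the factor `1/2`. -/
lemma density_eq (ψ : Ket) :
    (4 : ℂ) • density ψ = (star ψ ⬝ᵥ ψ) • 1 + (Complex.I / 2) • hat (cs ψ) := by
  ext p q
  have h1 : ∀ i j, (cs ψ i j : ℂ) * bil i j p q =
      Complex.I * ∑ r, ∑ s, (star ψ r * ψ s) * (if i = j then 0 else bil i j p q * bil i j r s) := by
    intro i j
    by_cases h : i = j
    · simp [h, cs]
    · rw [coe_cs ψ h, ev]
      simp only [h, if_false, dotProduct, mulVec, Finset.mul_sum, Finset.sum_mul]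
      refine Finset.sum_congr rfl fun r _ => Finset.sum_congr rfl fun s _ => by ring
  have h2 : hat (cs ψ) p q = Complex.I * ∑ r, ∑ s, (star ψ r * ψ s) *
      ((if p = q ∧ r = s then 2 else 0) - (if p = s ∧ q = r then 8 else 0)) := by
    simp only [hat, Matrix.sum_apply, Matrix.smul_apply, smul_eq_mul, h1, ← bil_completeness,
      Finset.mul_sum]
    rw [sum_comm₄]
  rw [Matrix.add_apply, Matrix.smul_apply, Matrix.smul_apply, Matrix.smul_apply, h2, density,
    vecMulVec_apply, one_apply]
  simp only [mul_sub, Finset.sum_sub_distrib, ite_and, mul_ite, mul_zero, Finset.sum_ite_eq,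
    Finset.mem_univ, if_true, smul_eq_mul, dotProduct, Pi.star_apply]
  by_cases h : p = q
  · simp only [h, if_true, Finset.sum_ite_eq, Finset.mem_univ, Finset.sum_ite_irrel,
      Finset.sum_const_zero]
    simp only [← Finset.sum_mul]
    linear_combination (4 * ψ q * star (ψ q) - ∑ i, star (ψ i) * ψ i) * Complex.I_sq
  · simp [h]
    linear_combination (4 * ψ p * (starRingEnd ℂ) (ψ q)) * Complex.I_sq

/-! ### The Lie bracket of `so(6)` in terms of operators -/

lemma hat_commutator_bil {K : Matrix (Fin 6) (Fin 6) ℝ} (hK : Kᵀ = -K) (i l : Fin 6) :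
    hat K * bil i l - bil i l * hat K =
      (4 : ℂ) • ∑ a, ((K a l : ℂ) • bil i a - (K i a : ℂ) • bil a l) := by
  have hs : ∀ a b, K b a = -K a b := fun a b => congrFun₂ hK a b
  have h1 : hat K * bil i l - bil i l * hat K =
      ∑ a, ∑ b, (K a b : ℂ) • (bil a b * bil i l - bil i l * bil a b) := by
    simp only [hat, Matrix.sum_mul, Matrix.mul_sum, smul_sub, Finset.sum_sub_distrib,
      Matrix.smul_mul, Matrix.mul_smul]
  rw [h1]
  simp only [bil_commutator, smul_add, smul_sub, Finset.sum_add_distrib, Finset.sum_sub_distrib,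
    smul_smul, smul_ite, smul_zero, ite_smul, zero_smul, Finset.sum_ite_eq, Finset.sum_ite_eq',
    Finset.mem_univ, if_true, Finset.sum_ite_irrel, Finset.sum_const_zero]
  simp only [hs i, hs l, ← Finset.sum_sub_distrib, ← Finset.sum_add_distrib, Finset.smul_sum]
  refine Finset.sum_congr rfl fun a _ => ?_
  rw [hs a i, hs a l]
  push_cast
  module

/-- On antisymmetric matrices `K ↦ hat K / 4` is a homomorphism from `so(6)` to `su(4)`, so
commuting matrices give commuting operators. -/
lemma hat_commutator {K : Matrix (Fin 6) (Fin 6) ℝ} (hK : Kᵀ = -K)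
    (L : Matrix (Fin 6) (Fin 6) ℝ) :
    hat K * hat L - hat L * hat K = (4 : ℂ) • hat (K * L - L * K) := by
  have hs : ∀ a b, K b a = -K a b := fun a b => congrFun₂ hK a b
  have h1 : hat K * hat L - hat L * hat K =
      ∑ i, ∑ l, (L i l : ℂ) • (hat K * bil i l - bil i l * hat K) := by
    have h2 : hat L = ∑ i, ∑ l, (L i l : ℂ) • bil i l := rfl
    simp only [h2, Matrix.sum_mul, Matrix.mul_sum, smul_sub, Finset.sum_sub_distrib,
      Matrix.smul_mul, Matrix.mul_smul]
  rw [h1]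
  simp only [hat_commutator_bil hK]
  have e1 : ∑ i, ∑ l, ∑ a, ((L i l : ℂ) * (4 * K a l)) • bil i a =
      -(4 : ℂ) • hat (L * K) := by
    simp only [hat, Finset.smul_sum]
    refine Finset.sum_congr rfl fun i _ => ?_
    rw [Finset.sum_comm]
    refine Finset.sum_congr rfl fun a _ => ?_
    rw [← Finset.sum_smul, smul_smul, Matrix.mul_apply, Complex.ofReal_sum, Finset.mul_sum]
    congr 1
    refine Finset.sum_congr rfl fun l _ => ?_
    rw [hs l a]
    push_cast
    ring
  have e2 : ∑ i, ∑ l, ∑ a, ((L i l : ℂ) * (4 * K i a)) • bil a l =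
      -(4 : ℂ) • hat (K * L) := by
    simp only [hat, Finset.smul_sum]
    rw [Finset.sum_comm, Finset.sum_congr rfl fun _ _ => Finset.sum_comm, Finset.sum_comm]
    refine Finset.sum_congr rfl fun a _ => Finset.sum_congr rfl fun l _ => ?_
    rw [← Finset.sum_smul, smul_smul, Matrix.mul_apply, Complex.ofReal_sum, Finset.mul_sum]
    congr 1
    refine Finset.sum_congr rfl fun i _ => ?_
    rw [hs a i]
    push_cast
    ring
  have e3 : hat (K * L - L * K) = hat (K * L) - hat (L * K) := by
    simp only [hat, Matrix.sub_apply, Complex.ofReal_sub, sub_smul, Finset.sum_sub_distrib]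
  simp only [Finset.smul_sum, smul_sub, smul_smul, Finset.sum_sub_distrib, mul_assoc]
  rw [e1, e2, e3]
  module

lemma density_mulVec (ψ φ : Ket) : density ψ *ᵥ φ = (star ψ ⬝ᵥ φ) • ψ := by
  ext p
  simp only [density, mulVec, dotProduct, vecMulVec_apply, Pi.smul_apply, smul_eq_mul,
    Finset.sum_mul]
  exact Finset.sum_congr rfl fun q _ => by ring

/-! ### Overlaps, and recovering a state from its complex structure -/

lemma ev_density (ψ φ : Ket) : ev φ (density ψ) = ((‖star ψ ⬝ᵥ φ‖ ^ 2 : ℝ) : ℂ) := by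
  rw [ev, density_mulVec, dotProduct_smul, ← star_star (star φ ⬝ᵥ ψ), ← star_dotProduct,
    smul_eq_mul]
  push_cast
  rw [← Complex.mul_conj']
  rfl

/-- The squared overlap of two states in terms of their complex structures. -/
lemma overlap_eq {ψ φ : Ket} (hψ : IsState ψ) (hφ : IsState φ) :
    ‖star ψ ⬝ᵥ φ‖ ^ 2 = (1 + (∑ i, ∑ j, cs ψ i j * cs φ i j) / 2) / 4 := by
  have h := congrArg (ev φ) (density_eq ψ)
  rw [ev_smul, ev_density, ev_add, ev_smul, ev_smul, ev_one, hψ, hφ, hat, ev_sum] at h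
  simp only [ev_sum, ev_smul, ev_bil] at h
  have h2 : ∑ x, ∑ y, ((cs ψ x y : ℂ) *
      (-Complex.I * (cs φ x y) + if x = y then star φ ⬝ᵥ φ else 0)) =
      -Complex.I * ∑ x, ∑ y, ((cs ψ x y : ℂ) * cs φ x y) := by
    simp only [Finset.mul_sum]
    refine Finset.sum_congr rfl fun x _ => Finset.sum_congr rfl fun y _ => ?_
    by_cases hxy : x = y
    · subst hxy; simp [cs_self]
    · simp [hxy]; ring
  rw [h2] at h
  apply Complex.ofReal_injective
  push_cast at h ⊢
  linear_combination h / 4 - (∑ x, ∑ y, (cs ψ x y : ℂ) * cs φ x y) / 8 * Complex.I_sq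

lemma eq_smul_of_density_eq {ψ φ : Ket} (hψ : IsState ψ) (hφ : IsState φ)
    (h : density ψ = density φ) : ∃ c : ℂ, star c * c = 1 ∧ ψ = c • φ := by
  have h1 : ψ = (star φ ⬝ᵥ ψ) • φ := by
    rw [← density_mulVec, ← h, density_mulVec, hψ, one_smul]
  refine ⟨_, ?_, h1⟩
  have h2 : star ψ ⬝ᵥ ψ = 1 := hψ
  rw [h1] at h2
  rw [star_smul, smul_dotProduct, dotProduct_smul, hφ] at h2
  simpa using h2

lemma eq_smul_of_cs_eq {ψ φ : Ket} (hψ : IsState ψ) (hφ : IsState φ) (h : cs ψ = cs φ) :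
    ∃ c : ℂ, star c * c = 1 ∧ ψ = c • φ := by
  refine eq_smul_of_density_eq hψ hφ ?_
  have h1 := density_eq ψ
  rw [h, hψ, ← (hφ : star φ ⬝ᵥ φ = 1), ← density_eq φ] at h1
  exact smul_right_injective _ (by norm_num : (4 : ℂ) ≠ 0) h1

lemma cs_smul (c : ℂ) (ψ : Ket) : cs (c • ψ) = (‖c‖ ^ 2) • cs ψ := by
  have h : ∀ A, ev (c • ψ) A = (‖c‖ ^ 2 : ℝ) * ev ψ A := by
    intro A
    rw [ev, ev, star_smul, smul_dotProduct, mulVec_smul, dotProduct_smul, smul_smul, smul_eq_mul]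
    push_cast
    rw [← Complex.conj_mul']
    rfl
  ext i j
  simp only [cs, Matrix.smul_apply, smul_eq_mul]
  split_ifs
  · simp
  · rw [h, mul_left_comm, Complex.re_ofReal_mul]

lemma norm_eq_one_of_star_mul {c : ℂ} (h : star c * c = 1) : ‖c‖ ^ 2 = 1 := by
  have : ((‖c‖ ^ 2 : ℝ) : ℂ) = 1 := by
    push_cast; rw [← Complex.conj_mul']; exact h
  exact_mod_cast this

/-! ### The square of the complex structure -/

lemma gam_completeness (a q r b : Fin 2 × Fin 2) :
    ∑ j, (gam j)ᴴ a q * gam j r b =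
      2 * ((if a = b then 1 else 0) * (if q = r then 1 else 0) -
        (if a = r then 1 else 0) * (if q = b then 1 else 0)) := by
  have : ∀ a q r b : Fin 2 × Fin 2, ∑ j, (gammaInt j)ᴴ a q * gammaInt j r b =
      2 * ((if a = b then 1 else 0) * (if q = r then 1 else 0) -
        (if a = r then 1 else 0) * (if q = b then 1 else 0)) := by
    decide +kernel
  have h := congrArg GaussianInt.toComplex (this a q r b)
  simp only [map_sum, apply_ite GaussianInt.toComplex, map_zero, map_mul, map_sub, map_ofNat,
    map_one] at h
  rw [← h]
  simp only [gam, ← toOp_conjTranspose, toOp_apply]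

/-- An antisymmetric matrix defines an alternating form. This is what makes one of the two terms of
the completeness relation drop out for pure states. -/
lemma gam_mulVec_dotProduct (k : Fin 6) (x : Ket) : x ⬝ᵥ (gam k *ᵥ x) = 0 := by
  have h : x ⬝ᵥ (gam k *ᵥ x) = -(x ⬝ᵥ (gam k *ᵥ x)) := by
    conv_lhs => rw [dotProduct_mulVec, ← mulVec_transpose, gam_transpose, neg_mulVec,
      neg_dotProduct, dotProduct_comm]
  exact self_eq_neg.mp h

lemma sum_mul_sum₄ {α β γ δ : Type*} [Fintype α] [Fintype β] [Fintype γ] [Fintype δ]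
    (f : α → β → ℂ) (g : γ → δ → ℂ) :
    (∑ a, ∑ q, f a q) * (∑ r, ∑ b, g r b) = ∑ a, ∑ q, ∑ r, ∑ b, f a q * g r b := by
  simp_rw [Finset.sum_mul]
  simp_rw [Finset.mul_sum]

lemma sum_comm₅ {ι α β γ δ : Type*} [Fintype ι] [Fintype α] [Fintype β] [Fintype γ] [Fintype δ]
    (F : ι → α → β → γ → δ → ℂ) :
    ∑ j, ∑ a, ∑ q, ∑ r, ∑ b, F j a q r b = ∑ a, ∑ q, ∑ r, ∑ b, ∑ j, F j a q r b := by
  rw [Finset.sum_comm]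
  refine Finset.sum_congr rfl fun a _ => ?_
  rw [Finset.sum_comm]
  refine Finset.sum_congr rfl fun q _ => ?_
  rw [Finset.sum_comm]
  refine Finset.sum_congr rfl fun r _ => ?_
  rw [Finset.sum_comm]

/-- Summing over `j` by `gam_completeness` leaves two terms. One is the norm times the expectation
value of `bil i l`; the other contains `⟨ψ| gam i |ψ̄⟩` and vanishes. The summands `j = i` and `j =
l`, where `bil` is the identity, account for the factor `2` once the identity is rewritten for `cs`.
-/
lemma sum_ev_bil_mul (ψ : Ket) (i l : Fin 6) :
    ∑ j, ev ψ (bil i j) * ev ψ (bil j l) = 2 * (star ψ ⬝ᵥ ψ) * ev ψ (bil i l) := by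
  have h1 : ∀ j, ev ψ (bil i j) = ∑ a, ∑ q, (star ψ ᵥ* gam i) a * ((gam j)ᴴ a q * ψ q) := by
    intro j
    rw [ev, bil, ← mulVec_mulVec, dotProduct_mulVec]
    simp only [dotProduct, mulVec, Finset.mul_sum]
  have h2 : ∀ j, ev ψ (bil j l) = ∑ r, ∑ b, star (ψ r) * (gam j r b * ((gam l)ᴴ *ᵥ ψ) b) := by
    intro j
    rw [ev, bil, ← mulVec_mulVec]
    simp only [dotProduct, mulVec, Finset.mul_sum, Pi.star_apply]
  have h3 : ∀ a q r b, ∑ j, ((star ψ ᵥ* gam i) a * ((gam j)ᴴ a q * ψ q)) *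
      (star (ψ r) * (gam j r b * ((gam l)ᴴ *ᵥ ψ) b)) =
      (star ψ ᵥ* gam i) a * ψ q * star (ψ r) * ((gam l)ᴴ *ᵥ ψ) b *
       (2 * ((if a = b then 1 else 0) * (if q = r then 1 else 0) -
        (if a = r then 1 else 0) * (if q = b then 1 else 0))) := by
    intro a q r b
    rw [← gam_completeness, Finset.mul_sum]
    exact Finset.sum_congr rfl fun j _ => by ring
  have h4 : (star ψ ᵥ* gam i) ⬝ᵥ star ψ = 0 := by
    rw [← dotProduct_mulVec, gam_mulVec_dotProduct]
  have h5 : ev ψ (bil i l) = (star ψ ᵥ* gam i) ⬝ᵥ ((gam l)ᴴ *ᵥ ψ) := by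
    rw [ev, bil, ← mulVec_mulVec, dotProduct_mulVec]
  have h6 : ∑ j, ev ψ (bil i j) * ev ψ (bil j l) =
      2 * (((star ψ ᵥ* gam i) ⬝ᵥ ((gam l)ᴴ *ᵥ ψ)) * (star ψ ⬝ᵥ ψ) -
       ((star ψ ᵥ* gam i) ⬝ᵥ star ψ) * (ψ ⬝ᵥ ((gam l)ᴴ *ᵥ ψ))) := by
    simp only [h1, h2, sum_mul_sum₄]
    rw [sum_comm₅]
    simp only [h3]
    simp only [mul_sub, mul_ite, mul_one, mul_zero, Finset.sum_sub_distrib,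
      ← ite_and, Finset.sum_ite_eq, Finset.sum_ite_eq', Finset.mem_univ, if_true,
      Finset.sum_ite_irrel, Finset.sum_const_zero, dotProduct, Finset.sum_mul_sum, Finset.mul_sum,
      Pi.star_apply]
    simp only [ite_and, Finset.sum_ite_irrel, Finset.sum_const_zero, Finset.sum_ite_eq,
      Finset.mem_univ, if_true]
    congr 1
    · rw [Finset.sum_comm]
      refine Finset.sum_congr rfl fun q _ => ?_
      rw [Finset.sum_mul, Finset.mul_sum]
      exact Finset.sum_congr rfl fun a _ => by ring
    · rw [Finset.sum_comm]
      refine Finset.sum_congr rfl fun q _ => ?_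
      rw [Finset.sum_mul, Finset.mul_sum]
      exact Finset.sum_congr rfl fun a _ => by ring
  rw [h6, h4, h5]
  ring

/-- The complex structure of a state squares to `-1`. -/
lemma cs_mul_self {ψ : Ket} (hψ : IsState ψ) : cs ψ * cs ψ = -1 := by
  ext i l
  have hn : star ψ ⬝ᵥ ψ = 1 := hψ
  have h := sum_ev_bil_mul ψ i l
  simp only [ev_bil, hn, add_mul, mul_add, mul_ite, ite_mul, mul_one, one_mul, zero_mul,
    mul_zero, Finset.sum_add_distrib, Finset.sum_ite_eq, Finset.sum_ite_eq', Finset.mem_univ, if_true] at h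
  have h2 : ∑ x, -Complex.I * (cs ψ i x) * (-Complex.I * (cs ψ x l)) =
      - ∑ x, (cs ψ i x : ℂ) * cs ψ x l := by
    rw [← Finset.sum_neg_distrib]
    refine Finset.sum_congr rfl fun x _ => ?_
    linear_combination (cs ψ i x : ℂ) * cs ψ x l * Complex.I_sq
  rw [h2] at h
  rw [Matrix.mul_apply, Matrix.neg_apply, Matrix.one_apply]
  apply Complex.ofReal_injective
  push_cast
  by_cases hil : i = l
  · simp only [hil, if_true] at h ⊢
    push_cast
    linear_combination -h
  · simp only [hil, if_false] at h ⊢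
    push_cast
    linear_combination -h

/-! ### Signed permutations -/

/-- `J'` arises from `J` by the signed permutation of the basis that maps the `i`-th basis vector
to `ε i` times the `π i`-th one. -/
def SignedConj (π : Equiv.Perm (Fin 6)) (ε : Fin 6 → ℤˣ) (J J' : Matrix (Fin 6) (Fin 6) ℝ) :
    Prop :=
  ∀ i j, J' (π i) (π j) = ((ε i * ε j : ℤˣ) : ℤ) * J i j

/-- The determinant of a signed permutation. -/
def signedDet (π : Equiv.Perm (Fin 6)) (ε : Fin 6 → ℤˣ) : ℤˣ := Equiv.Perm.sign π * ∏ i, ε i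

lemma SignedConj.trans {π π' : Equiv.Perm (Fin 6)} {ε ε' : Fin 6 → ℤˣ}
    {J J' J'' : Matrix (Fin 6) (Fin 6) ℝ} (h : SignedConj π ε J J') (h' : SignedConj π' ε' J' J'') :
    SignedConj (π' * π) (fun i => ε' (π i) * ε i) J J'' := by
  intro i j
  rw [Equiv.Perm.mul_apply, Equiv.Perm.mul_apply, h', h]
  push_cast
  ring

lemma signedDet_mul (π π' : Equiv.Perm (Fin 6)) (ε ε' : Fin 6 → ℤˣ) :
    signedDet (π' * π) (fun i => ε' (π i) * ε i) = signedDet π' ε' * signedDet π ε := by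
  rw [signedDet, signedDet, signedDet, Finset.prod_mul_distrib, Equiv.prod_comp π, map_mul]
  exact mul_mul_mul_comm _ _ _ _

lemma units_mul_self_cast (u v : ℤˣ) :
    (((u * v : ℤˣ) : ℤ) : ℝ) * (((u * v : ℤˣ) : ℤ) : ℝ) = 1 := by
  rw [← Int.cast_mul, ← Units.val_mul, Int.units_mul_self]; simp

lemma SignedConj.symm {π : Equiv.Perm (Fin 6)} {ε : Fin 6 → ℤˣ}
    {J J' : Matrix (Fin 6) (Fin 6) ℝ} (h : SignedConj π ε J J') :
    SignedConj π.symm (fun i => ε (π.symm i)) J' J := by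
  intro i j
  have h1 := h (π.symm i) (π.symm j)
  simp only [Equiv.apply_symm_apply] at h1
  rw [h1, ← mul_assoc, units_mul_self_cast, one_mul]

lemma signedDet_inv (π : Equiv.Perm (Fin 6)) (ε : Fin 6 → ℤˣ) :
    signedDet π.symm (fun i => ε (π.symm i)) = signedDet π ε := by
  rw [signedDet, signedDet, Equiv.prod_comp π.symm ε, Equiv.Perm.sign_symm]

lemma SignedConj.neg {π : Equiv.Perm (Fin 6)} {ε : Fin 6 → ℤˣ}
    {J J' : Matrix (Fin 6) (Fin 6) ℝ} (h : SignedConj π ε J J') : SignedConj π ε (-J) (-J') := by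
  intro i j; simp [h i j]

lemma SignedConj.eq {π : Equiv.Perm (Fin 6)} {ε : Fin 6 → ℤˣ}
    {J J' J'' : Matrix (Fin 6) (Fin 6) ℝ} (h : SignedConj π ε J J') (h' : SignedConj π ε J J'') :
    J' = J'' := by
  ext i j
  have h1 := h (π.symm i) (π.symm j)
  have h2 := h' (π.symm i) (π.symm j)
  simp only [Equiv.apply_symm_apply] at h1 h2
  rw [h1, h2]

/-- The unitary `C` acts as a signed permutation in the six-dimensional representation. -/
def Implements (C : Op) (π : Equiv.Perm (Fin 6)) (ε : Fin 6 → ℤˣ) : Prop :=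
  C ∈ unitaryGroup (Fin 2 × Fin 2) ℂ ∧
    ∀ i j, C * bil i j * Cᴴ = (((ε i * ε j : ℤˣ) : ℤ) : ℂ) • bil (π i) (π j)

lemma conjTranspose_mul_of_unitary {C : Op} (h : C ∈ unitaryGroup (Fin 2 × Fin 2) ℂ) :
    Cᴴ * C = 1 := (mem_unitaryGroup_iff').mp h

lemma mul_conjTranspose_of_unitary {C : Op} (h : C ∈ unitaryGroup (Fin 2 × Fin 2) ℂ) :
    C * Cᴴ = 1 := (mem_unitaryGroup_iff).mp h

lemma IsState.mulVec {C : Op} (h : C ∈ unitaryGroup (Fin 2 × Fin 2) ℂ) {ψ : Ket}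
    (hψ : IsState ψ) : IsState (C *ᵥ ψ) := by
  rw [IsState, star_mulVec, ← dotProduct_mulVec, mulVec_mulVec, conjTranspose_mul_of_unitary h,
    one_mulVec]
  exact hψ

lemma Implements.signedConj {C : Op} {π : Equiv.Perm (Fin 6)} {ε : Fin 6 → ℤˣ}
    (h : Implements C π ε) (ψ : Ket) : SignedConj π ε (cs ψ) (cs (C *ᵥ ψ)) := by
  intro i j
  by_cases hij : i = j
  · subst hij; simp [cs_self]
  · have hu := conjTranspose_mul_of_unitary h.1
    have h1 : Cᴴ * bil (π i) (π j) * C = (((ε i * ε j : ℤˣ) : ℤ) : ℂ) • bil i j := by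
      have h2 := congrArg (fun A => (((ε i * ε j : ℤˣ) : ℤ) : ℂ) • (Cᴴ * A * C)) (h.2 i j)
      simp only [Matrix.mul_smul, Matrix.smul_mul, smul_smul] at h2
      have h3 : ((((ε i * ε j : ℤˣ) : ℤ) : ℂ) * (((ε i * ε j : ℤˣ) : ℤ) : ℂ)) = 1 := by
        exact_mod_cast units_mul_self_cast (ε i) (ε j)
      rw [h3, one_smul] at h2
      rw [← h2, ← Matrix.mul_assoc, ← Matrix.mul_assoc, hu, Matrix.one_mul, Matrix.mul_assoc, hu,
        Matrix.mul_one]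
    apply Complex.ofReal_injective
    rw [coe_cs _ (π.injective.ne hij), ev_mulVec, h1, ev_smul, Complex.ofReal_mul, coe_cs ψ hij]
    push_cast
    ring

/-- Reindexing the double sum by `π` shows that conjugation by `C` returns `hat K`. Fixed
antisymmetric matrices are thus infinitesimal symmetries of `C`. -/
lemma Implements.mul_hat {C : Op} {π : Equiv.Perm (Fin 6)} {ε : Fin 6 → ℤˣ}
    (h : Implements C π ε) {K : Matrix (Fin 6) (Fin 6) ℝ} (hK : SignedConj π ε K K) :
    C * hat K = hat K * C := by
  have h1 : C * hat K * Cᴴ = hat K := by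
    simp only [hat, Matrix.mul_sum, Matrix.sum_mul, Matrix.mul_smul, Matrix.smul_mul, h.2,
      smul_smul]
    rw [← Equiv.sum_comp π (fun i => ∑ j, (K i j : ℂ) • bil i j)]
    refine Finset.sum_congr rfl fun i _ => ?_
    rw [← Equiv.sum_comp π (fun j => (K (π i) j : ℂ) • bil (π i) j)]
    refine Finset.sum_congr rfl fun j _ => ?_
    rw [hK i j]
    push_cast
    rw [mul_comm]
  calc C * hat K = C * hat K * Cᴴ * C := by
        rw [Matrix.mul_assoc _ Cᴴ, conjTranspose_mul_of_unitary h.1, Matrix.mul_one]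
    _ = hat K * C := by rw [h1]

/-! ### Non-degenerate eigenvectors -/

/-- `J` commutes with the signed permutation and is central in the Lie algebra of antisymmetric
matrices that commute with it. -/
def Central (π : Equiv.Perm (Fin 6)) (ε : Fin 6 → ℤˣ) (J : Matrix (Fin 6) (Fin 6) ℝ) : Prop :=
  SignedConj π ε J J ∧ ∀ K : Matrix (Fin 6) (Fin 6) ℝ, Kᵀ = -K → SignedConj π ε K K → K * J = J * K

lemma mem_eigenspace_iff {C : Op} {c : ℂ} {ψ : Ket} :
    ψ ∈ Module.End.eigenspace (Matrix.toLin' C) c ↔ C *ᵥ ψ = c • ψ := by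
  rw [Module.End.mem_eigenspace_iff, Matrix.toLin'_apply]

lemma star_mul_of_eigenvector {C : Op} (h : C ∈ unitaryGroup (Fin 2 × Fin 2) ℂ) {c : ℂ} {ψ : Ket}
    (hψ : IsState ψ) (hc : C *ᵥ ψ = c • ψ) : star c * c = 1 := by
  have h1 : star (C *ᵥ ψ) ⬝ᵥ (C *ᵥ ψ) = 1 := hψ.mulVec h
  rw [hc, star_smul, smul_dotProduct, dotProduct_smul, (show star ψ ⬝ᵥ ψ = 1 from hψ)] at h1
  simpa using h1

lemma ne_zero_of_isState {ψ : Ket} (hψ : IsState ψ) : ψ ≠ 0 := by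
  rintro rfl
  simp [IsState] at hψ

/-- A fixed antisymmetric `K` gives an operator `hat K` commuting with `C`, which preserves the
one-dimensional eigenspace, so `ψ` is an eigenvector of `hat K`. Commutators with `hat K` then have
expectation value zero, and by `hat_commutator_bil` these values are, up to a factor, the entries of
`K J - J K`. -/
lemma central_of_nondegenerate {C : Op} {π : Equiv.Perm (Fin 6)} {ε : Fin 6 → ℤˣ}
    (h : Implements C π ε) {c : ℂ} {ψ : Ket} (hψ : IsState ψ)
    (hc : ψ ∈ Module.End.eigenspace (Matrix.toLin' C) c)
    (hfin : Module.finrank ℂ (Module.End.eigenspace (Matrix.toLin' C) c) = 1) :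
    Central π ε (cs ψ) := by
  have hc' := mem_eigenspace_iff.mp hc
  refine ⟨?_, fun K hK hKC => ?_⟩
  · have h1 := h.signedConj ψ
    rwa [hc', cs_smul, norm_eq_one_of_star_mul (star_mul_of_eigenvector h.1 hψ hc'), one_smul]
      at h1
  · have h2 : hat K *ᵥ ψ ∈ Module.End.eigenspace (Matrix.toLin' C) c := by
      rw [mem_eigenspace_iff, mulVec_mulVec, h.mul_hat hKC, ← mulVec_mulVec, hc', mulVec_smul]
    obtain ⟨k, hk⟩ := exists_smul_eq_of_finrank_eq_one hfin (x := ⟨ψ, hc⟩)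
      (by simpa [Subtype.ext_iff] using ne_zero_of_isState hψ) ⟨_, h2⟩
    have hk' : hat K *ᵥ ψ = k • ψ := (congrArg Subtype.val hk).symm
    -- Since `hat K` is anti-Hermitian, `k` is imaginary, and `star ψ` is a left eigenvector for the
    -- same `k`.
    have hstar : star ψ ᵥ* hat K = k • star ψ := by
      have h3 : star ψ ᵥ* hat K = -star k • star ψ := by
        have := congrArg star hk'
        rw [star_mulVec, hat_conjTranspose, hK, star_smul] at this
        have h4 : hat (-K) = -hat K := by simp [hat]
        rw [h4, vecMul_neg] at this
        rw [neg_smul, ← this, neg_neg]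
      have h5 : star ψ ⬝ᵥ (hat K *ᵥ ψ) = (star ψ ᵥ* hat K) ⬝ᵥ ψ := dotProduct_mulVec _ _ _
      rw [hk', h3, dotProduct_smul, smul_dotProduct, (show star ψ ⬝ᵥ ψ = 1 from hψ)] at h5
      simp only [smul_eq_mul, mul_one] at h5
      rw [h3, ← h5]
    ext i l
    have h6 : ev ψ (hat K * bil i l - bil i l * hat K) = 0 := by
      rw [ev_sub, ev, ev, ← mulVec_mulVec, ← mulVec_mulVec, hk', dotProduct_mulVec, hstar,
        mulVec_smul, dotProduct_smul, smul_dotProduct, sub_self]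
    rw [hat_commutator_bil hK, ev_smul, ev_sum] at h6
    simp only [ev_sub, ev_smul, ev_bil, mul_add, mul_ite, mul_zero, Finset.sum_sub_distrib,
      Finset.sum_add_distrib, Finset.sum_ite_eq, Finset.sum_ite_eq', Finset.mem_univ, if_true,
      (show star ψ ⬝ᵥ ψ = 1 from hψ)] at h6
    rw [Matrix.mul_apply, Matrix.mul_apply]
    apply Complex.ofReal_injective
    push_cast
    have e1 : ∑ x, (K x l : ℂ) * (-Complex.I * cs ψ i x) =
        -Complex.I * ∑ x, (cs ψ i x : ℂ) * K x l := by
      rw [Finset.mul_sum]; exact Finset.sum_congr rfl fun x _ => by ring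
    have e2 : ∑ x, (K i x : ℂ) * (-Complex.I * cs ψ x l) =
        -Complex.I * ∑ x, (K i x : ℂ) * cs ψ x l := by
      rw [Finset.mul_sum]; exact Finset.sum_congr rfl fun x _ => by ring
    rw [e1, e2] at h6
    linear_combination (-Complex.I / 4) * h6 +
      (∑ x, (K i x : ℂ) * cs ψ x l - ∑ x, (cs ψ i x : ℂ) * K x l) * Complex.I_sq

/-- Any eigenvector of `C` for `c` has a fixed complex structure, so centrality makes its density
operator commute with that of `ψ`. Commuting rank-one projectors of non-orthogonal vectors have the
same range, which rules out a second dimension. -/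
lemma nondegenerate_of_central {C : Op} {π : Equiv.Perm (Fin 6)} {ε : Fin 6 → ℤˣ}
    (h : Implements C π ε) {ψ : Ket} (hψ : IsState ψ) (hJ : Central π ε (cs ψ)) :
    ∃ c, ψ ∈ Module.End.eigenspace (Matrix.toLin' C) c ∧
      Module.finrank ℂ (Module.End.eigenspace (Matrix.toLin' C) c) = 1 := by
  obtain ⟨c, hcc, hc⟩ := eq_smul_of_cs_eq (hψ.mulVec h.1) hψ ((h.signedConj ψ).eq hJ.1)
  refine ⟨c, mem_eigenspace_iff.mpr hc, ?_⟩
  have hn : star ψ ⬝ᵥ ψ = 1 := hψ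
  refine finrank_eq_one (⟨ψ, mem_eigenspace_iff.mpr hc⟩ : Module.End.eigenspace _ c)
    (by simpa [Subtype.ext_iff] using ne_zero_of_isState hψ) ?_
  rintro ⟨φ, hφ⟩
  refine ⟨star ψ ⬝ᵥ φ, Subtype.ext ?_⟩
  change (star ψ ⬝ᵥ φ) • ψ = φ
  have hφ' := mem_eigenspace_iff.mp hφ
  -- The part of `φ` orthogonal to `ψ` is added to `ψ`, giving an eigenvector with `⟨ψ|χ⟩ = 1`. It
  -- need not be normalised: `cs` only scales with the squared norm.
  set χ : Ket := ψ + (φ - (star ψ ⬝ᵥ φ) • ψ) with hχ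
  have hχC : C *ᵥ χ = c • χ := by
    rw [hχ, mulVec_add, mulVec_sub, mulVec_smul, hc, hφ']
    module
  have h1 : SignedConj π ε (cs χ) (cs χ) := by
    have h2 := h.signedConj χ
    rwa [hχC, cs_smul, norm_eq_one_of_star_mul hcc, one_smul] at h2
  have h3 := hat_commutator (cs_transpose χ) (cs ψ)
  rw [hJ.2 _ (cs_transpose χ) h1, sub_self] at h3
  have h4 : hat (cs χ) * hat (cs ψ) = hat (cs ψ) * hat (cs χ) := by
    rw [← sub_eq_zero, h3]; simp [hat]
  have h5 : density χ * density ψ = density ψ * density χ := by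
    have h6 : ((4 : ℂ) • density χ) * ((4 : ℂ) • density ψ) =
        ((4 : ℂ) • density ψ) * ((4 : ℂ) • density χ) := by
      rw [density_eq, density_eq]
      simp only [Matrix.add_mul, Matrix.mul_add, Matrix.smul_mul, Matrix.mul_smul, Matrix.one_mul,
        Matrix.mul_one, h4, smul_smul]
      module
    simp only [Matrix.smul_mul, Matrix.mul_smul, smul_smul] at h6
    exact smul_right_injective _ (by norm_num : (4 * 4 : ℂ) ≠ 0) h6
  -- Applied to `ψ`, one side of the commutation relation gives `χ` and the other `ψ`.
  have h7 := congrArg (fun A => A *ᵥ ψ) h5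
  have h8 : star ψ ⬝ᵥ χ = 1 := by
    rw [hχ, dotProduct_add, dotProduct_sub, dotProduct_smul, hn]; simp
  have h9 : star χ ⬝ᵥ ψ = 1 := by
    rw [star_dotProduct, h8, star_one]
  simp only [← mulVec_mulVec, density_mulVec, hn, h9, h8, one_smul] at h7
  rw [hχ] at h7
  have h10 : φ - (star ψ ⬝ᵥ φ) • ψ = 0 := by simpa using h7
  exact (sub_eq_zero.mp h10).symm

/-! ### The Pauli group -/

/-- Generators of the two-qubit Pauli group. -/
def pauliGen : Fin 5 → IntOp :=
  let x : Matrix (Fin 2) (Fin 2) GaussianInt := !![0, 1; 1, 0]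
  let z : Matrix (Fin 2) (Fin 2) GaussianInt := !![1, 0; 0, -1]
  ![fun p q => x p.1 q.1 * (1 : Matrix (Fin 2) (Fin 2) GaussianInt) p.2 q.2,
    fun p q => (1 : Matrix (Fin 2) (Fin 2) GaussianInt) p.1 q.1 * x p.2 q.2,
    fun p q => z p.1 q.1 * (1 : Matrix (Fin 2) (Fin 2) GaussianInt) p.2 q.2,
    fun p q => (1 : Matrix (Fin 2) (Fin 2) GaussianInt) p.1 q.1 * z p.2 q.2,
    fun p q => if p = q then ⟨0, 1⟩ else 0]

def pauliInt (x k a₁ a₂ b₁ b₂ : Fin 2) : IntOp := fun p q =>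
  if p.1 = q.1 + a₁ ∧ p.2 = q.2 + a₂ then
    (-1) ^ (x.val + b₁.val * q.1.val + b₂.val * q.2.val) * ⟨0, 1⟩ ^ k.val else 0

lemma toOp_kronecker (A B : Matrix (Fin 2) (Fin 2) GaussianInt) :
    IntOp.toOp (fun p q => A p.1 q.1 * B p.2 q.2) =
      A.map GaussianInt.toComplex ⊗ₖ B.map GaussianInt.toComplex := by
  ext p q
  exact map_mul GaussianInt.toComplex (A p.1 q.1) (B p.2 q.2)

lemma toOp_pauliInt (x k a₁ a₂ b₁ b₂ : Fin 2) : IntOp.toOp (pauliInt x k a₁ a₂ b₁ b₂) =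
    ((-1 : ℂ) ^ (x : ℕ) * Complex.I ^ (k : ℕ)) •
      (((pauliX ^ (a₁ : ℕ)) ⊗ₖ (pauliX ^ (a₂ : ℕ))) *
        ((pauliZ ^ (b₁ : ℕ)) ⊗ₖ (pauliZ ^ (b₂ : ℕ)))) := by
  have h1 : ∀ a b p q : Fin 2, (pauliX ^ a.val * pauliZ ^ b.val) p q =
      if p = q + a then (-1) ^ (b.val * q.val) else 0 := by
    intro a b p q
    fin_cases a <;> fin_cases b <;> fin_cases p <;> fin_cases q <;>
      simp [pauliX, pauliZ]
  have h2 : GaussianInt.toComplex ⟨0, 1⟩ = Complex.I := by simp [GaussianInt.toComplex_def]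
  rw [← mul_kronecker_mul]
  ext p q
  rw [Matrix.smul_apply, kroneckerMap_apply, h1, h1]
  change GaussianInt.toComplex (if p.1 = q.1 + a₁ ∧ p.2 = q.2 + a₂ then
    (-1) ^ (x.val + b₁.val * q.1.val + b₂.val * q.2.val) * ⟨0, 1⟩ ^ k.val else 0) = _
  by_cases ha : p.1 = q.1 + a₁ <;> by_cases hb : p.2 = q.2 + a₂ <;>
    simp [ha, hb, h2, pow_add]
  ring

lemma pauli_eq_mul_pow (x k a₁ a₂ b₁ b₂ : Fin 2) :
    ((-1 : ℂ) ^ (x : ℕ) * Complex.I ^ (k : ℕ)) •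
      (((pauliX ^ (a₁ : ℕ)) ⊗ₖ (pauliX ^ (a₂ : ℕ))) *
        ((pauliZ ^ (b₁ : ℕ)) ⊗ₖ (pauliZ ^ (b₂ : ℕ)))) =
    IntOp.toOp (pauliGen 4) ^ (2 * x.val + k.val) * (IntOp.toOp (pauliGen 0) ^ a₁.val *
      (IntOp.toOp (pauliGen 1) ^ a₂.val *
        (IntOp.toOp (pauliGen 2) ^ b₁.val * IntOp.toOp (pauliGen 3) ^ b₂.val))) := by
  have eX : (!![0, 1; 1, 0] : Matrix (Fin 2) (Fin 2) GaussianInt).map GaussianInt.toComplex =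
      pauliX := by
    ext i j; fin_cases i <;> fin_cases j <;> simp [pauliX]
  have eZ : (!![1, 0; 0, -1] : Matrix (Fin 2) (Fin 2) GaussianInt).map GaussianInt.toComplex =
      pauliZ := by
    ext i j; fin_cases i <;> fin_cases j <;> simp [pauliZ]
  have e1' : (1 : Matrix (Fin 2) (Fin 2) GaussianInt).map GaussianInt.toComplex = 1 :=
    Matrix.map_one _ (map_zero _) (map_one _)
  have e0 : IntOp.toOp (pauliGen 0) = pauliX ⊗ₖ 1 := by
    rw [← eX, ← e1', ← toOp_kronecker]; rfl
  have e1 : IntOp.toOp (pauliGen 1) = 1 ⊗ₖ pauliX := by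
    rw [← eX, ← e1', ← toOp_kronecker]; rfl
  have e2 : IntOp.toOp (pauliGen 2) = pauliZ ⊗ₖ 1 := by
    rw [← eZ, ← e1', ← toOp_kronecker]; rfl
  have e3 : IntOp.toOp (pauliGen 3) = 1 ⊗ₖ pauliZ := by
    rw [← eZ, ← e1', ← toOp_kronecker]; rfl
  have e4 : IntOp.toOp (pauliGen 4) = Complex.I • 1 := by
    ext p q
    rw [toOp_apply]
    change GaussianInt.toComplex (if p = q then ⟨0, 1⟩ else 0) = _
    by_cases h : p = q <;> simp [h, GaussianInt.toComplex_def]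
  have hX : ∀ a : Fin 2, (pauliX ⊗ₖ (1 : Op₁)) ^ a.val = (pauliX ^ a.val) ⊗ₖ 1 := by
    intro a; fin_cases a <;> simp
  have hX' : ∀ a : Fin 2, ((1 : Op₁) ⊗ₖ pauliX) ^ a.val = 1 ⊗ₖ (pauliX ^ a.val) := by
    intro a; fin_cases a <;> simp
  have hZ : ∀ a : Fin 2, (pauliZ ⊗ₖ (1 : Op₁)) ^ a.val = (pauliZ ^ a.val) ⊗ₖ 1 := by
    intro a; fin_cases a <;> simp
  have hZ' : ∀ a : Fin 2, ((1 : Op₁) ⊗ₖ pauliZ) ^ a.val = 1 ⊗ₖ (pauliZ ^ a.val) := by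
    intro a; fin_cases a <;> simp
  simp only [e0, e1, e2, e3, e4, smul_pow, one_pow, hX, hX', hZ, hZ', pow_add,
    pow_mul, Complex.I_sq, Matrix.smul_mul, Matrix.one_mul, ← mul_kronecker_mul, Matrix.mul_one,
    ← Matrix.mul_assoc, smul_smul]

lemma mem_pauliGroup_iff {P : Op} :
    P ∈ pauliGroup ↔ ∃ x k a₁ a₂ b₁ b₂, P = IntOp.toOp (pauliInt x k a₁ a₂ b₁ b₂) := by
  simp only [toOp_pauliInt]; rfl

lemma one_mem_pauliGroup : (1 : Op) ∈ pauliGroup :=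
  mem_pauliGroup_iff.mpr ⟨0, 0, 0, 0, 0, 0, by
    rw [toOp_pauliInt]; simp⟩

lemma pauliGroup_finite : pauliGroup.Finite := by
  have : pauliGroup ⊆ Set.range (fun t : Fin 2 × Fin 2 × Fin 2 × Fin 2 × Fin 2 × Fin 2 =>
      IntOp.toOp (pauliInt t.1 t.2.1 t.2.2.1 t.2.2.2.1 t.2.2.2.2.1 t.2.2.2.2.2)) := by
    intro P hP
    obtain ⟨x, k, a₁, a₂, b₁, b₂, rfl⟩ := mem_pauliGroup_iff.mp hP
    exact ⟨(x, k, a₁, a₂, b₁, b₂), rfl⟩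
  exact (Set.finite_range _).subset this

/-- Statements about the Pauli group reduce to its generators `X₁, X₂, Z₁, Z₂, i`, which are integer
matrices, so the remaining checks are finite. -/
lemma pauli_induction {p : Op → Prop} (h1 : p 1)
    (hg : ∀ g A, p A → p (IntOp.toOp (pauliGen g) * A)) : ∀ P ∈ pauliGroup, p P := by
  have hp : ∀ g (n : ℕ) A, p A → p (IntOp.toOp (pauliGen g) ^ n * A) := by
    intro g n A hA
    induction n with
    | zero => simpa
    | succ n ih => rw [pow_succ', Matrix.mul_assoc]; exact hg _ _ ih
  intro P hP
  obtain ⟨x, k, a₁, a₂, b₁, b₂, rfl⟩ := mem_pauliGroup_iff.mp hP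
  rw [toOp_pauliInt, pauli_eq_mul_pow]
  have := hp 3 b₂ 1 h1
  rw [Matrix.mul_one] at this
  exact hp _ _ _ (hp _ _ _ (hp _ _ _ (hp _ _ _ this)))

lemma I_pow_smul_mem_pauliGroup (n : ℕ) (a₁ a₂ b₁ b₂ : Fin 2) :
    Complex.I ^ n • IntOp.toOp (pauliInt 0 0 a₁ a₂ b₁ b₂) ∈ pauliGroup := by
  have h4 : ∀ m < 4, Complex.I ^ m • IntOp.toOp (pauliInt 0 0 a₁ a₂ b₁ b₂) ∈ pauliGroup := by
    have h : ∀ x k : Fin 2, Complex.I ^ (2 * x.val + k.val) •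
        IntOp.toOp (pauliInt 0 0 a₁ a₂ b₁ b₂) ∈ pauliGroup := fun x k =>
      mem_pauliGroup_iff.mpr ⟨x, k, a₁, a₂, b₁, b₂, by
        rw [toOp_pauliInt, toOp_pauliInt, smul_smul, pow_add, pow_mul, Complex.I_sq]; simp⟩
    intro m hm
    interval_cases m
    exacts [h 0 0, h 0 1, h 1 0, h 1 1]
  rw [Complex.I_pow_eq_pow_mod]
  exact h4 _ (Nat.mod_lt _ (by norm_num))

lemma exists_I_pow_of_mem_pauliGroup {P : Op} (hP : P ∈ pauliGroup) :
    ∃ (n : ℕ) (a₁ a₂ b₁ b₂ : Fin 2), P = Complex.I ^ n • IntOp.toOp (pauliInt 0 0 a₁ a₂ b₁ b₂) := by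
  obtain ⟨x, k, a₁, a₂, b₁, b₂, rfl⟩ := mem_pauliGroup_iff.mp hP
  refine ⟨2 * x.val + k.val, a₁, a₂, b₁, b₂, ?_⟩
  rw [toOp_pauliInt, toOp_pauliInt, smul_smul, pow_add, pow_mul, Complex.I_sq]; simp

lemma pauliGen_mul_mem (g : Fin 5) {P : Op} (hP : P ∈ pauliGroup) :
    IntOp.toOp (pauliGen g) * P ∈ pauliGroup := by
  obtain ⟨n, a₁, a₂, b₁, b₂, rfl⟩ := exists_I_pow_of_mem_pauliGroup hP
  -- A `Z` on the left picks up the sign `(-1)^a` when it passes `X^a`; an `X` only shifts its own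
  -- exponent.
  have h : ∀ g a₁ a₂ b₁ b₂, pauliGen g * pauliInt 0 0 a₁ a₂ b₁ b₂ =
      pauliInt (if g = 2 then a₁ else if g = 3 then a₂ else 0)
        (if g = 4 then 1 else 0) (if g = 0 then a₁ + 1 else a₁) (if g = 1 then a₂ + 1 else a₂)
        (if g = 2 then b₁ + 1 else b₁) (if g = 3 then b₂ + 1 else b₂) := by
    decide +kernel
  rw [Matrix.mul_smul, ← map_mul, h]
  obtain ⟨m, c₁, c₂, d₁, d₂, hm⟩ := exists_I_pow_of_mem_pauliGroup
    (mem_pauliGroup_iff.mpr ⟨_, _, _, _, _, _, rfl⟩)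
  rw [hm, smul_smul, ← pow_add]
  exact I_pow_smul_mem_pauliGroup _ _ _ _ _

lemma mul_mem_pauliGroup {P Q : Op} (hP : P ∈ pauliGroup) (hQ : Q ∈ pauliGroup) :
    P * Q ∈ pauliGroup := by
  refine pauli_induction (p := fun A => A * Q ∈ pauliGroup) (by simpa) (fun g A hA => ?_) P hP
  rw [Matrix.mul_assoc]
  exact pauliGen_mul_mem g hA

lemma bil_eq_toOp (i j : Fin 6) : bil i j = IntOp.toOp (gammaInt i * (gammaInt j)ᴴ) := by
  rw [bil, gam, gam, ← toOp_conjTranspose, map_mul]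

lemma bil_mem_pauliGroup (i j : Fin 6) : bil i j ∈ pauliGroup := by
  have : ∀ i j, ∃ x k a₁ a₂ b₁ b₂, gammaInt i * (gammaInt j)ᴴ = pauliInt x k a₁ a₂ b₁ b₂ := by
    decide +kernel
  obtain ⟨x, k, a₁, a₂, b₁, b₂, h⟩ := this i j
  exact mem_pauliGroup_iff.mpr ⟨x, k, a₁, a₂, b₁, b₂, by rw [bil_eq_toOp, h]⟩

lemma pauli_unitary : ∀ P ∈ pauliGroup, P ∈ unitaryGroup (Fin 2 × Fin 2) ℂ := by
  have h : ∀ g, pauliGen g * (pauliGen g)ᴴ = 1 := by decide +kernel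
  refine pauli_induction (one_mem _) fun g A hA => mul_mem ?_ hA
  rw [mem_unitaryGroup_iff, star_eq_conjTranspose, ← toOp_conjTranspose, ← map_mul, h, map_one]

/-- The `gam k` are weight vectors for the Pauli group acting by `A ↦ P A Pᵀ`. A Clifford operation
normalises the Pauli group and must therefore permute the weight lines. -/
lemma pauli_mul_gam (k : Fin 6) : ∀ P ∈ pauliGroup,
    P * gam k * Pᵀ = gam k ∨ P * gam k * Pᵀ = -gam k := by
  have h : ∀ (g : Fin 5) (k : Fin 6), pauliGen g * gammaInt k * (pauliGen g)ᵀ = gammaInt k ∨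
      pauliGen g * gammaInt k * (pauliGen g)ᵀ = -gammaInt k := by
    decide +kernel
  refine pauli_induction (by simp) fun g A hA => ?_
  have h' : IntOp.toOp (pauliGen g) * gam k * (IntOp.toOp (pauliGen g))ᵀ = gam k ∨
      IntOp.toOp (pauliGen g) * gam k * (IntOp.toOp (pauliGen g))ᵀ = -gam k := by
    rw [gam, ← toOp_transpose, ← map_mul, ← map_mul, ← map_neg]
    exact (h g k).imp (congrArg _) (congrArg _)
  have e : IntOp.toOp (pauliGen g) * A * gam k * (IntOp.toOp (pauliGen g) * A)ᵀ =
      IntOp.toOp (pauliGen g) * (A * gam k * Aᵀ) * (IntOp.toOp (pauliGen g))ᵀ := by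
    simp only [transpose_mul, Matrix.mul_assoc]
  rw [e]
  rcases h' with h' | h' <;> rcases hA with hA | hA <;> rw [hA] <;> simp [h']

lemma transpose_mul_conjTranspose_transpose {C : Op} (h : C ∈ unitaryGroup (Fin 2 × Fin 2) ℂ) :
    Cᵀ * Cᵀᴴ = 1 := by
  have : Cᵀᴴ = Cᴴᵀ := rfl
  rw [this, ← transpose_mul, conjTranspose_mul_of_unitary h, transpose_one]

/-- Inserting the identity in the form `Cᵀ * Cᵀᴴ` between the two factors of `bil` reduces
conjugation to the six-dimensional action. -/
lemma unitary_conj_bil {C : Op} (h : C ∈ unitaryGroup (Fin 2 × Fin 2) ℂ) (i j : Fin 6) :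
    C * bil i j * Cᴴ = (C * gam i * Cᵀ) * (C * gam j * Cᵀ)ᴴ := by
  calc C * bil i j * Cᴴ = C * gam i * (Cᵀ * Cᵀᴴ) * (gam j)ᴴ * Cᴴ := by
        rw [transpose_mul_conjTranspose_transpose h, bil]; simp only [Matrix.mul_one,
          Matrix.mul_assoc]
    _ = _ := by simp only [conjTranspose_mul, Matrix.mul_assoc]

lemma bil_mul_pauli (i j : Fin 6) {P : Op} (hP : P ∈ pauliGroup) :
    bil i j * P = P * bil i j ∨ bil i j * P = -(P * bil i j) := by
  have hu := pauli_unitary P hP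
  have h1 : P * bil i j * Pᴴ = bil i j ∨ P * bil i j * Pᴴ = -bil i j := by
    rw [unitary_conj_bil hu]
    rcases pauli_mul_gam i P hP with h | h <;> rcases pauli_mul_gam j P hP with h' | h' <;>
      rw [h, h'] <;> simp [bil]
  have h2 : P * bil i j = P * bil i j * Pᴴ * P := by
    rw [Matrix.mul_assoc _ Pᴴ, conjTranspose_mul_of_unitary hu, Matrix.mul_one]
  rcases h1 with h1 | h1 <;> rw [h1] at h2 <;> rw [h2] <;> simp

/-! ### Clifford operations as signed permutations -/

lemma IsClifford.mul {C D : Op} (hC : IsClifford C) (hD : IsClifford D) : IsClifford (C * D) := by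
  refine ⟨mul_mem hC.1 hD.1, fun P hP => ?_⟩
  have := hC.2 _ (hD.2 P hP)
  rwa [show C * D * P * (C * D)ᴴ = C * (D * P * Dᴴ) * Cᴴ by
    simp only [conjTranspose_mul, Matrix.mul_assoc]]

lemma isClifford_one : IsClifford 1 := ⟨one_mem _, fun P hP => by simpa⟩

lemma IsClifford.smul {C : Op} (hC : IsClifford C) {c : ℂ} (hc : star c * c = 1) :
    IsClifford (c • C) := by
  have hc' : c * star c = 1 := by rw [mul_comm]; exact hc
  refine ⟨?_, fun P hP => ?_⟩
  · rw [mem_unitaryGroup_iff, star_eq_conjTranspose, conjTranspose_smul, Matrix.smul_mul,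
      Matrix.mul_smul, smul_smul, hc', one_smul, mul_conjTranspose_of_unitary hC.1]
  · rw [conjTranspose_smul, Matrix.smul_mul, Matrix.smul_mul, Matrix.mul_smul, smul_smul, hc',
      one_smul]
    exact hC.2 P hP

/-- The definition only asks that conjugation map the Pauli group into itself. As an injective map
of a finite set it is also onto. -/
lemma IsClifford.exists_preimage {C : Op} (hC : IsClifford C) {P : Op} (hP : P ∈ pauliGroup) :
    ∃ Q ∈ pauliGroup, C * Q * Cᴴ = P := by
  have hinj : Set.InjOn (fun Q => C * Q * Cᴴ) pauliGroup := by
    intro Q _ R _ h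
    have h' := congrArg (fun A => Cᴴ * A * C) h
    have e : ∀ A : Op, Cᴴ * (C * A * Cᴴ) * C = A := by
      intro A
      rw [Matrix.mul_assoc C, ← Matrix.mul_assoc Cᴴ C, conjTranspose_mul_of_unitary hC.1,
        Matrix.one_mul, Matrix.mul_assoc, conjTranspose_mul_of_unitary hC.1, Matrix.mul_one]
    simpa only [e] using h'
  have hsub : (fun Q => C * Q * Cᴴ) '' pauliGroup ⊆ pauliGroup := by
    rintro _ ⟨Q, hQ, rfl⟩
    exact hC.2 Q hQ
  have h : (fun Q => C * Q * Cᴴ) '' pauliGroup = pauliGroup :=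
    Set.eq_of_subset_of_ncard_le hsub hinj.ncard_image.ge pauliGroup_finite
  have hP' : P ∈ (fun Q => C * Q * Cᴴ) '' pauliGroup := h.symm ▸ hP
  exact hP'

/-! ### Clifford operations act as signed permutations -/

/-- The sign with which a Pauli generator acts on `gam j`. -/
def gamSign (j : Fin 6) (g : Fin 5) : ℤ :=
  if pauliGen g * gammaInt j * (pauliGen g)ᵀ = gammaInt j then 1 else -1

/-- The six weights are distinct, so the weight spaces in the antisymmetric matrices are lines. -/
lemma gamSign_injective : ∀ j k, (∀ g, gamSign j g = gamSign k g) → j = k := by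
  decide +kernel

lemma pauliGen_transpose_mul_gam (g : Fin 5) (j : Fin 6) :
    (IntOp.toOp (pauliGen g))ᵀ * (gam j)ᴴ * IntOp.toOp (pauliGen g) = (gamSign j g : ℂ) • (gam j)ᴴ := by
  have h : ∀ g j, (pauliGen g)ᵀ * (gammaInt j)ᴴ * pauliGen g = gamSign j g • (gammaInt j)ᴴ := by
    decide +kernel
  rw [gam, ← toOp_conjTranspose, ← toOp_transpose, ← map_mul, ← map_mul, h, map_zsmul,
    Int.cast_smul_eq_zsmul]

lemma pauliGen_mem (g : Fin 5) : IntOp.toOp (pauliGen g) ∈ pauliGroup := by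
  have := pauliGen_mul_mem g one_mem_pauliGroup
  rwa [Matrix.mul_one] at this

lemma eq_sum_gam_of_transpose {A : Op} (hA : Aᵀ = -A) :
    A = ∑ j, (((gam j)ᴴ * A).trace / 4) • gam j := by
  ext r b
  have h1 : ∀ j, ((gam j)ᴴ * A).trace * gam j r b =
      ∑ a, ∑ q, A q a * ((gam j)ᴴ a q * gam j r b) := by
    intro j
    simp only [trace, diag_apply, Matrix.mul_apply, Finset.sum_mul]
    exact Finset.sum_congr rfl fun a _ => Finset.sum_congr rfl fun q _ => by ring
  have h2 : ∑ j, ((gam j)ᴴ * A).trace * gam j r b = 4 * A r b := by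
    simp only [h1]
    rw [Finset.sum_comm, Finset.sum_congr rfl fun _ _ => Finset.sum_comm]
    simp only [← Finset.mul_sum, gam_completeness]
    simp only [mul_sub, mul_ite, mul_one, mul_zero, Finset.sum_sub_distrib, Finset.sum_ite_eq',
      Finset.sum_ite_eq, Finset.mem_univ, if_true, Finset.sum_ite_irrel, Finset.sum_const_zero]
    have : A b r = -A r b := congrFun₂ hA r b
    rw [this]; ring
  simp only [Matrix.sum_apply, Matrix.smul_apply, smul_eq_mul, div_mul_eq_mul_div,
    ← Finset.sum_div, h2]
  ring

/-- If the `gam j` coefficient of `A` is nonzero, then `A` has the weight of `gam j`. Distinct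
weights leave room for only one nonzero coefficient. -/
lemma exists_eq_smul_gam {A : Op} (hA : Aᵀ = -A) (h0 : A ≠ 0)
    (hP : ∀ P ∈ pauliGroup, P * A * Pᵀ = A ∨ P * A * Pᵀ = -A) : ∃ (j : Fin 6) (a : ℂ),
    A = a • gam j := by
  have hsum := eq_sum_gam_of_transpose hA
  have key : ∀ j, ((gam j)ᴴ * A).trace ≠ 0 → ∀ g,
      IntOp.toOp (pauliGen g) * A * (IntOp.toOp (pauliGen g))ᵀ = (gamSign j g : ℂ) • A := by
    intro j hj g
    have h1 : ((gam j)ᴴ * (IntOp.toOp (pauliGen g) * A * (IntOp.toOp (pauliGen g))ᵀ)).trace =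
        gamSign j g * ((gam j)ᴴ * A).trace := by
      have e : (gam j)ᴴ * (IntOp.toOp (pauliGen g) * A * (IntOp.toOp (pauliGen g))ᵀ) =
          ((gam j)ᴴ * IntOp.toOp (pauliGen g) * A) * (IntOp.toOp (pauliGen g))ᵀ := by
        simp only [Matrix.mul_assoc]
      rw [e, trace_mul_comm, ← Matrix.mul_assoc, ← Matrix.mul_assoc, pauliGen_transpose_mul_gam,
        Matrix.smul_mul, trace_smul, smul_eq_mul]
    have h2 : gamSign j g = 1 ∨ gamSign j g = -1 := by
      unfold gamSign; split_ifs <;> simp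
    rcases hP _ (pauliGen_mem g) with h | h <;> rw [h] at h1 ⊢ <;> rcases h2 with h2 | h2 <;>
      rw [h2] at h1 ⊢
    · simp
    · exfalso; apply hj
      push_cast at h1
      linear_combination h1 / 2
    · exfalso; apply hj
      rw [Matrix.mul_neg, trace_neg] at h1
      push_cast at h1
      linear_combination -h1 / 2
    · simp
  have hex : ∃ j, ((gam j)ᴴ * A).trace ≠ 0 := by
    by_contra! hall
    apply h0
    rw [hsum]
    simp [hall]
  obtain ⟨j, hj⟩ := hex
  refine ⟨j, ((gam j)ᴴ * A).trace / 4, ?_⟩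
  conv_lhs => rw [hsum]
  refine Finset.sum_eq_single j (fun k _ hk => ?_) (by simp)
  have : ((gam k)ᴴ * A).trace = 0 := by
    by_contra hk'
    apply hk
    refine gamSign_injective k j fun g => ?_
    have h1 := (key k hk' g).symm.trans (key j hj g)
    rw [← sub_eq_zero, ← sub_smul] at h1
    rcases smul_eq_zero.mp h1 with h1 | h1
    · exact_mod_cast sub_eq_zero.mp h1
    · exact absurd h1 h0
  simp [this]

/-- A Pauli operator acts on `C * gam k * Cᵀ` as its preimage under conjugation acts on `gam k`,
namely by a sign. -/
lemma IsClifford.exists_mul_gam {C : Op} (hC : IsClifford C) (k : Fin 6) :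
    ∃ (j : Fin 6) (a : ℂ), C * gam k * Cᵀ = a • gam j := by
  refine exists_eq_smul_gam ?_ ?_ fun P hP => ?_
  · simp only [transpose_mul, transpose_transpose, gam_transpose, Matrix.mul_assoc]
    simp
  · intro h
    have h1 := unitary_conj_bil hC.1 k k
    rw [h, bil_self, Matrix.mul_one, mul_conjTranspose_of_unitary hC.1, Matrix.zero_mul] at h1
    exact one_ne_zero h1
  · obtain ⟨Q, hQ, rfl⟩ := hC.exists_preimage hP
    have e : C * Q * Cᴴ * (C * gam k * Cᵀ) * (C * Q * Cᴴ)ᵀ = C * (Q * gam k * Qᵀ) * Cᵀ := by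
      have h1 := conjTranspose_mul_of_unitary hC.1
      have h2 : Cᵀ * Cᴴᵀ = 1 := by rw [← transpose_mul, h1, transpose_one]
      calc _ = C * Q * (Cᴴ * C) * gam k * (Cᵀ * Cᴴᵀ) * Qᵀ * Cᵀ := by
            simp only [transpose_mul, Matrix.mul_assoc]
        _ = _ := by rw [h1, h2]; simp only [Matrix.mul_one, Matrix.mul_assoc]
    rw [e]
    rcases pauli_mul_gam k Q hQ with h | h <;> rw [h] <;> simp

lemma trace_bil {i j : Fin 6} (h : i ≠ j) : (bil i j).trace = 0 := by
  have h1 : ∀ i j, i ≠ j → (gammaInt i * (gammaInt j)ᴴ).trace = 0 := by decide +kernel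
  have h2 := congrArg GaussianInt.toComplex (h1 i j h)
  rw [trace, map_sum, map_zero] at h2
  rw [bil_eq_toOp, trace]
  exact h2

theorem IsClifford.exists_implements {C : Op} (hC : IsClifford C) :
    ∃ π ε, Implements C π ε := by
  choose f a hf using hC.exists_mul_gam
  have hb : ∀ i j, C * bil i j * Cᴴ = (a i * star (a j)) • bil (f i) (f j) := by
    intro i j
    rw [unitary_conj_bil hC.1, hf, hf, conjTranspose_smul, Matrix.smul_mul, Matrix.mul_smul,
      smul_smul, bil]
  have ha : ∀ i, a i * star (a i) = 1 := by
    intro i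
    have h := hb i i
    rw [bil_self, bil_self, Matrix.mul_one, mul_conjTranspose_of_unitary hC.1] at h
    have := congrFun₂ h (0, 0) (0, 0)
    simpa using this.symm
  have ha0 : ∀ i, a i ≠ 0 := fun i h => by simpa [h] using ha i
  have hinj : Function.Injective f := by
    intro i j hij
    by_contra hne
    have h := congrArg trace (hb i j)
    rw [trace_mul_cycle, conjTranspose_mul_of_unitary hC.1, Matrix.one_mul, trace_bil hne, hij,
      bil_self, trace_smul, trace_one] at h
    simp [ha0] at h
  -- Comparing the images of `bil i j` and `bil j i = -bil i j` shows that `a i * star (a j)` is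
  -- real, and its modulus is one.
  have hsq : ∀ i j, a i * star (a j) = 1 ∨ a i * star (a j) = -1 := by
    intro i j
    by_cases hij : i = j
    · subst hij; exact Or.inl (ha i)
    have hne : bil (f i) (f j) ≠ 0 := by
      intro h0
      have h2 := bil_mul_self (hinj.ne hij)
      rw [h0, Matrix.zero_mul] at h2
      exact one_ne_zero (neg_eq_zero.mp h2.symm)
    have h1 := hb j i
    rw [bil_swap hij, bil_swap (hinj.ne hij), Matrix.mul_neg, Matrix.neg_mul, hb, smul_neg,
      neg_inj, ← sub_eq_zero, ← sub_smul] at h1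
    have h3 : a i * star (a j) = a j * star (a i) :=
      sub_eq_zero.mp ((smul_eq_zero.mp h1).resolve_right hne)
    refine mul_self_eq_one_iff.mp ?_
    conv_lhs => rw [h3]
    conv_lhs => arg 2; rw [← h3]
    linear_combination ha i * a j * star (a j) + ha j
  -- The phase of `C` is arbitrary, so the `a i` are signs only up to a common phase. Dividing by `a
  -- 0` removes it, and `bil` does not see it.
  choose ε hε using fun i => show ∃ u : ℤˣ, a i * star (a 0) = ((u : ℤ) : ℂ) from
    (hsq i 0).elim (fun h => ⟨1, by rw [h]; simp⟩) (fun h => ⟨-1, by rw [h]; simp⟩)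
  refine ⟨Equiv.ofBijective f (Finite.injective_iff_bijective.mp hinj), ε, hC.1, fun i j => ?_⟩
  rw [hb, Equiv.ofBijective_apply, Equiv.ofBijective_apply]
  congr 1
  have h0 : star (a j) * a 0 = ((ε j : ℤ) : ℂ) := by
    have := congrArg star (hε j)
    rw [star_mul', star_star] at this
    simpa using this
  push_cast
  rw [← hε i, ← h0]
  linear_combination -(a i * star (a j)) * ha 0

/-! ### Realizing signed permutations by Clifford operations -/

lemma implements_of_gam {C : Op} {π : Equiv.Perm (Fin 6)} {ε : Fin 6 → ℤˣ}
    (hC : C ∈ unitaryGroup (Fin 2 × Fin 2) ℂ)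
    (h : ∀ k, C * gam k * Cᵀ = ((ε k : ℤ) : ℂ) • gam (π k)) : Implements C π ε := by
  refine ⟨hC, fun i j => ?_⟩
  rw [unitary_conj_bil hC, h, h, conjTranspose_smul, Matrix.smul_mul, Matrix.mul_smul, smul_smul,
    bil]
  simp

lemma Implements.mul {C D : Op} {π π' : Equiv.Perm (Fin 6)} {ε ε' : Fin 6 → ℤˣ}
    (hD : Implements D π ε) (hC : Implements C π' ε') :
    Implements (C * D) (π' * π) (fun i => ε' (π i) * ε i) := by
  refine ⟨mul_mem hC.1 hD.1, fun i j => ?_⟩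
  rw [show C * D * bil i j * (C * D)ᴴ = C * (D * bil i j * Dᴴ) * Cᴴ by
    simp only [conjTranspose_mul, Matrix.mul_assoc], hD.2, Matrix.mul_smul, Matrix.smul_mul, hC.2,
    smul_smul]
  congr 1
  push_cast
  ring

lemma implements_one : Implements 1 1 1 := ⟨one_mem _, fun i j => by simp⟩

/-- The Clifford operation that rotates the plane `i, j` by a right angle. -/
def quarterTurn (i j : Fin 6) : Op := ((1 / √2 : ℝ) : ℂ) • (1 + bil i j)

lemma half_mul : ((1 / √2 : ℝ) : ℂ) * ((1 / √2 : ℝ) : ℂ) = 1 / 2 := by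
  rw [← Complex.ofReal_mul, div_mul_div_comm, Real.mul_self_sqrt (by norm_num)]
  norm_num

lemma star_half : star ((1 / √2 : ℝ) : ℂ) = ((1 / √2 : ℝ) : ℂ) := Complex.conj_ofReal _

lemma quarterTurn_conjTranspose {i j : Fin 6} (h : i ≠ j) :
    (quarterTurn i j)ᴴ = ((1 / √2 : ℝ) : ℂ) • (1 - bil i j) := by
  rw [quarterTurn, conjTranspose_smul, star_half, conjTranspose_add, bil_conjTranspose, bil_swap h,
    conjTranspose_one, sub_eq_add_neg]

lemma quarterTurn_unitary {i j : Fin 6} (h : i ≠ j) :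
    quarterTurn i j ∈ unitaryGroup (Fin 2 × Fin 2) ℂ := by
  rw [mem_unitaryGroup_iff, star_eq_conjTranspose, quarterTurn_conjTranspose h, quarterTurn,
    Matrix.smul_mul, Matrix.mul_smul, smul_smul, half_mul]
  have : (1 + bil i j) * (1 - bil i j) = (2 : ℂ) • 1 := by
    simp only [Matrix.mul_sub, Matrix.add_mul, Matrix.mul_one, Matrix.one_mul, bil_mul_self h]
    module
  rw [this, smul_smul]; norm_num

lemma quarterTurn_isClifford {i j : Fin 6} (h : i ≠ j) : IsClifford (quarterTurn i j) := by
  refine ⟨quarterTurn_unitary h, fun P hP => ?_⟩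
  have hB := bil_mul_self h
  have e : quarterTurn i j * P * (quarterTurn i j)ᴴ =
      (1 / 2 : ℂ) • ((1 + bil i j) * P * (1 - bil i j)) := by
    rw [quarterTurn_conjTranspose h, quarterTurn]
    simp only [Matrix.smul_mul, Matrix.mul_smul, smul_smul, half_mul]
  rw [e]
  rcases bil_mul_pauli i j hP with h1 | h1
  · have : (1 + bil i j) * P * (1 - bil i j) = (2 : ℂ) • P := by
      simp only [Matrix.add_mul, h1, Matrix.mul_sub, Matrix.one_mul, Matrix.mul_one,
        Matrix.mul_assoc P, hB, Matrix.mul_neg]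
      module
    rw [this, smul_smul]; simpa using hP
  · have : (1 + bil i j) * P * (1 - bil i j) = (2 : ℂ) • (bil i j * P) := by
      have h2 : P * bil i j = -(bil i j * P) := by rw [h1, neg_neg]
      have h3 : bil i j * P * bil i j = P := by
        rw [Matrix.mul_assoc, h2, Matrix.mul_neg, ← Matrix.mul_assoc, hB]; simp
      simp only [Matrix.add_mul, Matrix.mul_sub, Matrix.one_mul, Matrix.mul_one, h3, h2]
      module
    rw [this, smul_smul]; simpa using mul_mem_pauliGroup (bil_mem_pauliGroup i j) hP

lemma quarterTurn_implements {i j : Fin 6} (h : i ≠ j) :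
    Implements (quarterTurn i j) (Equiv.swap i j) (fun k => if k = i then -1 else 1) := by
  refine implements_of_gam (quarterTurn_unitary h) fun k => ?_
  have hT : (bil i j)ᵀ = (gam j)ᴴ * gam i := by
    have : (gam j)ᴴᵀ = (gam j)ᵀᴴ := rfl
    rw [bil, transpose_mul, this, gam_transpose, gam_transpose, conjTranspose_neg,
      neg_mul_neg]
  have hii : gam i * ((gam j)ᴴ * gam i) = -gam j := by
    rw [← Matrix.mul_assoc, gam_mul_conjTranspose i j, if_neg h, zero_smul, zero_sub,
      Matrix.neg_mul, Matrix.mul_assoc, gam_conjTranspose_mul_self, Matrix.mul_one]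
  have hB : (bil i j)ᵀ * (bil i j)ᵀ = -1 := by
    rw [← transpose_mul, bil_mul_self h, transpose_neg, transpose_one]
  have key : gam k + bil i j * gam k + gam k * (bil i j)ᵀ + bil i j * gam k * (bil i j)ᵀ =
      (2 * (((if k = i then -1 else 1 : ℤˣ) : ℤ) : ℂ)) • gam (Equiv.swap i j k) := by
    by_cases hki : k = i
    · subst hki
      have e1 : bil k j * gam k = -gam j := by rw [bil, Matrix.mul_assoc, hii]
      rw [e1, hT, hii, Equiv.swap_apply_left, if_pos rfl, Matrix.neg_mul, ← Matrix.mul_assoc,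
        gam_mul_conjTranspose_self, Matrix.one_mul]
      push_cast
      module
    by_cases hkj : k = j
    · subst hkj
      have e1 : bil i k * gam k = gam i := by
        rw [bil, Matrix.mul_assoc, gam_conjTranspose_mul_self, Matrix.mul_one]
      rw [e1, hT, hii, Equiv.swap_apply_right, if_neg hki, ← Matrix.mul_assoc,
        gam_mul_conjTranspose_self, Matrix.one_mul]
      push_cast
      module
    -- Outside the plane the two cross terms cancel, and the term with `bil i j` on both sides
    -- returns `gam k`.
    · have e1 : bil i j * gam k = -(gam k * (bil i j)ᵀ) := by
        rw [bil, Matrix.mul_assoc, gam_conjTranspose_mul j k, if_neg (Ne.symm hkj), zero_smul,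
          zero_sub, Matrix.mul_neg, ← Matrix.mul_assoc, gam_mul_conjTranspose i k,
          if_neg (Ne.symm hki), zero_smul, zero_sub, Matrix.neg_mul, neg_neg, Matrix.mul_assoc,
          gam_conjTranspose_mul i j, if_neg h, zero_smul, zero_sub, Matrix.mul_neg, ← hT]
        rfl
      rw [e1, Equiv.swap_apply_of_ne_of_ne hki hkj, if_neg hki, Matrix.neg_mul, Matrix.mul_assoc,
        hB]
      simp only [Matrix.mul_neg, Matrix.mul_one]
      push_cast
      module
  rw [quarterTurn, transpose_smul, transpose_add, transpose_one]
  simp only [Matrix.smul_mul, Matrix.mul_smul, smul_smul, half_mul]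
  have e : (1 + bil i j) * gam k * (1 + (bil i j)ᵀ) =
      gam k + bil i j * gam k + gam k * (bil i j)ᵀ + bil i j * gam k * (bil i j)ᵀ := by
    simp only [Matrix.add_mul, Matrix.mul_add, Matrix.one_mul, Matrix.mul_one]
    abel
  rw [e, key, smul_smul]
  congr 1
  ring

lemma signedDet_quarterTurn {i j : Fin 6} (h : i ≠ j) :
    signedDet (Equiv.swap i j) (fun k => if k = i then -1 else 1) = 1 := by
  rw [signedDet, Equiv.Perm.sign_swap h, Finset.prod_ite_eq']
  simp

/-- The signed permutations that are implemented by Clifford operations. -/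
def Realizable (π : Equiv.Perm (Fin 6)) (ε : Fin 6 → ℤˣ) : Prop :=
  ∃ C, IsClifford C ∧ Implements C π ε

lemma Realizable.mul {π π' : Equiv.Perm (Fin 6)} {ε ε' : Fin 6 → ℤˣ}
    (h : Realizable π ε) (h' : Realizable π' ε') :
    Realizable (π' * π) (fun i => ε' (π i) * ε i) := by
  obtain ⟨D, hD, hD'⟩ := h
  obtain ⟨C, hC, hC'⟩ := h'
  exact ⟨C * D, hC.mul hD, hD'.mul hC'⟩

lemma realizable_one : Realizable 1 1 := ⟨1, isClifford_one, implements_one⟩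

/-- Transpositions generate all permutations, and each is the permutation part of a quarter turn,
which has determinant one because of its single sign. -/
lemma exists_realizable (π : Equiv.Perm (Fin 6)) : ∃ ε, Realizable π ε ∧ signedDet π ε = 1 := by
  induction π using Equiv.Perm.swap_induction_on with
  | one => exact ⟨1, realizable_one, by simp [signedDet]⟩
  | swap_mul π i j hij ih =>
    obtain ⟨ε, h, hdet⟩ := ih
    refine ⟨_, h.mul ⟨_, quarterTurn_isClifford hij, quarterTurn_implements hij⟩, ?_⟩
    have hd := signedDet_mul π (Equiv.swap i j) ε (fun k => if k = i then -1 else 1)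
    rwa [hdet, signedDet_quarterTurn hij, mul_one] at hd

/-- The square of the quarter turn in the plane `0, k` flips exactly these two coordinates. Such
half turns produce arbitrary signs on the coordinates `1` to `5`, and the sign on `0` is then forced
by the product condition. -/
lemma realizable_flips {δ : Fin 6 → ℤˣ} (h : ∏ i, δ i = 1) : Realizable 1 δ := by
  have hf : ∀ k : Fin 6, k ≠ 0 → Realizable 1 (fun i => if i = 0 ∨ i = k then -1 else 1) := by
    intro k hk
    have hq : Realizable (Equiv.swap 0 k) (fun i => if i = 0 then -1 else 1) :=
      ⟨_, quarterTurn_isClifford hk.symm, quarterTurn_implements hk.symm⟩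
    have h2 := hq.mul hq
    rw [Equiv.swap_mul_self] at h2
    have e : ∀ k i : Fin 6, k ≠ 0 → (if i = 0 ∨ i = k then -1 else 1 : ℤˣ) =
        (if Equiv.swap 0 k i = 0 then -1 else 1) * (if i = 0 then -1 else 1) := by
      decide
    convert h2 using 2 with i
    exact e k i hk
  have hm : ∀ δ δ', Realizable 1 δ → Realizable 1 δ' → Realizable 1 (δ * δ') := by
    intro δ δ' h1 h2
    have := h2.mul h1
    simpa [Pi.mul_def] using this
  have hs : ∀ k : Fin 6, k ≠ 0 →
      Realizable 1 (if δ k = 1 then 1 else fun i => if i = 0 ∨ i = k then -1 else 1) := by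
    intro k hk
    split_ifs
    · exact realizable_one
    · exact hf k hk
  have := hm _ _ (hs 1 (by decide)) (hm _ _ (hs 2 (by decide)) (hm _ _ (hs 3 (by decide))
    (hm _ _ (hs 4 (by decide)) (hs 5 (by decide)))))
  have e : ∀ δ : Fin 6 → ℤˣ, ∏ i, δ i = 1 → δ =
      (if δ 1 = 1 then 1 else fun i => if i = 0 ∨ i = 1 then -1 else 1) *
      ((if δ 2 = 1 then 1 else fun i => if i = 0 ∨ i = 2 then -1 else 1) *
      ((if δ 3 = 1 then 1 else fun i => if i = 0 ∨ i = 3 then -1 else 1) *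
      ((if δ 4 = 1 then 1 else fun i => if i = 0 ∨ i = 4 then -1 else 1) *
      (if δ 5 = 1 then 1 else fun i => if i = 0 ∨ i = 5 then -1 else 1)))) := by
    decide +kernel
  rw [e δ h]
  exact this

/-- Two signed permutations with the same permutation part and the same determinant differ by an
even number of sign changes. -/
theorem realizable_of_signedDet {π : Equiv.Perm (Fin 6)} {ε : Fin 6 → ℤˣ}
    (h : signedDet π ε = 1) : Realizable π ε := by
  obtain ⟨ε₀, h0, hdet⟩ := exists_realizable π
  have hδ : ∏ i, (fun i => ε (π.symm i) * ε₀ (π.symm i)) i = 1 := by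
    rw [Equiv.prod_comp π.symm (fun i => ε i * ε₀ i), Finset.prod_mul_distrib]
    rw [signedDet] at h hdet
    have := congrArg₂ (· * ·) h hdet
    simp only [mul_one] at this
    rw [mul_mul_mul_comm, Int.units_mul_self, one_mul] at this
    exact this
  have := h0.mul (realizable_flips hδ)
  simp only [Equiv.symm_apply_apply, mul_assoc, Int.units_mul_self, mul_one, one_mul] at this
  exact this

/-! ### Equivalence of states through their complex structures -/

/-- Complex conjugation of the state transposes the Pauli operators. The signs record that the first
three `gam k` are real and the last three imaginary. Their product is `-1`, so passing from a
complex structure to its negative reverses orientation. -/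
lemma cs_star (ψ : Ket) :
    SignedConj 1 ![1, 1, 1, -1, -1, -1] (cs ψ) (-cs (star ψ)) := by
  intro i j
  by_cases h : i = j
  · subst h; simp [cs_self]
  have h1 : ∀ i j : Fin 6, i ≠ j → (gammaInt i * (gammaInt j)ᴴ)ᵀ =
      -(((![1, 1, 1, -1, -1, -1] i * ![1, 1, 1, -1, -1, -1] j : ℤˣ) : ℤ) •
        (gammaInt i * (gammaInt j)ᴴ)) := by
    decide +kernel
  have h2 := congrArg IntOp.toOp (h1 i j h)
  rw [toOp_transpose, map_neg, map_zsmul, ← bil_eq_toOp, ← Int.cast_smul_eq_zsmul ℂ] at h2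
  have h3 : ev (star ψ) (bil i j) = ev ψ (bil i j)ᵀ := by
    rw [ev, ev, star_star, dotProduct_mulVec, mulVec_transpose, dotProduct_comm]
  apply Complex.ofReal_injective
  simp only [Equiv.Perm.one_apply, Matrix.neg_apply]
  rw [Complex.ofReal_neg, Complex.ofReal_mul, coe_cs _ h, coe_cs _ h, h3, h2, ← neg_smul, ev_smul]
  push_cast
  ring

lemma sum_sq_cs {ψ : Ket} (hψ : IsState ψ) : ∑ i, ∑ j, cs ψ i j * cs ψ i j = 6 := by
  have h1 : ∀ i, ∑ j, cs ψ i j * cs ψ i j = 1 := by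
    intro i
    have h := congrFun₂ (cs_mul_self hψ) i i
    rw [Matrix.mul_apply, Matrix.neg_apply, Matrix.one_apply_eq] at h
    simp only [cs_swap ψ i, mul_neg, Finset.sum_neg_distrib, neg_inj] at h
    exact h
  simp [h1]

/-- For opposite complex structures the overlap formula would give `(1 - 3) / 4`, a negative squared
modulus. -/
lemma cs_ne_neg {ψ φ : Ket} (hψ : IsState ψ) (hφ : IsState φ) : cs φ ≠ -cs ψ := by
  intro h
  have h1 := overlap_eq hψ hφ
  rw [h] at h1
  simp only [Matrix.neg_apply, mul_neg, Finset.sum_neg_distrib, sum_sq_cs hψ] at h1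
  have : 0 ≤ ‖star ψ ⬝ᵥ φ‖ ^ 2 := by positivity
  linarith

lemma isState_star {ψ : Ket} (hψ : IsState ψ) : IsState (star ψ) := by
  rw [IsState, star_star, dotProduct_comm]; exact hψ

/-- A signed permutation between the complex structures of two states has determinant one. -/
theorem signedDet_eq_one {π : Equiv.Perm (Fin 6)} {ε : Fin 6 → ℤˣ} {ψ φ : Ket} (hψ : IsState ψ)
    (hφ : IsState φ) (h : SignedConj π ε (cs ψ) (cs φ)) : signedDet π ε = 1 := by
  rcases Int.units_eq_one_or (signedDet π ε) with hd | hd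
  · exact hd
  exfalso
  -- If the determinant were `-1`, composing with complex conjugation would give a signed
  -- permutation of determinant one. A Clifford operation realising it would carry `star ψ` to a
  -- state with complex structure `-cs φ`.
  have h1 := ((cs_star ψ).symm.trans h).neg
  rw [neg_neg] at h1
  have hdet : signedDet (π * (1 : Equiv.Perm (Fin 6)).symm) (fun i => ε ((1 : Equiv.Perm (Fin 6)).symm i) *
      ![1, 1, 1, -1, -1, -1] ((1 : Equiv.Perm (Fin 6)).symm i)) = 1 := by
    refine (signedDet_mul _ _ _ _).trans ?_
    rw [signedDet_inv, hd]
    decide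
  obtain ⟨C, -, hC⟩ := realizable_of_signedDet hdet
  exact cs_ne_neg hφ ((isState_star hψ).mulVec hC.1) ((hC.signedConj _).eq h1)

theorem cliffordEquiv_of_signedConj {π : Equiv.Perm (Fin 6)} {ε : Fin 6 → ℤˣ} {ψ φ : Ket}
    (hψ : IsState ψ) (hφ : IsState φ) (h : SignedConj π ε (cs ψ) (cs φ)) : CliffordEquiv ψ φ := by
  obtain ⟨C, hC, hC'⟩ := realizable_of_signedDet (signedDet_eq_one hψ hφ h)
  obtain ⟨c, hc, hcφ⟩ := eq_smul_of_cs_eq hφ (hψ.mulVec hC.1) (h.eq (hC'.signedConj ψ))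
  exact ⟨c • C, hC.smul hc, by rw [smul_mulVec, ← hcφ]⟩

/-! ### Standard complex structures for the rows of the table -/

/-- The antisymmetric matrix with the given entries above the diagonal. -/
def antisymm (a b c d e f g h i j k l m n o : ℝ) : Matrix (Fin 6) (Fin 6) ℝ :=
  !![0, a, b, c, d, e; -a, 0, f, g, h, i; -b, -f, 0, j, k, l; -c, -g, -j, 0, m, n;
    -d, -h, -k, -m, 0, o; -e, -i, -l, -n, -o, 0]

/-- For each row of the table, the complex structure of a state in that row. -/
def rowForm : Fin 9 → Matrix (Fin 6) (Fin 6) ℝ :=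
  ![antisymm 1 0 0 0 0 0 0 0 0 1 0 0 0 0 1,
    antisymm 0 (√2)⁻¹ (√2)⁻¹ 0 0 (√2)⁻¹ (-(√2)⁻¹) 0 0 0 0 0 0 0 1,
    antisymm (√3)⁻¹ (-(√3)⁻¹) (√3)⁻¹ 0 0 (√3)⁻¹ (√3)⁻¹ 0 0 (√3)⁻¹ 0 0 0 0 1,
    antisymm 2⁻¹ 0 (-2⁻¹) (√2)⁻¹ 0 2⁻¹ 0 0 (-(√2)⁻¹) 2⁻¹ (√2)⁻¹ 0 0 (-(√2)⁻¹) 0,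
    antisymm (√3)⁻¹ (-(√3)⁻¹) (√6)⁻¹ (√6)⁻¹ 0 (√3)⁻¹ (√6)⁻¹ (√6)⁻¹ 0 (√6)⁻¹ (√6)⁻¹ 0
      0 (-(√2)⁻¹) (√2)⁻¹,
    antisymm (√3)⁻¹ (-(√3)⁻¹) 3⁻¹ 3⁻¹ 3⁻¹ (√3)⁻¹ 3⁻¹ 3⁻¹ 3⁻¹ 3⁻¹ 3⁻¹ 3⁻¹
      (√3)⁻¹ (-(√3)⁻¹) (√3)⁻¹,
    antisymm (2 / 3) 0 3⁻¹ 0 (2 / 3) (2 / 3) 0 3⁻¹ 0 (2 / 3) 0 3⁻¹ (2 / 3) 0 (2 / 3),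
    let a := √(5 + 2 * √5) / 5
    let b := √(5 - 2 * √5) / 5
    antisymm a (-b) b (-a) (√5)⁻¹ a (-b) b (√5)⁻¹ a (-b) (√5)⁻¹ a (√5)⁻¹ (√5)⁻¹,
    antisymm 2⁻¹ 0 (-2⁻¹) 2⁻¹ 2⁻¹ 2⁻¹ 0 2⁻¹ (-2⁻¹) 2⁻¹ 2⁻¹ 2⁻¹ 2⁻¹ (-2⁻¹) 0]

/-- `J` is equivalent to one of the standard complex structures. -/
def IsRow (J : Matrix (Fin 6) (Fin 6) ℝ) : Prop := ∃ r π ε, SignedConj π ε J (rowForm r)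

/-! ### Complex structures central for a signed permutation, and changes of basis -/

/-- The matrix `J` is fixed by the signed permutation `(p, e)`. -/
def Fixed (p : Fin 6 → Fin 6) (e : Fin 6 → ℤ) (J : Matrix (Fin 6) (Fin 6) ℝ) : Prop :=
  ∀ i j, J (p i) (p j) = e i * e j * J i j

/-- `J` is an orthogonal complex structure that is fixed by the signed permutation `(p, e)` and
commutes with all antisymmetric matrices fixed by it. -/
structure CentralStructure (p : Fin 6 → Fin 6) (e : Fin 6 → ℤ) (J : Matrix (Fin 6) (Fin 6) ℝ) :
    Prop where
  transpose : Jᵀ = -J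
  mul_self : J * J = -1
  fixed : Fixed p e J
  comm : ∀ K : Matrix (Fin 6) (Fin 6) ℝ, Kᵀ = -K → Fixed p e K → K * J = J * K

lemma apply_swap_of_transpose {J : Matrix (Fin 6) (Fin 6) ℝ} (h : Jᵀ = -J) (i j : Fin 6) :
    J i j = -J j i := by
  have := congrFun (congrFun h j) i
  simpa using this

/-- The factor `τ` expresses that a signed permutation and its negative act alike on matrices,
because signs enter in pairs. This freedom shortens the lists of normal forms below. -/
lemma Fixed.changeBasis {p p' : Fin 6 → Fin 6} {e e' : Fin 6 → ℤ} {J J' : Matrix (Fin 6) (Fin 6) ℝ}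
    (h : Fixed p e J) (σ : Equiv.Perm (Fin 6)) {δ : Fin 6 → ℤ} {τ : ℤ} (hτ : τ * τ = 1)
    (hp : ∀ i, p' (σ i) = σ (p i)) (he : ∀ i, e' (σ i) = τ * δ (p i) * e i * δ i)
    (hδ : ∀ i, δ i * δ i = 1) (hJ : ∀ i j, J' (σ i) (σ j) = δ i * δ j * J i j) : Fixed p' e' J' := by
  intro i j
  obtain ⟨i, rfl⟩ := σ.surjective i
  obtain ⟨j, rfl⟩ := σ.surjective j
  have hτ' : (τ : ℝ) * τ = 1 := by exact_mod_cast hτ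
  have hδ' : ∀ i, (δ i : ℝ) * δ i = 1 := fun i => by exact_mod_cast hδ i
  rw [hp, hp, hJ, hJ, h, he, he]
  push_cast
  linear_combination (-(δ (p i) * δ (p j) * e i * e j * J i j) : ℝ) * hδ' i * (τ * τ * (δ j * δ j)) -
    (δ (p i) * δ (p j) * e i * e j * J i j : ℝ) * hδ' j * (τ * τ) -
    (δ (p i) * δ (p j) * e i * e j * J i j : ℝ) * hτ'

/-- The matrix `J` in the basis transformed by a signed permutation. -/
def transform (σ : Equiv.Perm (Fin 6)) (δ : Fin 6 → ℤ) (J : Matrix (Fin 6) (Fin 6) ℝ) :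
    Matrix (Fin 6) (Fin 6) ℝ := fun i j => δ (σ.symm i) * δ (σ.symm j) * J (σ.symm i) (σ.symm j)

lemma transform_apply (σ : Equiv.Perm (Fin 6)) (δ : Fin 6 → ℤ) (J : Matrix (Fin 6) (Fin 6) ℝ)
    (i j : Fin 6) : transform σ δ J (σ i) (σ j) = δ i * δ j * J i j := by simp [transform]

lemma transform_transpose (σ : Equiv.Perm (Fin 6)) (δ : Fin 6 → ℤ)
    (J : Matrix (Fin 6) (Fin 6) ℝ) : (transform σ δ J)ᵀ = transform σ δ Jᵀ := by
  ext i j; simp only [transform, transpose_apply]; ring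

lemma transform_neg (σ : Equiv.Perm (Fin 6)) (δ : Fin 6 → ℤ) (J : Matrix (Fin 6) (Fin 6) ℝ) :
    transform σ δ (-J) = -transform σ δ J := by
  ext i j; simp [transform]

lemma transform_mul (σ : Equiv.Perm (Fin 6)) {δ : Fin 6 → ℤ} (hδ : ∀ i, δ i * δ i = 1)
    (J K : Matrix (Fin 6) (Fin 6) ℝ) :
    transform σ δ (J * K) = transform σ δ J * transform σ δ K := by
  have hδ' : ∀ i, (δ i : ℝ) * δ i = 1 := fun i => by exact_mod_cast hδ i
  ext i j
  obtain ⟨i, rfl⟩ := σ.surjective i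
  obtain ⟨j, rfl⟩ := σ.surjective j
  rw [transform_apply, mul_apply, mul_apply, Finset.mul_sum,
    ← Equiv.sum_comp σ (fun k => transform σ δ J (σ i) k * transform σ δ K k (σ j))]
  refine Finset.sum_congr rfl fun k _ => ?_
  rw [transform_apply, transform_apply]
  linear_combination (-(δ i * δ j * J i k * K k j) : ℝ) * hδ' k

lemma transform_one (σ : Equiv.Perm (Fin 6)) {δ : Fin 6 → ℤ} (hδ : ∀ i, δ i * δ i = 1) :
    transform σ δ 1 = 1 := by
  ext i j
  by_cases h : i = j
  · subst h
    have : (δ (σ.symm i) : ℝ) * δ (σ.symm i) = 1 := by exact_mod_cast hδ _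
    simp [transform, this]
  · simp [transform, h]

lemma exists_units_of_mul_self {e : Fin 6 → ℝ} (h : ∀ i, e i * e i = 1) :
    ∃ ε : Fin 6 → ℤˣ, ∀ i, ((ε i : ℤ) : ℝ) = e i := by
  have h1 : ∀ i, ∃ u : ℤˣ, ((u : ℤ) : ℝ) = e i := fun i => by
    rcases mul_self_eq_one_iff.mp (h i) with h | h
    · exact ⟨1, by simp [h]⟩
    · exact ⟨-1, by simp [h]⟩
  choose ε hε using h1
  exact ⟨ε, hε⟩

lemma isRow_transform {σ : Equiv.Perm (Fin 6)} {δ : Fin 6 → ℤ} (hδ : ∀ i, δ i * δ i = 1)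
    {J : Matrix (Fin 6) (Fin 6) ℝ} (h : IsRow (transform σ δ J)) : IsRow J := by
  obtain ⟨r, π, ε, h⟩ := h
  obtain ⟨η, hη⟩ := exists_units_of_mul_self (e := fun i => (δ i : ℝ))
    (fun i => by exact_mod_cast hδ i)
  have h1 : SignedConj σ η J (transform σ δ J) := by
    intro i j
    rw [transform_apply]
    push_cast
    rw [hη, hη]
  exact ⟨r, _, _, h1.trans h⟩

/-- Change of basis for central structures. -/
lemma CentralStructure.changeBasis {p p' : Fin 6 → Fin 6} {e e' : Fin 6 → ℤ}
    {J : Matrix (Fin 6) (Fin 6) ℝ} (h : CentralStructure p e J) (σ : Equiv.Perm (Fin 6))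
    (δ : Fin 6 → ℤ) (τ : ℤ) (hτ : τ * τ = 1) (hδ : ∀ i, δ i * δ i = 1)
    (hp : ∀ i, p' (σ i) = σ (p i)) (he : ∀ i, e' (σ i) = τ * δ (p i) * e i * δ i) :
    CentralStructure p' e' (transform σ δ J) where
  transpose := by rw [transform_transpose, h.transpose, transform_neg]
  mul_self := by rw [← transform_mul σ hδ, h.mul_self, transform_neg, transform_one σ hδ]
  fixed := h.fixed.changeBasis σ hτ hp he hδ (transform_apply σ δ J)
  comm := by
    intro K hK hKf
    have hδ' : ∀ i, (δ i : ℝ) * δ i = 1 := fun i => by exact_mod_cast hδ i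
    set L : Matrix (Fin 6) (Fin 6) ℝ := fun i j => δ i * δ j * K (σ i) (σ j) with hL
    have hKL : K = transform σ δ L := by
      ext i j
      obtain ⟨i, rfl⟩ := σ.surjective i
      obtain ⟨j, rfl⟩ := σ.surjective j
      rw [transform_apply, hL]
      linear_combination (-K (σ i) (σ j)) * hδ' i * (δ j * δ j) - K (σ i) (σ j) * hδ' j
    have hLf : Fixed p e L := by
      refine hKf.changeBasis σ.symm (δ := fun i => δ (σ.symm i)) hτ ?_ ?_ (fun i => hδ _) ?_
      · intro i
        obtain ⟨i, rfl⟩ := σ.surjective i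
        rw [hp]; simp
      · intro i
        obtain ⟨i, rfl⟩ := σ.surjective i
        rw [hp, he]
        simp only [Equiv.symm_apply_apply]
        have h1 := hδ i
        have h2 := hδ (p i)
        linear_combination (-e i) * hτ - e i * τ * τ * h1 - e i * τ * τ * (δ i * δ i) * h2
      · intro i j
        simp [hL]
    have hLt : Lᵀ = -L := by
      ext i j
      have := apply_swap_of_transpose hK (σ i) (σ j)
      change δ j * δ i * K (σ j) (σ i) = -(δ i * δ j * K (σ i) (σ j) : ℝ)
      rw [this]; ring
    rw [hKL, ← transform_mul σ hδ, ← transform_mul σ hδ, h.comm L hLt hLf]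

/-! ### Constraints on central structures -/

lemma antisymm_transpose (a b c d e f g h i j k l m n o : ℝ) :
    (antisymm a b c d e f g h i j k l m n o)ᵀ = -antisymm a b c d e f g h i j k l m n o := by
  ext x y
  fin_cases x <;> fin_cases y <;> simp [antisymm]

lemma rowForm_transpose (r : Fin 9) : (rowForm r)ᵀ = -rowForm r := by
  fin_cases r <;> exact antisymm_transpose ..

lemma exists_eq_antisymm {J : Matrix (Fin 6) (Fin 6) ℝ} (h : Jᵀ = -J) :
    ∃ a b c d e f g h i j k l m n o, J = antisymm a b c d e f g h i j k l m n o := by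
  refine ⟨J 0 1, J 0 2, J 0 3, J 0 4, J 0 5, J 1 2, J 1 3, J 1 4, J 1 5, J 2 3, J 2 4, J 2 5,
    J 3 4, J 3 5, J 4 5, ?_⟩
  have h1 := apply_swap_of_transpose h
  have h2 : ∀ i, J i i = 0 := fun i => by linarith [h1 i i]
  ext x y
  fin_cases x <;> fin_cases y <;> first | exact h1 _ _ | exact h2 _ | rfl

lemma ext_of_lt {A B : Matrix (Fin 6) (Fin 6) ℝ} (hA : Aᵀ = -A) (hB : Bᵀ = -B)
    (h : ∀ i j, i < j → A i j = B i j) : A = B := by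
  ext i j
  have h1 := apply_swap_of_transpose hA
  have h2 := apply_swap_of_transpose hB
  rcases lt_trichotomy i j with hij | rfl | hij
  · exact h i j hij
  · linarith [h1 i i, h2 i i]
  · rw [h1, h2, h j i hij]

/-- Antisymmetry reduces the equivalence to fifteen scalar equations above the diagonal. The signs
are real numbers here, so that they may contain sign variables found while solving for `J`. -/
lemma exists_signedConj_antisymm (r : Fin 9) {a b c d e f g h i j k l m n o : ℝ} (p : Fin 6 → Fin 6)
    (s : Fin 6 → ℝ) (hp : Function.Injective p) (hs : ∀ i, s i * s i = 1)
    (H : (rowForm r (p 0) (p 1) = s 0 * s 1 * a ∧ rowForm r (p 0) (p 2) = s 0 * s 2 * b ∧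
      rowForm r (p 0) (p 3) = s 0 * s 3 * c ∧ rowForm r (p 0) (p 4) = s 0 * s 4 * d ∧
      rowForm r (p 0) (p 5) = s 0 * s 5 * e) ∧ (rowForm r (p 1) (p 2) = s 1 * s 2 * f ∧
      rowForm r (p 1) (p 3) = s 1 * s 3 * g ∧ rowForm r (p 1) (p 4) = s 1 * s 4 * h ∧
      rowForm r (p 1) (p 5) = s 1 * s 5 * i) ∧ (rowForm r (p 2) (p 3) = s 2 * s 3 * j ∧
      rowForm r (p 2) (p 4) = s 2 * s 4 * k ∧ rowForm r (p 2) (p 5) = s 2 * s 5 * l) ∧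
      (rowForm r (p 3) (p 4) = s 3 * s 4 * m ∧ rowForm r (p 3) (p 5) = s 3 * s 5 * n) ∧
      rowForm r (p 4) (p 5) = s 4 * s 5 * o) :
    ∃ (π : Equiv.Perm (Fin 6)) (ε : Fin 6 → ℤˣ), (∀ x, π x = p x) ∧ (∀ x, ((ε x : ℤ) : ℝ) = s x) ∧
      SignedConj π ε (antisymm a b c d e f g h i j k l m n o) (rowForm r) := by
  obtain ⟨ε, hε⟩ := exists_units_of_mul_self hs
  refine ⟨Equiv.ofBijective p (Finite.injective_iff_bijective.mp hp), ε, fun _ => rfl, hε, ?_⟩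
  obtain ⟨⟨h1, h2, h3, h4, h5⟩, ⟨h6, h7, h8, h9⟩, ⟨h10, h11, h12⟩, ⟨h13, h14⟩, h15⟩ := H
  have key : (fun x y => s x * s y * rowForm r (p x) (p y) : Matrix (Fin 6) (Fin 6) ℝ) =
      antisymm a b c d e f g h i j k l m n o := by
    refine ext_of_lt ?_ (antisymm_transpose ..) ?_
    · ext x y
      change s y * s x * rowForm r (p y) (p x) = -(s x * s y * rowForm r (p x) (p y))
      rw [apply_swap_of_transpose (rowForm_transpose r) (p y)]; ring
    · have aux : ∀ {x y : Fin 6} {z w : ℝ}, w = s x * s y * z → s x * s y * w = z := by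
        intro x y z w hw
        rw [hw]
        linear_combination z * hs x * (s y * s y) + z * hs y
      intro x y hxy
      fin_cases x <;> fin_cases y <;>
        first
        | exact absurd hxy (by decide)
        | exact aux ‹_›
  intro x y
  change rowForm r (p x) (p y) = _
  rw [← key]
  push_cast
  rw [hε, hε]
  linear_combination (-rowForm r (p x) (p y)) * hs x * (s y * s y) -
    rowForm r (p x) (p y) * hs y

lemma isRow_antisymm (r : Fin 9) {a b c d e f g h i j k l m n o : ℝ} (p : Fin 6 → Fin 6)
    (s : Fin 6 → ℝ) (hp : Function.Injective p) (hs : ∀ i, s i * s i = 1)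
    (H : (rowForm r (p 0) (p 1) = s 0 * s 1 * a ∧ rowForm r (p 0) (p 2) = s 0 * s 2 * b ∧
      rowForm r (p 0) (p 3) = s 0 * s 3 * c ∧ rowForm r (p 0) (p 4) = s 0 * s 4 * d ∧
      rowForm r (p 0) (p 5) = s 0 * s 5 * e) ∧ (rowForm r (p 1) (p 2) = s 1 * s 2 * f ∧
      rowForm r (p 1) (p 3) = s 1 * s 3 * g ∧ rowForm r (p 1) (p 4) = s 1 * s 4 * h ∧
      rowForm r (p 1) (p 5) = s 1 * s 5 * i) ∧ (rowForm r (p 2) (p 3) = s 2 * s 3 * j ∧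
      rowForm r (p 2) (p 4) = s 2 * s 4 * k ∧ rowForm r (p 2) (p 5) = s 2 * s 5 * l) ∧
      (rowForm r (p 3) (p 4) = s 3 * s 4 * m ∧ rowForm r (p 3) (p 5) = s 3 * s 5 * n) ∧
      rowForm r (p 4) (p 5) = s 4 * s 5 * o) :
    IsRow (antisymm a b c d e f g h i j k l m n o) := by
  obtain ⟨π, ε, -, -, h⟩ := exists_signedConj_antisymm r p s hp hs H
  exact ⟨r, π, ε, h⟩

lemma CentralStructure.comm_int {p : Fin 6 → Fin 6} {e : Fin 6 → ℤ}
    {J : Matrix (Fin 6) (Fin 6) ℝ} (h : CentralStructure p e J) (K : Matrix (Fin 6) (Fin 6) ℤ)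
    (hK : ∀ i j, K j i = -K i j) (hf : ∀ i j, K (p i) (p j) = e i * e j * K i j) :
    K.map (Int.cast : ℤ → ℝ) * J = J * K.map (Int.cast : ℤ → ℝ) := by
  refine h.comm _ ?_ ?_
  · ext i j
    simp [hK i j]
  · intro i j
    simp only [map_apply]
    exact_mod_cast hf i j

/-- The generator of rotations in the coordinate plane spanned by `a` and `b`. -/
def planeRotation (a b : Fin 6) : Matrix (Fin 6) (Fin 6) ℤ :=
  fun i j => if i = a ∧ j = b then 1 else if i = b ∧ j = a then -1 else 0

/-- When the rotation in the plane `a, b` is itself fixed, `J` commutes with it and hence maps the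
plane to itself. -/
lemma CentralStructure.isolated {p : Fin 6 → Fin 6} {e : Fin 6 → ℤ}
    {J : Matrix (Fin 6) (Fin 6) ℝ} (h : CentralStructure p e J) {a b : Fin 6} (hab : a ≠ b)
    (hK : ∀ i j, planeRotation a b j i = -planeRotation a b i j)
    (hf : ∀ i j, planeRotation a b (p i) (p j) = e i * e j * planeRotation a b i j) {c : Fin 6}
    (ha : a ≠ c) (hb : b ≠ c) : J a c = 0 ∧ J b c = 0 := by
  have h1 := h.comm_int _ hK hf
  have h2 : ∀ i, (J * (planeRotation a b).map (Int.cast : ℤ → ℝ)) i c = 0 := fun i => by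
    rw [mul_apply]
    refine Finset.sum_eq_zero fun k _ => ?_
    simp [planeRotation, ha.symm, hb.symm]
  have h3 := h2 b
  have h4 := h2 a
  rw [← h1, mul_apply] at h3 h4
  simp [planeRotation, hab, hab.symm] at h3 h4
  exact ⟨h3, h4⟩

lemma vecMulVec_sub_mulVec (u v x : Fin 6 → ℝ) :
    (vecMulVec u v - vecMulVec v u) *ᵥ x = (v ⬝ᵥ x) • u - (u ⬝ᵥ x) • v := by
  rw [sub_mulVec, vecMulVec_mulVec, vecMulVec_mulVec]
  simp

lemma mulVec_eq_zero_of_mul_self {J : Matrix (Fin 6) (Fin 6) ℝ} (h : J * J = -1) {u : Fin 6 → ℝ}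
    (hu : J *ᵥ u = 0) : u = 0 := by
  have h1 := congrArg (fun x => J *ᵥ x) hu
  simp only [mulVec_mulVec, h, mulVec_zero, neg_mulVec, one_mulVec] at h1
  simpa using h1

lemma CentralStructure.dotProduct_eq_zero {p : Fin 6 → Fin 6} {e : Fin 6 → ℤ}
    {J : Matrix (Fin 6) (Fin 6) ℝ} (h : CentralStructure p e J) {τ : ℝ} (hτ : τ * τ = 1)
    {u v w : Fin 6 → ℝ} (hu : ∀ i, u (p i) = τ * e i * u i) (hv : ∀ i, v (p i) = τ * e i * v i)
    (huv : u ⬝ᵥ v = 0) (huw : u ⬝ᵥ w = 0) (hvw : v ⬝ᵥ w = 0) (hu0 : u ≠ 0) :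
    (vecMulVec u v - vecMulVec v u) * J = J * (vecMulVec u v - vecMulVec v u) ∧
      v ⬝ᵥ (J *ᵥ w) = 0 := by
  have h1 : (vecMulVec u v - vecMulVec v u) * J = J * (vecMulVec u v - vecMulVec v u) := by
    refine h.comm _ ?_ ?_
    · ext i j; simp [vecMulVec]; ring
    · intro i j
      simp only [Matrix.sub_apply, vecMulVec_apply, hu, hv]
      linear_combination (e i * e j * (u i * v j - v i * u j)) * hτ
  refine ⟨h1, ?_⟩
  -- Applied to `w` and paired with `u`, the commutation relation reads `(v ⬝ J w) (u ⬝ u) = 0`.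
  have h2 := congrArg (fun A => u ⬝ᵥ (A *ᵥ w)) h1
  simp only [← mulVec_mulVec, vecMulVec_sub_mulVec, huw, hvw, dotProduct_sub, dotProduct_smul,
    huv, zero_smul, sub_zero, mulVec_zero, dotProduct_zero, smul_eq_mul, mul_zero, mul_eq_zero,
    dotProduct_self_eq_zero] at h2
  exact h2.resolve_right hu0

/-- Three orthogonal vectors with the same eigenvalue span a copy of `so(3)` in the centralizer, and
`so(3)` has trivial centre. Commuting with the rotation in the plane of `u` and `v` then forces `J u
= 0`, against `J² = -1`. -/
lemma CentralStructure.false_of_eigenvectors {p : Fin 6 → Fin 6} {e : Fin 6 → ℤ}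
    {J : Matrix (Fin 6) (Fin 6) ℝ} (h : CentralStructure p e J) (τ : ℤ) (u v w : Fin 6 → ℤ)
    (hτ : τ * τ = 1) (hu : ∀ i, u (p i) = τ * e i * u i) (hv : ∀ i, v (p i) = τ * e i * v i)
    (hw : ∀ i, w (p i) = τ * e i * w i) (huv : u ⬝ᵥ v = 0) (huw : u ⬝ᵥ w = 0) (hvw : v ⬝ᵥ w = 0)
    (hu0 : u ≠ 0) (hv0 : v ≠ 0) (hw0 : w ≠ 0) : False := by
  have hτ' : (τ : ℝ) * τ = 1 := by exact_mod_cast hτ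
  let r : (Fin 6 → ℤ) → Fin 6 → ℝ := fun x i => x i
  have hr : ∀ {x : Fin 6 → ℤ}, (∀ i, x (p i) = τ * e i * x i) →
      ∀ i, r x (p i) = τ * e i * r x i := fun hx i => by
    simp only [r, hx]; push_cast; ring
  have hd : ∀ {x y : Fin 6 → ℤ}, x ⬝ᵥ y = 0 → r x ⬝ᵥ r y = 0 := fun {x y} hxy => by
    simp only [dotProduct, r] at hxy ⊢
    exact_mod_cast hxy
  have hz : ∀ {x : Fin 6 → ℤ}, x ≠ 0 → r x ≠ 0 := fun {x} hx hx' => hx (by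
    ext i
    have := congrFun hx' i
    simpa [r] using this)
  have huv' := hd huv
  have huw' := hd huw
  have hvw' := hd hvw
  have hwv' : r w ⬝ᵥ r v = 0 := by rw [dotProduct_comm]; exact hvw'
  obtain ⟨h1, -⟩ := h.dotProduct_eq_zero hτ' (hr hu) (hr hv) huv' huw' hvw' (hz hu0)
  obtain ⟨-, h2⟩ := h.dotProduct_eq_zero hτ' (hr hw) (hr hu) (by rw [dotProduct_comm]; exact huw')
    hwv' huv' (hz hw0)
  have h3 : r v ⬝ᵥ (J *ᵥ r v) = 0 := by
    have h4 : r v ⬝ᵥ (J *ᵥ r v) = -(r v ⬝ᵥ (J *ᵥ r v)) := by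
      conv_lhs => rw [dotProduct_mulVec, ← mulVec_transpose, h.transpose, neg_mulVec,
        neg_dotProduct, dotProduct_comm]
    linarith
  have h5 := congrArg (fun A => A *ᵥ r v) h1
  simp only [← mulVec_mulVec, vecMulVec_sub_mulVec, h2, h3, huv', zero_smul, sub_zero,
    mulVec_smul] at h5
  have h6 : r v ⬝ᵥ r v ≠ 0 := by
    rw [Ne, dotProduct_self_eq_zero]; exact hz hv0
  have h7 := (smul_eq_zero.mp h5.symm).resolve_left h6
  exact hz hu0 (mulVec_eq_zero_of_mul_self h.mul_self h7)

lemma exists_sign {x c : ℝ} (h : x ^ 2 = c ^ 2) : ∃ s : ℝ, (s = 1 ∨ s = -1) ∧ x = s * c := by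
  rcases sq_eq_sq_iff_eq_or_eq_neg.mp h with h | h
  · exact ⟨1, Or.inl rfl, by rw [h, one_mul]⟩
  · exact ⟨-1, Or.inr rfl, by rw [h]; ring⟩

lemma mul_self_apply {J : Matrix (Fin 6) (Fin 6) ℝ} (h : J * J = -1) (i j : Fin 6) :
    J i 0 * J 0 j + J i 1 * J 1 j + J i 2 * J 2 j + J i 3 * J 3 j + J i 4 * J 4 j +
      J i 5 * J 5 j = if i = j then -1 else 0 := by
  have h1 := congrFun (congrFun h i) j
  rw [mul_apply, Fin.sum_univ_six] at h1
  rw [h1, neg_apply, one_apply]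
  split_ifs <;> simp

/-! ### Recognizing the rows -/

lemma inv_sqrt_sq (x : ℝ) (hx : 0 ≤ x) : (√x)⁻¹ ^ 2 = x⁻¹ := by rw [inv_pow, Real.sq_sqrt hx]

/-- The matrices in this section are what the fixed-point and centrality conditions leave for some
cycle type. In each of them `J² = -1` determines the parameters up to signs, and a signed
permutation absorbs the signs. -/
lemma isRow_matching {a b c : ℝ} (h : antisymm a 0 0 0 0 0 0 0 0 b 0 0 0 0 c *
    antisymm a 0 0 0 0 0 0 0 0 b 0 0 0 0 c = -1) :
    IsRow (antisymm a 0 0 0 0 0 0 0 0 b 0 0 0 0 c) := by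
  have h0 := mul_self_apply h 0 0
  have h2 := mul_self_apply h 2 2
  have h4 := mul_self_apply h 4 4
  simp [antisymm] at h0 h2 h4
  obtain ⟨s, hs, rfl⟩ := exists_sign (x := a) (c := 1) (by linarith)
  obtain ⟨t, ht, rfl⟩ := exists_sign (x := b) (c := 1) (by linarith)
  obtain ⟨u, hu, rfl⟩ := exists_sign (x := c) (c := 1) (by linarith)
  refine isRow_antisymm 0 ![0, 1, 2, 3, 4, 5] ![1, s, 1, t, 1, u] (by decide) ?_ ?_ <;>
  rcases hs with rfl | rfl <;> rcases ht with rfl | rfl <;> rcases hu with rfl | rfl <;>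
    simp [rowForm, antisymm, Fin.forall_fin_succ]

lemma isRow_two {a b c : ℝ} (h : antisymm 0 0 0 a b 0 0 a (-b) c 0 0 0 0 0 *
    antisymm 0 0 0 a b 0 0 a (-b) c 0 0 0 0 0 = -1) :
    IsRow (antisymm 0 0 0 a b 0 0 a (-b) c 0 0 0 0 0) := by
  have h0 := mul_self_apply h 0 0
  have h2 := mul_self_apply h 2 2
  have h4 := mul_self_apply h 4 4
  simp [antisymm] at h0 h2 h4
  obtain ⟨s, hs, rfl⟩ := exists_sign (x := a) (c := (√2)⁻¹)
    (by rw [inv_sqrt_sq _ (by norm_num)]; linarith)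
  obtain ⟨t, ht, rfl⟩ := exists_sign (x := b) (c := (√2)⁻¹)
    (by rw [inv_sqrt_sq _ (by norm_num)]; linarith)
  obtain ⟨u, hu, rfl⟩ := exists_sign (x := c) (c := 1) (by linarith)
  refine isRow_antisymm 1 ![0, 1, 4, 5, 2, 3] ![1, 1, 1, u, s, t] (by decide) ?_ ?_ <;>
  rcases hs with rfl | rfl <;> rcases ht with rfl | rfl <;> rcases hu with rfl | rfl <;>
    simp [rowForm, antisymm, Fin.forall_fin_succ]

lemma isRow_three {a b c : ℝ} (h : antisymm a (-a) b 0 0 a b 0 0 b 0 0 0 0 c *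
    antisymm a (-a) b 0 0 a b 0 0 b 0 0 0 0 c = -1) :
    IsRow (antisymm a (-a) b 0 0 a b 0 0 b 0 0 0 0 c) := by
  have h0 := mul_self_apply h 0 0
  have h3 := mul_self_apply h 3 3
  have h4 := mul_self_apply h 4 4
  simp [antisymm] at h0 h3 h4
  obtain ⟨s, hs, rfl⟩ := exists_sign (x := a) (c := (√3)⁻¹)
    (by rw [inv_sqrt_sq _ (by norm_num)]; linarith)
  obtain ⟨t, ht, rfl⟩ := exists_sign (x := b) (c := (√3)⁻¹)
    (by rw [inv_sqrt_sq _ (by norm_num)]; linarith)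
  obtain ⟨u, hu, rfl⟩ := exists_sign (x := c) (c := 1) (by linarith)
  rcases hs with rfl | rfl
  · refine isRow_antisymm 2 ![0, 1, 2, 3, 4, 5] ![1, 1, 1, t, 1, u] (by decide) ?_ ?_ <;>
    rcases ht with rfl | rfl <;> rcases hu with rfl | rfl <;>
      simp [rowForm, antisymm, Fin.forall_fin_succ]
  · refine isRow_antisymm 2 ![0, 1, 3, 2, 4, 5] ![1, -1, 1, -t, 1, u] (by decide) ?_ ?_ <;>
    rcases ht with rfl | rfl <;> rcases hu with rfl | rfl <;>
      simp [rowForm, antisymm, Fin.forall_fin_succ]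

lemma isRow_two_two {a b c : ℝ} (h : antisymm 0 a b 0 0 b a 0 0 0 0 0 0 0 c *
    antisymm 0 a b 0 0 b a 0 0 0 0 0 0 0 c = -1) :
    IsRow (antisymm 0 a b 0 0 b a 0 0 0 0 0 0 0 c) := by
  have h0 := mul_self_apply h 0 0
  have h1 := mul_self_apply h 0 1
  have h4 := mul_self_apply h 4 4
  simp [antisymm] at h0 h1 h4
  -- An off-diagonal entry of `J²` is `-2ab`, so the matrix degenerates to a matching.
  have hab : a * b = 0 := by linarith
  obtain ⟨u, hu, rfl⟩ := exists_sign (x := c) (c := 1) (by linarith)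
  rcases mul_eq_zero.mp hab with rfl | rfl
  · obtain ⟨s, hs, rfl⟩ := exists_sign (x := b) (c := 1) (by linarith)
    refine isRow_antisymm 0 ![0, 2, 3, 1, 4, 5] ![1, 1, s, s, 1, u] (by decide) ?_ ?_ <;>
    rcases hs with rfl | rfl <;> rcases hu with rfl | rfl <;>
      simp [rowForm, antisymm, Fin.forall_fin_succ]
  · obtain ⟨s, hs, rfl⟩ := exists_sign (x := a) (c := 1) (by linarith)
    refine isRow_antisymm 0 ![0, 2, 1, 3, 4, 5] ![1, 1, s, s, 1, u] (by decide) ?_ ?_ <;>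
    rcases hs with rfl | rfl <;> rcases hu with rfl | rfl <;>
      simp [rowForm, antisymm, Fin.forall_fin_succ]

lemma isRow_four {a b c : ℝ} (h : antisymm a b a 0 0 a b 0 0 a 0 0 0 0 c *
    antisymm a b a 0 0 a b 0 0 a 0 0 0 0 c = -1) :
    IsRow (antisymm a b a 0 0 a b 0 0 a 0 0 0 0 c) := by
  have h0 := mul_self_apply h 0 0
  have h1 := mul_self_apply h 0 1
  have h4 := mul_self_apply h 4 4
  simp [antisymm] at h0 h1 h4
  have hab : a * b = 0 := by linarith
  obtain ⟨u, hu, rfl⟩ := exists_sign (x := c) (c := 1) (by linarith)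
  rcases mul_eq_zero.mp hab with rfl | rfl
  · obtain ⟨s, hs, rfl⟩ := exists_sign (x := b) (c := 1) (by linarith)
    refine isRow_antisymm 0 ![0, 2, 1, 3, 4, 5] ![1, 1, s, s, 1, u] (by decide) ?_ ?_ <;>
    rcases hs with rfl | rfl <;> rcases hu with rfl | rfl <;>
      simp [rowForm, antisymm, Fin.forall_fin_succ]
  · obtain ⟨s, hs, rfl⟩ := exists_sign (x := a) (c := (√2)⁻¹)
      (by rw [inv_sqrt_sq _ (by norm_num)]; linarith)
    refine isRow_antisymm 1 ![0, 2, 1, 3, 4, 5] ![1, s, -1, s, 1, u] (by decide) ?_ ?_ <;>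
    rcases hs with rfl | rfl <;> rcases hu with rfl | rfl <;>
      simp [rowForm, antisymm, Fin.forall_fin_succ]

lemma isRow_three_two {a b c : ℝ} (h : antisymm a (-a) 0 b b a 0 b b 0 b b c (-c) 0 *
    antisymm a (-a) 0 b b a 0 b b 0 b b c (-c) 0 = -1) :
    IsRow (antisymm a (-a) 0 b b a 0 b b 0 b b c (-c) 0) := by
  have h0 := mul_self_apply h 0 0
  have h3 := mul_self_apply h 3 3
  have h4 := mul_self_apply h 4 4
  simp [antisymm] at h0 h3 h4
  obtain ⟨s, hs, rfl⟩ := exists_sign (x := a) (c := (√3)⁻¹)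
    (by rw [inv_sqrt_sq _ (by norm_num)]; linarith)
  obtain ⟨t, ht, rfl⟩ := exists_sign (x := b) (c := (√6)⁻¹)
    (by rw [inv_sqrt_sq _ (by norm_num)]; linarith)
  obtain ⟨u, hu, rfl⟩ := exists_sign (x := c) (c := (√2)⁻¹)
    (by rw [inv_sqrt_sq _ (by norm_num)]; linarith)
  rcases hs with rfl | rfl
  · refine isRow_antisymm 4 ![0, 1, 2, 5, 3, 4] ![1, 1, 1, t * u, t, t] (by decide) ?_ ?_ <;>
    rcases ht with rfl | rfl <;> rcases hu with rfl | rfl <;>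
      simp [rowForm, antisymm, Fin.forall_fin_succ]
  · refine isRow_antisymm 4 ![0, 2, 1, 5, 3, 4] ![1, 1, 1, t * u, t, t] (by decide) ?_ ?_ <;>
    rcases ht with rfl | rfl <;> rcases hu with rfl | rfl <;>
      simp [rowForm, antisymm, Fin.forall_fin_succ]

lemma isRow_three_three {a b : ℝ} (h : antisymm a (-a) b b b a b b b b b b a (-a) a *
    antisymm a (-a) b b b a b b b b b b a (-a) a = -1) :
    IsRow (antisymm a (-a) b b b a b b b b b b a (-a) a) := by
  have h0 := mul_self_apply h 0 0
  have h1 := mul_self_apply h 0 1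
  simp [antisymm] at h0 h1
  obtain ⟨s, hs, rfl⟩ := exists_sign (x := a) (c := (√3)⁻¹)
    (by rw [inv_sqrt_sq _ (by norm_num)]; linarith)
  obtain ⟨t, ht, rfl⟩ := exists_sign (x := b) (c := 3⁻¹)
    (by
      have : (s * (√3)⁻¹) * (s * (√3)⁻¹) = 1 / 3 := by
        have := inv_sqrt_sq 3 (by norm_num)
        rcases hs with rfl | rfl <;> linarith
      linarith)
  rcases hs with rfl | rfl
  · refine isRow_antisymm 5 ![0, 1, 2, 3, 4, 5] ![1, 1, 1, t, t, t] (by decide) ?_ ?_ <;>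
    rcases ht with rfl | rfl <;> simp [rowForm, antisymm, Fin.forall_fin_succ]
  · refine isRow_antisymm 5 ![0, 2, 1, 3, 5, 4] ![1, 1, 1, t, t, t] (by decide) ?_ ?_ <;>
    rcases ht with rfl | rfl <;> simp [rowForm, antisymm, Fin.forall_fin_succ]

lemma isRow_four_one_one {a b c : ℝ} (h : antisymm a 0 (-a) b c a 0 b (-c) a b c b (-c) 0 *
    antisymm a 0 (-a) b c a 0 b (-c) a b c b (-c) 0 = -1) :
    IsRow (antisymm a 0 (-a) b c a 0 b (-c) a b c b (-c) 0) := by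
  have h0 := mul_self_apply h 0 0
  have h4 := mul_self_apply h 4 4
  have h5 := mul_self_apply h 5 5
  simp [antisymm] at h0 h4 h5
  obtain ⟨s, hs, rfl⟩ := exists_sign (x := a) (c := 2⁻¹) (by linarith)
  obtain ⟨t, ht, rfl⟩ := exists_sign (x := b) (c := 2⁻¹) (by linarith)
  obtain ⟨u, hu, rfl⟩ := exists_sign (x := c) (c := 2⁻¹) (by linarith)
  rcases hs with rfl | rfl
  · refine isRow_antisymm 8 ![0, 1, 2, 3, 4, 5] ![1, 1, 1, 1, t, u] (by decide) ?_ ?_ <;>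
    rcases ht with rfl | rfl <;> rcases hu with rfl | rfl <;>
      simp [rowForm, antisymm, Fin.forall_fin_succ]
  · refine isRow_antisymm 8 ![0, 1, 2, 3, 5, 4] ![1, -1, 1, -1, t, u] (by decide) ?_ ?_ <;>
    rcases ht with rfl | rfl <;> rcases hu with rfl | rfl <;>
      simp [rowForm, antisymm, Fin.forall_fin_succ]

lemma isRow_four_two {a b c : ℝ} (h : antisymm a 0 (-a) b c a 0 c b a b c c b 0 *
    antisymm a 0 (-a) b c a 0 c b a b c c b 0 = -1) :
    IsRow (antisymm a 0 (-a) b c a 0 c b a b c c b 0) := by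
  have h0 := mul_self_apply h 0 0
  have h4 := mul_self_apply h 4 4
  have h5 := mul_self_apply h 4 5
  simp [antisymm] at h0 h4 h5
  have hbc : b * c = 0 := by linarith
  obtain ⟨s, hs, rfl⟩ := exists_sign (x := a) (c := 2⁻¹) (by linarith)
  rcases mul_eq_zero.mp hbc with rfl | rfl
  · obtain ⟨t, ht, rfl⟩ := exists_sign (x := c) (c := (√2)⁻¹)
      (by rw [inv_sqrt_sq _ (by norm_num)]; linarith)
    refine isRow_antisymm 3 ![0, 1, 2, 3, 5, 4] ![1, s, 1, s, -(s * t), t] (by decide) ?_ ?_ <;>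
    rcases hs with rfl | rfl <;> rcases ht with rfl | rfl <;>
      simp [rowForm, antisymm, Fin.forall_fin_succ]
  · obtain ⟨t, ht, rfl⟩ := exists_sign (x := b) (c := (√2)⁻¹)
      (by rw [inv_sqrt_sq _ (by norm_num)]; linarith)
    refine isRow_antisymm 3 ![0, 1, 2, 3, 4, 5] ![1, s, 1, s, t, -(s * t)] (by decide) ?_ ?_ <;>
    rcases hs with rfl | rfl <;> rcases ht with rfl | rfl <;>
      simp [rowForm, antisymm, Fin.forall_fin_succ]

lemma inv_sqrt_five_cubed : √(5 + 2 * √5) / 5 * (√(5 - 2 * √5) / 5) = √5 / 25 := by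
  have h5 : √5 ^ 2 = 5 := Real.sq_sqrt (by norm_num)
  have h : √(5 + 2 * √5) * √(5 - 2 * √5) = √5 := by
    rw [← Real.sqrt_mul (by positivity)]
    congr 1
    linear_combination (-4) * h5
  linear_combination h / 25

/-- The matrix is a circulant of size five bordered by a constant. There are four solutions for `(a,
b)`, and they are related by multiplying the first five indices by `3, 2, 1, 4` modulo `5`, in the
order of the cases. -/
lemma isRow_five {a b c : ℝ} (h : antisymm a b (-b) (-a) c a b (-b) c a b c a c c *
    antisymm a b (-b) (-a) c a b (-b) c a b c a c c = -1) :
    IsRow (antisymm a b (-b) (-a) c a b (-b) c a b c a c c) := by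
  have h0 := mul_self_apply h 0 1
  have h1 := mul_self_apply h 0 2
  have h5 := mul_self_apply h 5 5
  simp [antisymm] at h0 h1 h5
  have hr : √5 ^ 2 = 5 := Real.sq_sqrt (by norm_num)
  have hr2 : √5 < 5 / 2 := by rw [Real.sqrt_lt' (by norm_num)]; norm_num
  have hr0 : √5 ≠ 0 := by positivity
  have hA : (√(5 + 2 * √5) / 5) ^ 2 = (5 + 2 * √5) / 25 := by
    rw [div_pow, Real.sq_sqrt (by positivity)]; norm_num
  have hB : (√(5 - 2 * √5) / 5) ^ 2 = (5 - 2 * √5) / 25 := by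
    rw [div_pow, Real.sq_sqrt (by linarith)]; norm_num
  have hAB := inv_sqrt_five_cubed
  have hA0 : √(5 + 2 * √5) / 5 ≠ 0 := by positivity
  have hB0 : √(5 - 2 * √5) / 5 ≠ 0 := by
    have : 0 < √(5 - 2 * √5) := Real.sqrt_pos.mpr (by linarith)
    positivity
  obtain ⟨u, hu, rfl⟩ := exists_sign (x := c) (c := (√5)⁻¹)
    (by rw [inv_sqrt_sq _ (by norm_num)]; linarith)
  have hc : u * (√5)⁻¹ * (u * (√5)⁻¹) = 1 / 5 := by linarith
  -- From `a² = 1/5 - 2ab` and `b² = 1/5 + 2ab` one gets `125 (ab)² = 1`.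
  have hp : (a * b) ^ 2 = (√5 / 25) ^ 2 := by
    have e1 : a ^ 2 = 1 / 5 - 2 * (a * b) := by linarith
    have e2 : b ^ 2 = 1 / 5 + 2 * (a * b) := by linarith
    rw [div_pow, hr, mul_pow]
    have e3 : a ^ 2 * b ^ 2 = (1 / 5 - 2 * (a * b)) * (1 / 5 + 2 * (a * b)) := by rw [e1, e2]
    linarith
  rcases sq_eq_sq_iff_eq_or_eq_neg.mp hp with hp | hp
  · obtain ⟨s, hs, rfl⟩ := exists_sign (x := a) (c := √(5 - 2 * √5) / 5) (by rw [hB]; linarith)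
    have hs2 : s * s = 1 := by rcases hs with rfl | rfl <;> norm_num
    obtain rfl : b = s * (√(5 + 2 * √5) / 5) := by
      apply mul_left_cancel₀ hB0
      linear_combination s * hp - s * hAB - (√(5 - 2 * √5) / 5) * b * hs2
    rcases hs with rfl | rfl
    · refine isRow_antisymm 7 ![0, 3, 1, 4, 2, 5] ![1, 1, 1, 1, 1, u] (by decide) ?_ ?_ <;>
      rcases hu with rfl | rfl <;> simp [rowForm, antisymm, Fin.forall_fin_succ]
    · refine isRow_antisymm 7 ![0, 2, 4, 1, 3, 5] ![1, 1, 1, 1, 1, u] (by decide) ?_ ?_ <;>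
      rcases hu with rfl | rfl <;> simp [rowForm, antisymm, Fin.forall_fin_succ]
  · obtain ⟨s, hs, rfl⟩ := exists_sign (x := a) (c := √(5 + 2 * √5) / 5) (by rw [hA]; linarith)
    have hs2 : s * s = 1 := by rcases hs with rfl | rfl <;> norm_num
    obtain rfl : b = -(s * (√(5 - 2 * √5) / 5)) := by
      apply mul_left_cancel₀ hA0
      linear_combination s * hp + s * hAB - (√(5 + 2 * √5) / 5) * b * hs2
    rcases hs with rfl | rfl
    · refine isRow_antisymm 7 ![0, 1, 2, 3, 4, 5] ![1, 1, 1, 1, 1, u] (by decide) ?_ ?_ <;>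
      rcases hu with rfl | rfl <;> simp [rowForm, antisymm, Fin.forall_fin_succ]
    · refine isRow_antisymm 7 ![0, 4, 3, 2, 1, 5] ![1, 1, 1, 1, 1, u] (by decide) ?_ ?_ <;>
      rcases hu with rfl | rfl <;> simp [rowForm, antisymm, Fin.forall_fin_succ]

/-- The off-diagonal entries of `J²` give `b (a + c) = 0`, and `a (a - 2c) = 0` when `b = 0`. The
three branches are a matching, the form of the seventh row, and the form of `|TT⟩`. -/
lemma isRow_six {a b c : ℝ} (h : antisymm a b c b a a b c b a b c a b a *
    antisymm a b c b a a b c b a b c a b a = -1) :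
    IsRow (antisymm a b c b a a b c b a b c a b a) := by
  have h0 := mul_self_apply h 0 0
  have h1 := mul_self_apply h 0 1
  have h2 := mul_self_apply h 0 2
  simp [antisymm] at h0 h1 h2
  have hb : b * (a + c) = 0 := by linarith
  rcases mul_eq_zero.mp hb with rfl | hb
  · have ha : a * (a - 2 * c) = 0 := by linarith
    rcases mul_eq_zero.mp ha with rfl | ha
    · obtain ⟨s, hs, rfl⟩ := exists_sign (x := c) (c := 1) (by linarith)
      refine isRow_antisymm 0 ![0, 2, 4, 1, 3, 5] ![1, 1, 1, s, s, s] (by decide) ?_ ?_ <;>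
      rcases hs with rfl | rfl <;> simp [rowForm, antisymm, Fin.forall_fin_succ]
    · obtain rfl : a = 2 * c := by linarith
      obtain ⟨s, hs, rfl⟩ := exists_sign (x := c) (c := 3⁻¹) (by linarith)
      refine isRow_antisymm 6 ![0, 1, 2, 3, 4, 5] ![1, s, 1, s, 1, s] (by decide) ?_ ?_ <;>
      rcases hs with rfl | rfl <;> simp [rowForm, antisymm, Fin.forall_fin_succ] <;> norm_num
  · obtain rfl : c = -a := by linarith
    obtain ⟨s, hs, rfl⟩ := exists_sign (x := a) (c := 3⁻¹) (by linarith)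
    obtain ⟨t, ht, rfl⟩ := exists_sign (x := b) (c := (√3)⁻¹)
      (by
        have : (s * 3⁻¹) * (s * 3⁻¹) = 1 / 9 := by rcases hs with rfl | rfl <;> norm_num
        rw [inv_sqrt_sq _ (by norm_num)]; linarith)
    rcases ht with rfl | rfl
    · refine isRow_antisymm 5 ![0, 3, 2, 5, 1, 4] ![1, s, -1, -s, 1, s] (by decide) ?_ ?_ <;>
      rcases hs with rfl | rfl <;> simp [rowForm, antisymm, Fin.forall_fin_succ]
    · refine isRow_antisymm 5 ![0, 3, 1, 4, 2, 5] ![1, s, -1, -s, 1, s] (by decide) ?_ ?_ <;>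
      rcases hs with rfl | rfl <;> simp [rowForm, antisymm, Fin.forall_fin_succ]

/-! ### Classification by cycle type -/

/-- The coordinate signs `δ` transport the signs along each cycle, so that only the product over a
cycle survives, placed at its last point. The permutations in `S` exchange cycles of equal length,
and `τ` uses the irrelevant global sign. The hypothesis `key` is then a check of 64 sign vectors
against the list `F`. -/
lemma CentralStructure.isRow_of_forms {p : Fin 6 → Fin 6} {ε : Fin 6 → ℤˣ}
    {J : Matrix (Fin 6) (Fin 6) ℝ} (h : CentralStructure p (fun i => (ε i : ℤ)) J)
    (δ : (Fin 6 → ℤˣ) → Fin 6 → ℤˣ) (S : List (Equiv.Perm (Fin 6))) (F : List (Fin 6 → ℤ))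
    (hS : ∀ σ ∈ S, ∀ i, p (σ i) = σ (p i))
    (key : ∀ ε : Fin 6 → ℤˣ, ∃ N ∈ F, ∃ σ ∈ S, ∃ τ : ℤˣ, ∀ i,
      N (σ i) = (δ (fun i => τ * ε i) (p i) * (τ * ε i) * δ (fun i => τ * ε i) i : ℤˣ))
    (hF : ∀ N ∈ F, ∀ J, CentralStructure p N J → IsRow J) : IsRow J := by
  obtain ⟨N, hN, σ, hσ, τ, hτ⟩ := key ε
  refine isRow_transform (σ := σ) (δ := fun i => (δ (fun i => τ * ε i) i : ℤˣ))
    (fun i => by rw [← Units.val_mul, Int.units_mul_self]; rfl) (hF N hN _ ?_)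
  refine h.changeBasis σ _ (τ : ℤ) (by rw [← Units.val_mul, Int.units_mul_self]; rfl)
    (fun i => by rw [← Units.val_mul, Int.units_mul_self]; rfl) (hS σ hσ) fun i => ?_
  rw [hτ]
  push_cast
  ring

/-- For this and the following cycle types, a normal form is excluded by an eigenspace of dimension
at least three or by a singular block of `J`; otherwise its fixed-point equations lead to one of the
matrices recognised above. -/
lemma isRow_of_swap {ε : Fin 6 → ℤˣ} {J : Matrix (Fin 6) (Fin 6) ℝ}
    (h : CentralStructure ![1, 0, 2, 3, 4, 5] (fun i => (ε i : ℤ)) J) : IsRow J := by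
  refine h.isRow_of_forms (fun η => ![1, η 0, 1, 1, 1, 1])
    [1, Equiv.swap 2 5, Equiv.swap 3 5, Equiv.swap 4 5, Equiv.swap 3 4]
    [![1, 1, 1, 1, 1, 1],
      ![1, 1, 1, 1, 1, -1],
      ![1, 1, 1, 1, -1, -1],
      ![1, -1, 1, 1, 1, 1],
      ![1, -1, 1, 1, 1, -1],
      ![1, -1, 1, 1, -1, -1]]
    (by decide +kernel) (by decide +kernel) ?_
  clear h
  intro N hN J h
  simp only [List.mem_cons, List.not_mem_nil, or_false] at hN
  rcases hN with rfl | rfl | rfl | rfl | rfl | rfl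
  · refine (h.false_of_eigenvectors 1 ![1, 1, 0, 0, 0, 0] ![0, 0, 1, 0, 0, 0]
      ![0, 0, 0, 1, 0, 0] ?_ ?_ ?_ ?_ ?_ ?_ ?_ ?_ ?_ ?_).elim <;> decide
  · refine (h.false_of_eigenvectors 1 ![1, 1, 0, 0, 0, 0] ![0, 0, 1, 0, 0, 0]
      ![0, 0, 0, 1, 0, 0] ?_ ?_ ?_ ?_ ?_ ?_ ?_ ?_ ?_ ?_).elim <;> decide
  · refine (h.false_of_eigenvectors 1 ![1, 1, 0, 0, 0, 0] ![0, 0, 1, 0, 0, 0]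
      ![0, 0, 0, 1, 0, 0] ?_ ?_ ?_ ?_ ?_ ?_ ?_ ?_ ?_ ?_).elim <;> decide
  · refine (h.false_of_eigenvectors 1 ![0, 0, 1, 0, 0, 0] ![0, 0, 0, 1, 0, 0]
      ![0, 0, 0, 0, 1, 0] ?_ ?_ ?_ ?_ ?_ ?_ ?_ ?_ ?_ ?_).elim <;> decide
  · refine (h.false_of_eigenvectors 1 ![0, 0, 1, 0, 0, 0] ![0, 0, 0, 1, 0, 0]
      ![0, 0, 0, 0, 1, 0] ?_ ?_ ?_ ?_ ?_ ?_ ?_ ?_ ?_ ?_).elim <;> decide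
  · obtain ⟨a, b, c, d, e, f, g, h', i, j, k, l, m, n, o, rfl⟩ := exists_eq_antisymm h.transpose
    -- The rotations in the planes `01` and `23` are fixed, so `J` preserves these planes and the
    -- complementary plane `45`.
    have z := fun x => h.isolated (a := 0) (b := 1) (c := x) (by decide) (by decide) (by decide)
    obtain ⟨z02, z12⟩ := z 2 (by decide) (by decide)
    obtain ⟨z03, z13⟩ := z 3 (by decide) (by decide)
    obtain ⟨z04, z14⟩ := z 4 (by decide) (by decide)
    obtain ⟨z05, z15⟩ := z 5 (by decide) (by decide)
    clear z
    have z := fun x => h.isolated (a := 2) (b := 3) (c := x) (by decide) (by decide) (by decide)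
    obtain ⟨z20, z30⟩ := z 0 (by decide) (by decide)
    obtain ⟨z21, z31⟩ := z 1 (by decide) (by decide)
    obtain ⟨z24, z34⟩ := z 4 (by decide) (by decide)
    obtain ⟨z25, z35⟩ := z 5 (by decide) (by decide)
    clear z
    simp [antisymm] at z02 z03 z04 z05 z12 z13 z14 z15 z24 z25 z34 z35
    clear z20 z30 z21 z31
    subst z02 z03 z04 z05 z12 z13 z14 z15 z24 z25 z34 z35
    exact isRow_matching h.mul_self

lemma isRow_of_two_swaps {ε : Fin 6 → ℤˣ} {J : Matrix (Fin 6) (Fin 6) ℝ}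
    (h : CentralStructure ![1, 0, 3, 2, 4, 5] (fun i => (ε i : ℤ)) J) : IsRow J := by
  refine h.isRow_of_forms (fun η => ![1, η 0, 1, η 2, 1, 1])
    [1, (Equiv.swap 0 2 * Equiv.swap 1 3)]
    [![1, 1, 1, 1, 1, 1],
      ![1, 1, 1, 1, 1, -1],
      ![1, 1, 1, -1, 1, 1],
      ![1, 1, 1, -1, 1, -1],
      ![1, -1, 1, -1, 1, 1],
      ![1, -1, 1, -1, 1, -1]]
    (by decide +kernel) (by decide +kernel) ?_
  clear h
  intro N hN J h
  simp only [List.mem_cons, List.not_mem_nil, or_false] at hN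
  rcases hN with rfl | rfl | rfl | rfl | rfl | rfl
  · refine (h.false_of_eigenvectors 1 ![1, 1, 0, 0, 0, 0] ![0, 0, 1, 1, 0, 0]
      ![0, 0, 0, 0, 1, 0] ?_ ?_ ?_ ?_ ?_ ?_ ?_ ?_ ?_ ?_).elim <;> decide
  · refine (h.false_of_eigenvectors 1 ![1, 1, 0, 0, 0, 0] ![0, 0, 1, 1, 0, 0]
      ![0, 0, 0, 0, 1, 0] ?_ ?_ ?_ ?_ ?_ ?_ ?_ ?_ ?_ ?_).elim <;> decide
  · refine (h.false_of_eigenvectors 1 ![1, 1, 0, 0, 0, 0] ![0, 0, 0, 0, 1, 0]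
      ![0, 0, 0, 0, 0, 1] ?_ ?_ ?_ ?_ ?_ ?_ ?_ ?_ ?_ ?_).elim <;> decide
  · obtain ⟨a, b, c, d, e, f, g, h', i, j, k, l, m, n, o, rfl⟩ := exists_eq_antisymm h.transpose
    have z := fun x => h.isolated (a := 2) (b := 3) (c := x) (by decide) (by decide) (by decide)
    obtain ⟨z20, z30⟩ := z 0 (by decide) (by decide)
    obtain ⟨z21, z31⟩ := z 1 (by decide) (by decide)
    obtain ⟨z24, z34⟩ := z 4 (by decide) (by decide)
    obtain ⟨z25, z35⟩ := z 5 (by decide) (by decide)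
    clear z
    have r01 := h.fixed 0 1
    have r04 := h.fixed 0 4
    have r05 := h.fixed 0 5
    have r14 := h.fixed 1 4
    have r15 := h.fixed 1 5
    have r45 := h.fixed 4 5
    simp [antisymm] at z20 z30 z21 z31 z24 z25 z34 z35
    simp [antisymm] at r01 r04 r05 r14 r15 r45
    obtain rfl : a = 0 := by linarith only [r01]
    subst z20 z30 z21 z31
    obtain rfl : d = h' := by linarith only [r04, r14]
    obtain rfl : i = -e := by linarith only [r05, r15]
    subst z24 z25 z34 z35
    obtain rfl : o = 0 := by linarith only [r45]
    exact isRow_two h.mul_self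
  · obtain ⟨a, b, c, d, e, f, g, h', i, j, k, l, m, n, o, rfl⟩ := exists_eq_antisymm h.transpose
    have z := fun x => h.isolated (a := 0) (b := 1) (c := x) (by decide) (by decide) (by decide)
    obtain ⟨z02, z12⟩ := z 2 (by decide) (by decide)
    obtain ⟨z03, z13⟩ := z 3 (by decide) (by decide)
    obtain ⟨z04, z14⟩ := z 4 (by decide) (by decide)
    obtain ⟨z05, z15⟩ := z 5 (by decide) (by decide)
    clear z
    have z := fun x => h.isolated (a := 2) (b := 3) (c := x) (by decide) (by decide) (by decide)
    obtain ⟨z20, z30⟩ := z 0 (by decide) (by decide)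
    obtain ⟨z21, z31⟩ := z 1 (by decide) (by decide)
    obtain ⟨z24, z34⟩ := z 4 (by decide) (by decide)
    obtain ⟨z25, z35⟩ := z 5 (by decide) (by decide)
    clear z
    simp [antisymm] at z02 z03 z04 z05 z12 z13 z14 z15 z24 z25 z34 z35
    clear z20 z30 z21 z31
    subst z02 z03 z04 z05 z12 z13 z14 z15 z24 z25 z34 z35
    exact isRow_matching h.mul_self
  · obtain ⟨a, b, c, d, e, f, g, h', i, j, k, l, m, n, o, rfl⟩ := exists_eq_antisymm h.transpose
    have z := fun x => h.isolated (a := 0) (b := 1) (c := x) (by decide) (by decide) (by decide)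
    obtain ⟨z02, z12⟩ := z 2 (by decide) (by decide)
    obtain ⟨z03, z13⟩ := z 3 (by decide) (by decide)
    obtain ⟨z04, z14⟩ := z 4 (by decide) (by decide)
    obtain ⟨z05, z15⟩ := z 5 (by decide) (by decide)
    clear z
    have z := fun x => h.isolated (a := 2) (b := 3) (c := x) (by decide) (by decide) (by decide)
    obtain ⟨z20, z30⟩ := z 0 (by decide) (by decide)
    obtain ⟨z21, z31⟩ := z 1 (by decide) (by decide)
    obtain ⟨z24, z34⟩ := z 4 (by decide) (by decide)
    obtain ⟨z25, z35⟩ := z 5 (by decide) (by decide)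
    clear z
    have r45 := h.fixed 4 5
    simp [antisymm] at z02 z03 z04 z05 z12 z13 z14 z15 z24 z25 z34 z35
    simp [antisymm] at r45
    clear z20 z30 z21 z31
    subst z02 z03 z04 z05 z12 z13 z14 z15 z24 z25 z34 z35
    obtain rfl : o = 0 := by linarith only [r45]
    exact isRow_matching h.mul_self

lemma isRow_of_three_swaps {ε : Fin 6 → ℤˣ} {J : Matrix (Fin 6) (Fin 6) ℝ}
    (h : CentralStructure ![1, 0, 3, 2, 5, 4] (fun i => (ε i : ℤ)) J) : IsRow J := by
  refine h.isRow_of_forms (fun η => ![1, η 0, 1, η 2, 1, η 4])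
    [1, (Equiv.swap 0 2 * Equiv.swap 1 3), (Equiv.swap 0 4 * Equiv.swap 1 5), (Equiv.swap 2 4 * Equiv.swap 3 5)]
    [![1, 1, 1, 1, 1, 1],
      ![1, 1, 1, 1, 1, -1],
      ![1, -1, 1, -1, 1, 1],
      ![1, -1, 1, -1, 1, -1]]
    (by decide +kernel) (by decide +kernel) ?_
  clear h
  intro N hN J h
  simp only [List.mem_cons, List.not_mem_nil, or_false] at hN
  rcases hN with rfl | rfl | rfl | rfl
  · refine (h.false_of_eigenvectors 1 ![1, 1, 0, 0, 0, 0] ![0, 0, 1, 1, 0, 0]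
      ![0, 0, 0, 0, 1, 1] ?_ ?_ ?_ ?_ ?_ ?_ ?_ ?_ ?_ ?_).elim <;> decide
  · obtain ⟨a, b, c, d, e, f, g, h', i, j, k, l, m, n, o, rfl⟩ := exists_eq_antisymm h.transpose
    have z := fun x => h.isolated (a := 4) (b := 5) (c := x) (by decide) (by decide) (by decide)
    obtain ⟨z40, z50⟩ := z 0 (by decide) (by decide)
    obtain ⟨z41, z51⟩ := z 1 (by decide) (by decide)
    obtain ⟨z42, z52⟩ := z 2 (by decide) (by decide)
    obtain ⟨z43, z53⟩ := z 3 (by decide) (by decide)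
    clear z
    have r01 := h.fixed 0 1
    have r02 := h.fixed 0 2
    have r03 := h.fixed 0 3
    have r12 := h.fixed 1 2
    have r13 := h.fixed 1 3
    have r23 := h.fixed 2 3
    simp [antisymm] at z40 z50 z41 z51 z42 z52 z43 z53
    simp [antisymm] at r01 r02 r03 r12 r13 r23
    obtain rfl : a = 0 := by linarith only [r01]
    subst z40 z50
    obtain rfl : c = f := by linarith only [r03, r12]
    obtain rfl : b = g := by linarith only [r02, r13]
    subst z41 z51
    obtain rfl : j = 0 := by linarith only [r23]
    subst z42 z52 z43 z53
    exact isRow_two_two h.mul_self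
  · obtain ⟨a, b, c, d, e, f, g, h', i, j, k, l, m, n, o, rfl⟩ := exists_eq_antisymm h.transpose
    have z := fun x => h.isolated (a := 0) (b := 1) (c := x) (by decide) (by decide) (by decide)
    obtain ⟨z02, z12⟩ := z 2 (by decide) (by decide)
    obtain ⟨z03, z13⟩ := z 3 (by decide) (by decide)
    obtain ⟨z04, z14⟩ := z 4 (by decide) (by decide)
    obtain ⟨z05, z15⟩ := z 5 (by decide) (by decide)
    clear z
    have z := fun x => h.isolated (a := 2) (b := 3) (c := x) (by decide) (by decide) (by decide)
    obtain ⟨z20, z30⟩ := z 0 (by decide) (by decide)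
    obtain ⟨z21, z31⟩ := z 1 (by decide) (by decide)
    obtain ⟨z24, z34⟩ := z 4 (by decide) (by decide)
    obtain ⟨z25, z35⟩ := z 5 (by decide) (by decide)
    clear z
    have r45 := h.fixed 4 5
    simp [antisymm] at z02 z03 z04 z05 z12 z13 z14 z15 z24 z25 z34 z35
    simp [antisymm] at r45
    clear z20 z30 z21 z31
    subst z02 z03 z04 z05 z12 z13 z14 z15 z24 z25 z34 z35
    obtain rfl : o = 0 := by linarith only [r45]
    exact isRow_matching h.mul_self
  · obtain ⟨a, b, c, d, e, f, g, h', i, j, k, l, m, n, o, rfl⟩ := exists_eq_antisymm h.transpose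
    have z := fun x => h.isolated (a := 0) (b := 1) (c := x) (by decide) (by decide) (by decide)
    obtain ⟨z02, z12⟩ := z 2 (by decide) (by decide)
    obtain ⟨z03, z13⟩ := z 3 (by decide) (by decide)
    obtain ⟨z04, z14⟩ := z 4 (by decide) (by decide)
    obtain ⟨z05, z15⟩ := z 5 (by decide) (by decide)
    clear z
    have z := fun x => h.isolated (a := 2) (b := 3) (c := x) (by decide) (by decide) (by decide)
    obtain ⟨z20, z30⟩ := z 0 (by decide) (by decide)
    obtain ⟨z21, z31⟩ := z 1 (by decide) (by decide)
    obtain ⟨z24, z34⟩ := z 4 (by decide) (by decide)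
    obtain ⟨z25, z35⟩ := z 5 (by decide) (by decide)
    clear z
    simp [antisymm] at z02 z03 z04 z05 z12 z13 z14 z15 z24 z25 z34 z35
    clear z20 z30 z21 z31
    subst z02 z03 z04 z05 z12 z13 z14 z15 z24 z25 z34 z35
    exact isRow_matching h.mul_self

lemma isRow_of_three_cycle {ε : Fin 6 → ℤˣ} {J : Matrix (Fin 6) (Fin 6) ℝ}
    (h : CentralStructure ![1, 2, 0, 3, 4, 5] (fun i => (ε i : ℤ)) J) : IsRow J := by
  refine h.isRow_of_forms (fun η => ![1, η 0, η 0 * η 1, 1, 1, 1])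
    [1, Equiv.swap 3 4, Equiv.swap 3 5, Equiv.swap 4 5]
    [![1, 1, 1, 1, 1, 1],
      ![1, 1, 1, 1, 1, -1],
      ![1, 1, 1, 1, -1, -1],
      ![1, 1, 1, -1, -1, -1]]
    (by decide +kernel) (by decide +kernel) ?_
  clear h
  intro N hN J h
  simp only [List.mem_cons, List.not_mem_nil, or_false] at hN
  rcases hN with rfl | rfl | rfl | rfl
  · refine (h.false_of_eigenvectors 1 ![1, 1, 1, 0, 0, 0] ![0, 0, 0, 1, 0, 0]
      ![0, 0, 0, 0, 1, 0] ?_ ?_ ?_ ?_ ?_ ?_ ?_ ?_ ?_ ?_).elim <;> decide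
  · refine (h.false_of_eigenvectors 1 ![1, 1, 1, 0, 0, 0] ![0, 0, 0, 1, 0, 0]
      ![0, 0, 0, 0, 1, 0] ?_ ?_ ?_ ?_ ?_ ?_ ?_ ?_ ?_ ?_).elim <;> decide
  · obtain ⟨a, b, c, d, e, f, g, h', i, j, k, l, m, n, o, rfl⟩ := exists_eq_antisymm h.transpose
    have z := fun x => h.isolated (a := 4) (b := 5) (c := x) (by decide) (by decide) (by decide)
    obtain ⟨z40, z50⟩ := z 0 (by decide) (by decide)
    obtain ⟨z41, z51⟩ := z 1 (by decide) (by decide)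
    obtain ⟨z42, z52⟩ := z 2 (by decide) (by decide)
    obtain ⟨z43, z53⟩ := z 3 (by decide) (by decide)
    clear z
    have r01 := h.fixed 0 1
    have r02 := h.fixed 0 2
    have r03 := h.fixed 0 3
    have r12 := h.fixed 1 2
    have r13 := h.fixed 1 3
    have r23 := h.fixed 2 3
    simp [antisymm] at z40 z50 z41 z51 z42 z52 z43 z53
    simp [antisymm] at r01 r02 r03 r12 r13 r23
    obtain rfl : b = -a := by linarith only [r01, r12, r02]
    subst z40 z50
    obtain rfl : a = f := by linarith only [r01, r12, r02]
    obtain rfl : c = g := by linarith only [r03, r13, r23]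
    subst z41 z51
    obtain rfl : c = j := by linarith only [r03, r13, r23]
    subst z42 z52 z43 z53
    exact isRow_three h.mul_self
  -- Here it is the eigenvalue `-1` that has three independent eigenvectors.
  · refine (h.false_of_eigenvectors (-1) ![0, 0, 0, 1, 0, 0] ![0, 0, 0, 0, 1, 0]
      ![0, 0, 0, 0, 0, 1] ?_ ?_ ?_ ?_ ?_ ?_ ?_ ?_ ?_ ?_).elim <;> decide

lemma isRow_of_three_cycle_swap {ε : Fin 6 → ℤˣ} {J : Matrix (Fin 6) (Fin 6) ℝ}
    (h : CentralStructure ![1, 2, 0, 3, 5, 4] (fun i => (ε i : ℤ)) J) : IsRow J := by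
  refine h.isRow_of_forms (fun η => ![1, η 0, η 0 * η 1, 1, 1, η 4])
    [1]
    [![1, 1, 1, 1, 1, 1],
      ![1, 1, 1, -1, 1, 1],
      ![1, 1, 1, 1, 1, -1],
      ![1, 1, 1, -1, 1, -1]]
    (by decide +kernel) (by decide +kernel) ?_
  clear h
  intro N hN J h
  simp only [List.mem_cons, List.not_mem_nil, or_false] at hN
  rcases hN with rfl | rfl | rfl | rfl
  · refine (h.false_of_eigenvectors 1 ![1, 1, 1, 0, 0, 0] ![0, 0, 0, 1, 0, 0]
      ![0, 0, 0, 0, 1, 1] ?_ ?_ ?_ ?_ ?_ ?_ ?_ ?_ ?_ ?_).elim <;> decide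
  · obtain ⟨a, b, c, d, e, f, g, h', i, j, k, l, m, n, o, rfl⟩ := exists_eq_antisymm h.transpose
    have r01 := h.fixed 0 1
    have r02 := h.fixed 0 2
    have r03 := h.fixed 0 3
    have r04 := h.fixed 0 4
    have r05 := h.fixed 0 5
    have r12 := h.fixed 1 2
    have r13 := h.fixed 1 3
    have r14 := h.fixed 1 4
    have r15 := h.fixed 1 5
    have r23 := h.fixed 2 3
    have r24 := h.fixed 2 4
    have r25 := h.fixed 2 5
    have r34 := h.fixed 3 4
    have r35 := h.fixed 3 5
    have r45 := h.fixed 4 5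
    simp [antisymm] at r01 r02 r03 r04 r05 r12 r13 r14 r15 r23 r24 r25 r34 r35 r45
    obtain rfl : b = -a := by linarith only [r01, r12, r02]
    obtain rfl : c = 0 := by linarith only [r03, r13, r23]
    obtain rfl : d = e := by linarith only [r04, r15, r24, r05, r14, r25]
    obtain rfl : a = f := by linarith only [r01, r12, r02]
    obtain rfl : g = 0 := by linarith only [r03, r13, r23]
    obtain rfl : d = h' := by linarith only [r04, r15, r24, r05, r14, r25]
    obtain rfl : d = i := by linarith only [r04, r15, r24, r05, r14, r25]
    obtain rfl : j = 0 := by linarith only [r03, r13, r23]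
    obtain rfl : d = k := by linarith only [r04, r15, r24, r05, r14, r25]
    obtain rfl : d = l := by linarith only [r04, r15, r24, r05, r14, r25]
    obtain rfl : n = -m := by linarith only [r34, r35]
    obtain rfl : o = 0 := by linarith only [r45]
    exact isRow_three_two h.mul_self
  · obtain ⟨a, b, c, d, e, f, g, h', i, j, k, l, m, n, o, rfl⟩ := exists_eq_antisymm h.transpose
    have z := fun x => h.isolated (a := 4) (b := 5) (c := x) (by decide) (by decide) (by decide)
    obtain ⟨z40, z50⟩ := z 0 (by decide) (by decide)
    obtain ⟨z41, z51⟩ := z 1 (by decide) (by decide)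
    obtain ⟨z42, z52⟩ := z 2 (by decide) (by decide)
    obtain ⟨z43, z53⟩ := z 3 (by decide) (by decide)
    clear z
    have r01 := h.fixed 0 1
    have r02 := h.fixed 0 2
    have r03 := h.fixed 0 3
    have r12 := h.fixed 1 2
    have r13 := h.fixed 1 3
    have r23 := h.fixed 2 3
    simp [antisymm] at z40 z50 z41 z51 z42 z52 z43 z53
    simp [antisymm] at r01 r02 r03 r12 r13 r23
    obtain rfl : b = -a := by linarith only [r01, r12, r02]
    subst z40 z50
    obtain rfl : a = f := by linarith only [r01, r12, r02]
    obtain rfl : c = g := by linarith only [r03, r13, r23]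
    subst z41 z51
    obtain rfl : c = j := by linarith only [r03, r13, r23]
    subst z42 z52 z43 z53
    exact isRow_three h.mul_self
  · obtain ⟨a, b, c, d, e, f, g, h', i, j, k, l, m, n, o, rfl⟩ := exists_eq_antisymm h.transpose
    have z := fun x => h.isolated (a := 4) (b := 5) (c := x) (by decide) (by decide) (by decide)
    obtain ⟨z40, z50⟩ := z 0 (by decide) (by decide)
    obtain ⟨z41, z51⟩ := z 1 (by decide) (by decide)
    obtain ⟨z42, z52⟩ := z 2 (by decide) (by decide)
    obtain ⟨z43, z53⟩ := z 3 (by decide) (by decide)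
    clear z
    have r01 := h.fixed 0 1
    have r02 := h.fixed 0 2
    have r03 := h.fixed 0 3
    have r12 := h.fixed 1 2
    have r13 := h.fixed 1 3
    have r23 := h.fixed 2 3
    simp [antisymm] at z40 z50 z41 z51 z42 z52 z43 z53
    simp [antisymm] at r01 r02 r03 r12 r13 r23
    obtain rfl : b = -a := by linarith only [r01, r12, r02]
    obtain rfl : c = 0 := by linarith only [r03, r13, r23]
    subst z40 z50
    obtain rfl : a = f := by linarith only [r01, r12, r02]
    obtain rfl : g = 0 := by linarith only [r03, r13, r23]
    subst z41 z51
    obtain rfl : j = 0 := by linarith only [r03, r13, r23]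
    subst z42 z52 z43 z53
    -- The row of `J` at the index `3` is zero, which contradicts `J² = -1`.
    have q0 := mul_self_apply h.mul_self 3 3
    simp [antisymm] at q0

lemma isRow_of_two_three_cycles {ε : Fin 6 → ℤˣ} {J : Matrix (Fin 6) (Fin 6) ℝ}
    (h : CentralStructure ![1, 2, 0, 4, 5, 3] (fun i => (ε i : ℤ)) J) : IsRow J := by
  refine h.isRow_of_forms (fun η => ![1, η 0, η 0 * η 1, 1, η 3, η 3 * η 4])
    [1]
    [![1, 1, 1, 1, 1, 1],
      ![1, 1, 1, 1, 1, -1]]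
    (by decide +kernel) (by decide +kernel) ?_
  clear h
  intro N hN J h
  simp only [List.mem_cons, List.not_mem_nil, or_false] at hN
  rcases hN with rfl | rfl
  · obtain ⟨a, b, c, d, e, f, g, h', i, j, k, l, m, n, o, rfl⟩ := exists_eq_antisymm h.transpose
    have r01 := h.fixed 0 1
    have r02 := h.fixed 0 2
    have r03 := h.fixed 0 3
    have r04 := h.fixed 0 4
    have r05 := h.fixed 0 5
    have r12 := h.fixed 1 2
    have r13 := h.fixed 1 3
    have r14 := h.fixed 1 4
    have r15 := h.fixed 1 5
    have r23 := h.fixed 2 3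
    have r24 := h.fixed 2 4
    have r25 := h.fixed 2 5
    have r34 := h.fixed 3 4
    have r35 := h.fixed 3 5
    have r45 := h.fixed 4 5
    simp [antisymm] at r01 r02 r03 r04 r05 r12 r13 r14 r15 r23 r24 r25 r34 r35 r45
    obtain rfl : b = -a := by linarith only [r01, r12, r02]
    obtain rfl : a = f := by linarith only [r01, r12, r02]
    obtain rfl : e = g := by linarith only [r05, r13, r24]
    obtain rfl : c = h' := by linarith only [r03, r14, r25]
    obtain rfl : d = i := by linarith only [r04, r15, r23]
    obtain rfl : d = j := by linarith only [r04, r15, r23]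
    obtain rfl : e = k := by linarith only [r05, r13, r24]
    obtain rfl : c = l := by linarith only [r03, r14, r25]
    obtain rfl : n = -m := by linarith only [r34, r45, r35]
    obtain rfl : m = o := by linarith only [r34, r45, r35]
    -- With equal signs the two three-cycles carry the same representation, and the centralizer
    -- contains generators mixing them. Commuting with two of these equates the diagonal blocks and
    -- makes the off-diagonal block constant.
    have k := h.comm_int !![0, 0, 0, 1, 0, 0; 0, 0, 0, 0, 1, 0; 0, 0, 0, 0, 0, 1; -1, 0, 0, 0, 0, 0;
      0, -1, 0, 0, 0, 0; 0, 0, -1, 0, 0, 0] (by decide) (by decide)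
    have k' := h.comm_int !![0, 0, 0, 0, 1, 0; 0, 0, 0, 0, 0, 1; 0, 0, 0, 1, 0, 0; 0, 0, -1, 0, 0, 0;
      -1, 0, 0, 0, 0, 0; 0, -1, 0, 0, 0, 0] (by decide) (by decide)
    have k1 := congrFun (congrFun k 0) 4
    have k2 := congrFun (congrFun k 0) 1
    have k3 := congrFun (congrFun k' 0) 2
    simp [antisymm, mul_apply, Fin.sum_univ_six] at k1 k2 k3
    obtain rfl : a = m := by linarith
    obtain rfl : d = e := by linarith
    obtain rfl : c = d := by linarith
    exact isRow_three_three h.mul_self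
  · obtain ⟨a, b, c, d, e, f, g, h', i, j, k, l, m, n, o, rfl⟩ := exists_eq_antisymm h.transpose
    have r01 := h.fixed 0 1
    have r02 := h.fixed 0 2
    have r03 := h.fixed 0 3
    have r04 := h.fixed 0 4
    have r05 := h.fixed 0 5
    have r12 := h.fixed 1 2
    have r13 := h.fixed 1 3
    have r14 := h.fixed 1 4
    have r15 := h.fixed 1 5
    have r23 := h.fixed 2 3
    have r24 := h.fixed 2 4
    have r25 := h.fixed 2 5
    have r34 := h.fixed 3 4
    have r35 := h.fixed 3 5
    have r45 := h.fixed 4 5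
    simp [antisymm] at r01 r02 r03 r04 r05 r12 r13 r14 r15 r23 r24 r25 r34 r35 r45
    obtain rfl : b = -a := by linarith only [r01, r12, r02]
    obtain rfl : c = 0 := by linarith only [r03, r14, r25]
    obtain rfl : d = 0 := by linarith only [r04, r15, r23]
    obtain rfl : e = 0 := by linarith only [r05, r13, r24]
    obtain rfl : a = f := by linarith only [r01, r12, r02]
    obtain rfl : g = 0 := by linarith only [r05, r13, r24]
    obtain rfl : h' = 0 := by linarith only [r03, r14, r25]
    obtain rfl : i = 0 := by linarith only [r04, r15, r23]
    obtain rfl : j = 0 := by linarith only [r04, r15, r23]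
    obtain rfl : k = 0 := by linarith only [r05, r13, r24]
    obtain rfl : l = 0 := by linarith only [r03, r14, r25]
    obtain rfl : m = n := by linarith only [r34, r45, r35]
    obtain rfl : m = o := by linarith only [r34, r45, r35]
    -- Opposite signs decouple the two cycles, and an antisymmetric `3 × 3` block is singular.
    have q0 := mul_self_apply h.mul_self 0 0
    have q1 := mul_self_apply h.mul_self 0 1
    simp [antisymm] at q0 q1
    rw [q1] at q0
    norm_num at q0

lemma isRow_of_four_cycle {ε : Fin 6 → ℤˣ} {J : Matrix (Fin 6) (Fin 6) ℝ}
    (h : CentralStructure ![1, 2, 3, 0, 4, 5] (fun i => (ε i : ℤ)) J) : IsRow J := by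
  refine h.isRow_of_forms (fun η => ![1, η 0, η 0 * η 1, η 0 * η 1 * η 2, 1, 1])
    [1]
    [![1, 1, 1, 1, 1, 1],
      ![1, 1, 1, 1, 1, -1],
      ![1, 1, 1, -1, 1, 1],
      ![1, 1, 1, -1, 1, -1]]
    (by decide +kernel) (by decide +kernel) ?_
  clear h
  intro N hN J h
  simp only [List.mem_cons, List.not_mem_nil, or_false] at hN
  rcases hN with rfl | rfl | rfl | rfl
  · refine (h.false_of_eigenvectors 1 ![1, 1, 1, 1, 0, 0] ![0, 0, 0, 0, 1, 0]
      ![0, 0, 0, 0, 0, 1] ?_ ?_ ?_ ?_ ?_ ?_ ?_ ?_ ?_ ?_).elim <;> decide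
  · obtain ⟨a, b, c, d, e, f, g, h', i, j, k, l, m, n, o, rfl⟩ := exists_eq_antisymm h.transpose
    have r01 := h.fixed 0 1
    have r02 := h.fixed 0 2
    have r03 := h.fixed 0 3
    have r04 := h.fixed 0 4
    have r05 := h.fixed 0 5
    have r12 := h.fixed 1 2
    have r13 := h.fixed 1 3
    have r14 := h.fixed 1 4
    have r15 := h.fixed 1 5
    have r23 := h.fixed 2 3
    have r24 := h.fixed 2 4
    have r25 := h.fixed 2 5
    have r34 := h.fixed 3 4
    have r35 := h.fixed 3 5
    have r45 := h.fixed 4 5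
    simp [antisymm] at r01 r02 r03 r04 r05 r12 r13 r14 r15 r23 r24 r25 r34 r35 r45
    obtain rfl : b = 0 := by linarith only [r02, r13]
    obtain rfl : c = -a := by linarith only [r01, r12, r23, r03]
    obtain rfl : a = f := by linarith only [r01, r12, r23, r03]
    obtain rfl : g = 0 := by linarith only [r02, r13]
    obtain rfl : d = h' := by linarith only [r04, r14, r24, r34]
    obtain rfl : i = -e := by linarith only [r05, r15, r25, r35]
    obtain rfl : a = j := by linarith only [r01, r12, r23, r03]
    obtain rfl : d = k := by linarith only [r04, r14, r24, r34]
    obtain rfl : e = l := by linarith only [r05, r15, r25, r35]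
    obtain rfl : d = m := by linarith only [r04, r14, r24, r34]
    obtain rfl : n = -e := by linarith only [r05, r15, r25, r35]
    obtain rfl : o = 0 := by linarith only [r45]
    exact isRow_four_one_one h.mul_self
  · obtain ⟨a, b, c, d, e, f, g, h', i, j, k, l, m, n, o, rfl⟩ := exists_eq_antisymm h.transpose
    have z := fun x => h.isolated (a := 4) (b := 5) (c := x) (by decide) (by decide) (by decide)
    obtain ⟨z40, z50⟩ := z 0 (by decide) (by decide)
    obtain ⟨z41, z51⟩ := z 1 (by decide) (by decide)
    obtain ⟨z42, z52⟩ := z 2 (by decide) (by decide)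
    obtain ⟨z43, z53⟩ := z 3 (by decide) (by decide)
    clear z
    have r01 := h.fixed 0 1
    have r02 := h.fixed 0 2
    have r03 := h.fixed 0 3
    have r12 := h.fixed 1 2
    have r13 := h.fixed 1 3
    have r23 := h.fixed 2 3
    simp [antisymm] at z40 z50 z41 z51 z42 z52 z43 z53
    simp [antisymm] at r01 r02 r03 r12 r13 r23
    obtain rfl : a = c := by linarith only [r01, r12, r23, r03]
    subst z40 z50
    obtain rfl : a = f := by linarith only [r01, r12, r23, r03]
    obtain rfl : b = g := by linarith only [r02, r13]
    subst z41 z51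
    obtain rfl : a = j := by linarith only [r01, r12, r23, r03]
    subst z42 z52 z43 z53
    exact isRow_four h.mul_self
  · obtain ⟨a, b, c, d, e, f, g, h', i, j, k, l, m, n, o, rfl⟩ := exists_eq_antisymm h.transpose
    have r01 := h.fixed 0 1
    have r02 := h.fixed 0 2
    have r03 := h.fixed 0 3
    have r04 := h.fixed 0 4
    have r05 := h.fixed 0 5
    have r12 := h.fixed 1 2
    have r13 := h.fixed 1 3
    have r14 := h.fixed 1 4
    have r15 := h.fixed 1 5
    have r23 := h.fixed 2 3
    have r24 := h.fixed 2 4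
    have r25 := h.fixed 2 5
    have r34 := h.fixed 3 4
    have r35 := h.fixed 3 5
    have r45 := h.fixed 4 5
    simp [antisymm] at r01 r02 r03 r04 r05 r12 r13 r14 r15 r23 r24 r25 r34 r35 r45
    obtain rfl : a = c := by linarith only [r01, r12, r23, r03]
    obtain rfl : d = 0 := by linarith only [r04, r14, r24, r34]
    obtain rfl : e = 0 := by linarith only [r05, r15, r25, r35]
    obtain rfl : a = f := by linarith only [r01, r12, r23, r03]
    obtain rfl : b = g := by linarith only [r02, r13]
    obtain rfl : h' = 0 := by linarith only [r04, r14, r24, r34]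
    obtain rfl : i = 0 := by linarith only [r05, r15, r25, r35]
    obtain rfl : a = j := by linarith only [r01, r12, r23, r03]
    obtain rfl : k = 0 := by linarith only [r04, r14, r24, r34]
    obtain rfl : l = 0 := by linarith only [r05, r15, r25, r35]
    obtain rfl : m = 0 := by linarith only [r04, r14, r24, r34]
    obtain rfl : n = 0 := by linarith only [r05, r15, r25, r35]
    obtain rfl : o = 0 := by linarith only [r45]
    have q0 := mul_self_apply h.mul_self 4 4
    simp [antisymm] at q0

lemma isRow_of_four_cycle_swap {ε : Fin 6 → ℤˣ} {J : Matrix (Fin 6) (Fin 6) ℝ}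
    (h : CentralStructure ![1, 2, 3, 0, 5, 4] (fun i => (ε i : ℤ)) J) : IsRow J := by
  refine h.isRow_of_forms (fun η => ![1, η 0, η 0 * η 1, η 0 * η 1 * η 2, 1, η 4])
    [1]
    [![1, 1, 1, 1, 1, 1],
      ![1, 1, 1, 1, 1, -1],
      ![1, 1, 1, -1, 1, -1],
      ![1, 1, 1, -1, 1, 1]]
    (by decide +kernel) (by decide +kernel) ?_
  clear h
  intro N hN J h
  simp only [List.mem_cons, List.not_mem_nil, or_false] at hN
  rcases hN with rfl | rfl | rfl | rfl
  · obtain ⟨a, b, c, d, e, f, g, h', i, j, k, l, m, n, o, rfl⟩ := exists_eq_antisymm h.transpose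
    have r01 := h.fixed 0 1
    have r02 := h.fixed 0 2
    have r03 := h.fixed 0 3
    have r04 := h.fixed 0 4
    have r05 := h.fixed 0 5
    have r12 := h.fixed 1 2
    have r13 := h.fixed 1 3
    have r14 := h.fixed 1 4
    have r15 := h.fixed 1 5
    have r23 := h.fixed 2 3
    have r24 := h.fixed 2 4
    have r25 := h.fixed 2 5
    have r34 := h.fixed 3 4
    have r35 := h.fixed 3 5
    have r45 := h.fixed 4 5
    simp [antisymm] at r01 r02 r03 r04 r05 r12 r13 r14 r15 r23 r24 r25 r34 r35 r45
    obtain rfl : b = 0 := by linarith only [r02, r13]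
    obtain rfl : c = -a := by linarith only [r01, r12, r23, r03]
    obtain rfl : a = f := by linarith only [r01, r12, r23, r03]
    obtain rfl : g = 0 := by linarith only [r02, r13]
    obtain rfl : e = h' := by linarith only [r05, r14, r25, r34]
    obtain rfl : d = i := by linarith only [r04, r15, r24, r35]
    obtain rfl : a = j := by linarith only [r01, r12, r23, r03]
    obtain rfl : d = k := by linarith only [r04, r15, r24, r35]
    obtain rfl : e = l := by linarith only [r05, r14, r25, r34]
    obtain rfl : e = m := by linarith only [r05, r14, r25, r34]
    obtain rfl : d = n := by linarith only [r04, r15, r24, r35]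
    obtain rfl : o = 0 := by linarith only [r45]
    exact isRow_four_two h.mul_self
  · obtain ⟨a, b, c, d, e, f, g, h', i, j, k, l, m, n, o, rfl⟩ := exists_eq_antisymm h.transpose
    have z := fun x => h.isolated (a := 4) (b := 5) (c := x) (by decide) (by decide) (by decide)
    obtain ⟨z40, z50⟩ := z 0 (by decide) (by decide)
    obtain ⟨z41, z51⟩ := z 1 (by decide) (by decide)
    obtain ⟨z42, z52⟩ := z 2 (by decide) (by decide)
    obtain ⟨z43, z53⟩ := z 3 (by decide) (by decide)
    clear z
    have r01 := h.fixed 0 1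
    have r02 := h.fixed 0 2
    have r03 := h.fixed 0 3
    have r12 := h.fixed 1 2
    have r13 := h.fixed 1 3
    have r23 := h.fixed 2 3
    simp [antisymm] at z40 z50 z41 z51 z42 z52 z43 z53
    simp [antisymm] at r01 r02 r03 r12 r13 r23
    obtain rfl : b = 0 := by linarith only [r02, r13]
    obtain rfl : c = -a := by linarith only [r01, r12, r23, r03]
    subst z40 z50
    obtain rfl : a = f := by linarith only [r01, r12, r23, r03]
    obtain rfl : g = 0 := by linarith only [r02, r13]
    subst z41 z51
    obtain rfl : a = j := by linarith only [r01, r12, r23, r03]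
    subst z42 z52 z43 z53
    -- The block of the four-cycle is an antisymmetric circulant, so it kills the all-ones vector.
    have q0 := mul_self_apply h.mul_self 0 0
    have q1 := mul_self_apply h.mul_self 0 2
    simp [antisymm] at q0 q1
    rw [q1] at q0
    norm_num at q0
  · obtain ⟨a, b, c, d, e, f, g, h', i, j, k, l, m, n, o, rfl⟩ := exists_eq_antisymm h.transpose
    have z := fun x => h.isolated (a := 4) (b := 5) (c := x) (by decide) (by decide) (by decide)
    obtain ⟨z40, z50⟩ := z 0 (by decide) (by decide)
    obtain ⟨z41, z51⟩ := z 1 (by decide) (by decide)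
    obtain ⟨z42, z52⟩ := z 2 (by decide) (by decide)
    obtain ⟨z43, z53⟩ := z 3 (by decide) (by decide)
    clear z
    have r01 := h.fixed 0 1
    have r02 := h.fixed 0 2
    have r03 := h.fixed 0 3
    have r12 := h.fixed 1 2
    have r13 := h.fixed 1 3
    have r23 := h.fixed 2 3
    simp [antisymm] at z40 z50 z41 z51 z42 z52 z43 z53
    simp [antisymm] at r01 r02 r03 r12 r13 r23
    obtain rfl : a = c := by linarith only [r01, r12, r23, r03]
    subst z40 z50
    obtain rfl : a = f := by linarith only [r01, r12, r23, r03]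
    obtain rfl : b = g := by linarith only [r02, r13]
    subst z41 z51
    obtain rfl : a = j := by linarith only [r01, r12, r23, r03]
    subst z42 z52 z43 z53
    exact isRow_four h.mul_self
  · obtain ⟨a, b, c, d, e, f, g, h', i, j, k, l, m, n, o, rfl⟩ := exists_eq_antisymm h.transpose
    have r01 := h.fixed 0 1
    have r02 := h.fixed 0 2
    have r03 := h.fixed 0 3
    have r04 := h.fixed 0 4
    have r05 := h.fixed 0 5
    have r12 := h.fixed 1 2
    have r13 := h.fixed 1 3
    have r14 := h.fixed 1 4
    have r15 := h.fixed 1 5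
    have r23 := h.fixed 2 3
    have r24 := h.fixed 2 4
    have r25 := h.fixed 2 5
    have r34 := h.fixed 3 4
    have r35 := h.fixed 3 5
    have r45 := h.fixed 4 5
    simp [antisymm] at r01 r02 r03 r04 r05 r12 r13 r14 r15 r23 r24 r25 r34 r35 r45
    obtain rfl : a = c := by linarith only [r01, r12, r23, r03]
    obtain rfl : d = 0 := by linarith only [r04, r15, r24, r35]
    obtain rfl : e = 0 := by linarith only [r05, r14, r25, r34]
    obtain rfl : a = f := by linarith only [r01, r12, r23, r03]
    obtain rfl : b = g := by linarith only [r02, r13]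
    obtain rfl : h' = 0 := by linarith only [r05, r14, r25, r34]
    obtain rfl : i = 0 := by linarith only [r04, r15, r24, r35]
    obtain rfl : a = j := by linarith only [r01, r12, r23, r03]
    obtain rfl : k = 0 := by linarith only [r04, r15, r24, r35]
    obtain rfl : l = 0 := by linarith only [r05, r14, r25, r34]
    obtain rfl : m = 0 := by linarith only [r05, r14, r25, r34]
    obtain rfl : n = 0 := by linarith only [r04, r15, r24, r35]
    obtain rfl : o = 0 := by linarith only [r45]
    have q0 := mul_self_apply h.mul_self 4 4
    simp [antisymm] at q0

lemma isRow_of_five_cycle {ε : Fin 6 → ℤˣ} {J : Matrix (Fin 6) (Fin 6) ℝ}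
    (h : CentralStructure ![1, 2, 3, 4, 0, 5] (fun i => (ε i : ℤ)) J) : IsRow J := by
  refine h.isRow_of_forms (fun η => ![1, η 0, η 0 * η 1, η 0 * η 1 * η 2, η 0 * η 1 * η 2 * η 3, 1])
    [1]
    [![1, 1, 1, 1, 1, 1],
      ![1, 1, 1, 1, 1, -1]]
    (by decide +kernel) (by decide +kernel) ?_
  clear h
  intro N hN J h
  simp only [List.mem_cons, List.not_mem_nil, or_false] at hN
  rcases hN with rfl | rfl
  · obtain ⟨a, b, c, d, e, f, g, h', i, j, k, l, m, n, o, rfl⟩ := exists_eq_antisymm h.transpose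
    have r01 := h.fixed 0 1
    have r02 := h.fixed 0 2
    have r03 := h.fixed 0 3
    have r04 := h.fixed 0 4
    have r05 := h.fixed 0 5
    have r12 := h.fixed 1 2
    have r13 := h.fixed 1 3
    have r14 := h.fixed 1 4
    have r15 := h.fixed 1 5
    have r23 := h.fixed 2 3
    have r24 := h.fixed 2 4
    have r25 := h.fixed 2 5
    have r34 := h.fixed 3 4
    have r35 := h.fixed 3 5
    have r45 := h.fixed 4 5
    simp [antisymm] at r01 r02 r03 r04 r05 r12 r13 r14 r15 r23 r24 r25 r34 r35 r45
    obtain rfl : c = -b := by linarith only [r02, r13, r24, r03, r14]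
    obtain rfl : d = -a := by linarith only [r01, r12, r23, r34, r04]
    obtain rfl : a = f := by linarith only [r01, r12, r23, r34, r04]
    obtain rfl : b = g := by linarith only [r02, r13, r24, r03, r14]
    obtain rfl : h' = -b := by linarith only [r02, r13, r24, r03, r14]
    obtain rfl : e = i := by linarith only [r05, r15, r25, r35, r45]
    obtain rfl : a = j := by linarith only [r01, r12, r23, r34, r04]
    obtain rfl : b = k := by linarith only [r02, r13, r24, r03, r14]
    obtain rfl : e = l := by linarith only [r05, r15, r25, r35, r45]
    obtain rfl : a = m := by linarith only [r01, r12, r23, r34, r04]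
    obtain rfl : e = n := by linarith only [r05, r15, r25, r35, r45]
    obtain rfl : e = o := by linarith only [r05, r15, r25, r35, r45]
    exact isRow_five h.mul_self
  · obtain ⟨a, b, c, d, e, f, g, h', i, j, k, l, m, n, o, rfl⟩ := exists_eq_antisymm h.transpose
    have r01 := h.fixed 0 1
    have r02 := h.fixed 0 2
    have r03 := h.fixed 0 3
    have r04 := h.fixed 0 4
    have r05 := h.fixed 0 5
    have r12 := h.fixed 1 2
    have r13 := h.fixed 1 3
    have r14 := h.fixed 1 4
    have r15 := h.fixed 1 5
    have r23 := h.fixed 2 3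
    have r24 := h.fixed 2 4
    have r25 := h.fixed 2 5
    have r34 := h.fixed 3 4
    have r35 := h.fixed 3 5
    have r45 := h.fixed 4 5
    simp [antisymm] at r01 r02 r03 r04 r05 r12 r13 r14 r15 r23 r24 r25 r34 r35 r45
    obtain rfl : c = -b := by linarith only [r02, r13, r24, r03, r14]
    obtain rfl : d = -a := by linarith only [r01, r12, r23, r34, r04]
    obtain rfl : e = 0 := by linarith only [r05, r15, r25, r35, r45]
    obtain rfl : a = f := by linarith only [r01, r12, r23, r34, r04]
    obtain rfl : b = g := by linarith only [r02, r13, r24, r03, r14]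
    obtain rfl : h' = -b := by linarith only [r02, r13, r24, r03, r14]
    obtain rfl : i = 0 := by linarith only [r05, r15, r25, r35, r45]
    obtain rfl : a = j := by linarith only [r01, r12, r23, r34, r04]
    obtain rfl : b = k := by linarith only [r02, r13, r24, r03, r14]
    obtain rfl : l = 0 := by linarith only [r05, r15, r25, r35, r45]
    obtain rfl : a = m := by linarith only [r01, r12, r23, r34, r04]
    obtain rfl : n = 0 := by linarith only [r05, r15, r25, r35, r45]
    obtain rfl : o = 0 := by linarith only [r05, r15, r25, r35, r45]
    -- The fixed coordinate has a sign incompatible with the five-cycle, so its row of `J` vanishes.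
    have q0 := mul_self_apply h.mul_self 5 5
    simp [antisymm] at q0

lemma isRow_of_six_cycle {ε : Fin 6 → ℤˣ} {J : Matrix (Fin 6) (Fin 6) ℝ}
    (h : CentralStructure ![1, 2, 3, 4, 5, 0] (fun i => (ε i : ℤ)) J) : IsRow J := by
  refine h.isRow_of_forms (fun η => ![1, η 0, η 0 * η 1, η 0 * η 1 * η 2, η 0 * η 1 * η 2 * η 3,
    η 0 * η 1 * η 2 * η 3 * η 4])
    [1]
    [![1, 1, 1, 1, 1, 1],
      ![1, 1, 1, 1, 1, -1]]
    (by decide +kernel) (by decide +kernel) ?_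
  clear h
  intro N hN J h
  simp only [List.mem_cons, List.not_mem_nil, or_false] at hN
  rcases hN with rfl | rfl
  · obtain ⟨a, b, c, d, e, f, g, h', i, j, k, l, m, n, o, rfl⟩ := exists_eq_antisymm h.transpose
    have r01 := h.fixed 0 1
    have r02 := h.fixed 0 2
    have r03 := h.fixed 0 3
    have r04 := h.fixed 0 4
    have r05 := h.fixed 0 5
    have r12 := h.fixed 1 2
    have r13 := h.fixed 1 3
    have r14 := h.fixed 1 4
    have r15 := h.fixed 1 5
    have r23 := h.fixed 2 3
    have r24 := h.fixed 2 4
    have r25 := h.fixed 2 5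
    have r34 := h.fixed 3 4
    have r35 := h.fixed 3 5
    have r45 := h.fixed 4 5
    simp [antisymm] at r01 r02 r03 r04 r05 r12 r13 r14 r15 r23 r24 r25 r34 r35 r45
    obtain rfl : c = 0 := by linarith only [r03, r14, r25]
    obtain rfl : d = -b := by linarith only [r02, r13, r24, r35, r04, r15]
    obtain rfl : e = -a := by linarith only [r01, r12, r23, r34, r45, r05]
    obtain rfl : a = f := by linarith only [r01, r12, r23, r34, r45, r05]
    obtain rfl : b = g := by linarith only [r02, r13, r24, r35, r04, r15]
    obtain rfl : h' = 0 := by linarith only [r03, r14, r25]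
    obtain rfl : i = -b := by linarith only [r02, r13, r24, r35, r04, r15]
    obtain rfl : a = j := by linarith only [r01, r12, r23, r34, r45, r05]
    obtain rfl : b = k := by linarith only [r02, r13, r24, r35, r04, r15]
    obtain rfl : l = 0 := by linarith only [r03, r14, r25]
    obtain rfl : a = m := by linarith only [r01, r12, r23, r34, r45, r05]
    obtain rfl : b = n := by linarith only [r02, r13, r24, r35, r04, r15]
    obtain rfl : a = o := by linarith only [r01, r12, r23, r34, r45, r05]
    -- An antisymmetric circulant has row sums zero, so it kills the all-ones vector; adding the
    -- entries of a row of `J²` exposes the contradiction.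
    have q0 := mul_self_apply h.mul_self 0 0
    have q1 := mul_self_apply h.mul_self 0 1
    have q2 := mul_self_apply h.mul_self 0 2
    have q3 := mul_self_apply h.mul_self 0 3
    have q4 := mul_self_apply h.mul_self 0 4
    have q5 := mul_self_apply h.mul_self 0 5
    simp [antisymm] at q0 q1 q2 q3 q4 q5
    linarith
  · obtain ⟨a, b, c, d, e, f, g, h', i, j, k, l, m, n, o, rfl⟩ := exists_eq_antisymm h.transpose
    have r01 := h.fixed 0 1
    have r02 := h.fixed 0 2
    have r03 := h.fixed 0 3
    have r04 := h.fixed 0 4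
    have r05 := h.fixed 0 5
    have r12 := h.fixed 1 2
    have r13 := h.fixed 1 3
    have r14 := h.fixed 1 4
    have r15 := h.fixed 1 5
    have r23 := h.fixed 2 3
    have r24 := h.fixed 2 4
    have r25 := h.fixed 2 5
    have r34 := h.fixed 3 4
    have r35 := h.fixed 3 5
    have r45 := h.fixed 4 5
    simp [antisymm] at r01 r02 r03 r04 r05 r12 r13 r14 r15 r23 r24 r25 r34 r35 r45
    obtain rfl : b = d := by linarith only [r02, r13, r24, r35, r04, r15]
    obtain rfl : a = e := by linarith only [r01, r12, r23, r34, r45, r05]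
    obtain rfl : a = f := by linarith only [r01, r12, r23, r34, r45, r05]
    obtain rfl : b = g := by linarith only [r02, r13, r24, r35, r04, r15]
    obtain rfl : c = h' := by linarith only [r03, r14, r25]
    obtain rfl : b = i := by linarith only [r02, r13, r24, r35, r04, r15]
    obtain rfl : a = j := by linarith only [r01, r12, r23, r34, r45, r05]
    obtain rfl : b = k := by linarith only [r02, r13, r24, r35, r04, r15]
    obtain rfl : c = l := by linarith only [r03, r14, r25]
    obtain rfl : a = m := by linarith only [r01, r12, r23, r34, r45, r05]
    obtain rfl : b = n := by linarith only [r02, r13, r24, r35, r04, r15]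
    obtain rfl : a = o := by linarith only [r01, r12, r23, r34, r45, r05]
    exact isRow_six h.mul_self

/-- Among six signs three agree, so three coordinate vectors lie in one eigenspace. -/
lemma isRow_of_identity {ε : Fin 6 → ℤˣ} {J : Matrix (Fin 6) (Fin 6) ℝ}
    (h : CentralStructure id (fun i => (ε i : ℤ)) J) : IsRow J := by
  have key : ∀ ε : Fin 6 → ℤˣ, ∃ a b c : Fin 6, a ≠ b ∧ a ≠ c ∧ b ≠ c ∧ ε a = ε b ∧
      ε a = ε c := by decide +kernel
  obtain ⟨a, b, c, hab, hac, hbc, eb, ec⟩ := key ε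
  have hv : ∀ x, ε a = ε x → ∀ i, (Pi.single x 1 : Fin 6 → ℤ) (id i) =
      (ε a : ℤ) * ε i * (Pi.single x 1 : Fin 6 → ℤ) i := by
    intro x hx i
    by_cases hi : i = x
    · subst hi
      rw [hx, ← Units.val_mul, Int.units_mul_self]; simp
    · simp [hi]
  have hu : ∀ x : Fin 6, (Pi.single x 1 : Fin 6 → ℤ) ≠ 0 := fun x hx => by
    simpa using congrFun hx x
  refine (h.false_of_eigenvectors (ε a) (Pi.single a 1) (Pi.single b 1) (Pi.single c 1)
    (by rw [← Units.val_mul, Int.units_mul_self]; rfl) (hv a rfl) (hv b eb) (hv c ec) ?_ ?_ ?_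
    (hu a) (hu b) (hu c)).elim
  all_goals simp [hab.symm, hac.symm, hbc.symm]

/-! ### Reduction to the eleven conjugacy classes of permutations -/

/-- A representative of each conjugacy class of permutations. -/
def classRepresentative : Fin 11 → Equiv.Perm (Fin 6) :=
  ![1, c[0, 1], c[0, 1] * c[2, 3], c[0, 1] * c[2, 3] * c[4, 5], c[0, 1, 2], c[0, 1, 2] * c[4, 5],
    c[0, 1, 2] * c[3, 4, 5], c[0, 1, 2, 3], c[0, 1, 2, 3] * c[4, 5], c[0, 1, 2, 3, 4],
    c[0, 1, 2, 3, 4, 5]]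

lemma exists_isConj_classRepresentative (π : Equiv.Perm (Fin 6)) :
    ∃ k, IsConj π (classRepresentative k) := by
  have key : ∀ π : Equiv.Perm (Fin 6), ∃ k, π.cycleType = (classRepresentative k).cycleType := by
    decide +kernel
  obtain ⟨k, hk⟩ := key π
  exact ⟨k, Equiv.Perm.isConj_iff_cycleType_eq.mpr hk⟩

/-- Classification of the complex structures that are determined by a signed permutation. -/
theorem isRow_of_central {π : Equiv.Perm (Fin 6)} {ε : Fin 6 → ℤˣ} {J : Matrix (Fin 6) (Fin 6) ℝ}
    (hT : Jᵀ = -J) (hJ : J * J = -1) (h : Central π ε J) : IsRow J := by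
  have hf : ∀ K, SignedConj π ε K K ↔ Fixed π (fun i => (ε i : ℤ)) K := fun K => by
    simp [SignedConj, Fixed]
  have h1 : CentralStructure π (fun i => (ε i : ℤ)) J :=
    ⟨hT, hJ, (hf J).mp h.1, fun K hK hKf => h.2 K hK ((hf K).mpr hKf)⟩
  obtain ⟨k, hk⟩ := exists_isConj_classRepresentative π
  obtain ⟨σ, hσ⟩ := isConj_iff.mp hk
  -- Only the coordinates are relabelled here; the signs are normalised later, within each class.
  have h2 : CentralStructure (classRepresentative k) (fun i => (ε (σ.symm i) : ℤ))
      (transform σ 1 J) := by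
    refine h1.changeBasis σ 1 1 rfl (fun _ => rfl) (fun i => ?_) (fun i => by simp)
    rw [← hσ]; simp
  refine isRow_transform (σ := σ) (δ := 1) (fun _ => rfl) ?_
  generalize transform σ 1 J = J' at h2
  have hp : ∀ {p : Fin 6 → Fin 6}, classRepresentative k = p →
      CentralStructure p (fun i => (ε (σ.symm i) : ℤ)) J' := fun hp => hp ▸ h2
  clear h2 hk hσ
  fin_cases k
  · exact isRow_of_identity (hp rfl)
  · exact isRow_of_swap (hp (by decide +kernel))
  · exact isRow_of_two_swaps (hp (by decide +kernel))
  · exact isRow_of_three_swaps (hp (by decide +kernel))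
  · exact isRow_of_three_cycle (hp (by decide +kernel))
  · exact isRow_of_three_cycle_swap (hp (by decide +kernel))
  · exact isRow_of_two_three_cycles (hp (by decide +kernel))
  · exact isRow_of_four_cycle (hp (by decide +kernel))
  · exact isRow_of_four_cycle_swap (hp (by decide +kernel))
  · exact isRow_of_five_cycle (hp (by decide +kernel))
  · exact isRow_of_six_cycle (hp (by decide +kernel))

/-! ### The standard complex structures are central -/

/-- The transpose of `K * J` is `J * K`, so agreement above the diagonal is enough. -/
lemma mul_comm_of_lt {K J : Matrix (Fin 6) (Fin 6) ℝ} (hK : Kᵀ = -K) (hJ : Jᵀ = -J)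
    (h : ∀ i j, i < j → (K * J) i j = (J * K) i j) : K * J = J * K := by
  have hs : (K * J)ᵀ = J * K := by rw [transpose_mul, hK, hJ, neg_mul_neg]
  have hs' : ∀ i j, (K * J) j i = (J * K) i j := fun i j => by rw [← hs]; rfl
  ext i j
  rcases lt_trichotomy i j with hij | rfl | hij
  · exact h i j hij
  · exact hs' i i
  · rw [hs', ← h j i hij, hs']

lemma central_of_fixed {p : Fin 6 → Fin 6} {e : Fin 6 → ℤ} {J : Matrix (Fin 6) (Fin 6) ℝ}
    (hJ : Jᵀ = -J) {π : Equiv.Perm (Fin 6)} {ε : Fin 6 → ℤˣ} (hp : ∀ i, π i = p i)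
    (he : ∀ i, (ε i : ℤ) = e i) (hf : ∀ i j, i < j → J (p i) (p j) = e i * e j * J i j)
    (hK : ∀ K : Matrix (Fin 6) (Fin 6) ℝ, Kᵀ = -K → Fixed p e K →
      ∀ i j, i < j → (K * J) i j = (J * K) i j) : Central π ε J := by
  have hs : ∀ K, SignedConj π ε K K ↔ Fixed p e K := fun K => by
    simp [SignedConj, Fixed, hp, he]
  have hJ' := apply_swap_of_transpose hJ
  refine ⟨(hs J).mpr fun i j => ?_, fun K hKT hKf =>
    mul_comm_of_lt hKT hJ (hK K hKT ((hs K).mp hKf))⟩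
  rcases lt_trichotomy i j with hij | rfl | hij
  · exact hf i j hij
  · linarith [hJ' i i, hJ' (p i) (p i), mul_comm (e i * e i : ℝ) (J i i),
      show (e i * e i : ℝ) * J i i = 0 by rw [show J i i = 0 by linarith [hJ' i i]]; simp]
  · rw [hJ', hf j i hij, hJ' i j]; ring

lemma forall_lt {P : Fin 6 → Fin 6 → Prop}
    (h : (P 0 1 ∧ P 0 2 ∧ P 0 3 ∧ P 0 4 ∧ P 0 5) ∧ (P 1 2 ∧ P 1 3 ∧ P 1 4 ∧ P 1 5) ∧
      (P 2 3 ∧ P 2 4 ∧ P 2 5) ∧ (P 3 4 ∧ P 3 5) ∧ P 4 5) (i j : Fin 6) (hij : i < j) :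
    P i j := by
  obtain ⟨⟨h1, h2, h3, h4, h5⟩, ⟨h6, h7, h8, h9⟩, ⟨h10, h11, h12⟩, ⟨h13, h14⟩, h15⟩ := h
  fin_cases i <;> fin_cases j <;>
    first
    | exact absurd hij (by decide)
    | assumption

/-- The permutation part of a symmetry that determines the standard complex structure. -/
def rowPerm : Fin 9 → Equiv.Perm (Fin 6) :=
  ![c[0, 1] * c[2, 3] * c[4, 5],
    c[0, 1] * c[4, 5],
    c[0, 1, 2] * c[4, 5],
    c[0, 1, 2, 3] * c[4, 5],
    c[0, 1, 2] * c[3, 4],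
    c[0, 1, 2] * c[3, 4, 5],
    c[0, 1, 2, 3, 4, 5],
    c[0, 1, 2, 3, 4],
    c[0, 1, 2, 3]]

/-- The signs of a symmetry that determines the standard complex structure. -/
def rowSign : Fin 9 → Fin 6 → ℤˣ :=
  ![![1, -1, 1, -1, 1, -1],
    ![1, 1, 1, -1, 1, -1],
    ![1, 1, 1, 1, 1, -1],
    ![1, 1, 1, 1, -1, -1],
    ![1, 1, 1, 1, 1, -1],
    ![1, 1, 1, 1, 1, 1],
    ![1, 1, 1, 1, 1, -1],
    ![1, 1, 1, 1, 1, 1],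
    ![1, 1, 1, 1, 1, -1]]

lemma signedDet_rowPerm (r : Fin 9) : signedDet (rowPerm r) (rowSign r) = 1 := by
  revert r; decide +kernel

-- For each row, solving the linear fixed-point equations parametrises the relevant fixed
-- antisymmetric matrices. Their commutation with the standard form is then a polynomial identity in
-- the remaining parameters.
set_option maxHeartbeats 1000000 in
theorem central_rowForm (r : Fin 9) : Central (rowPerm r) (rowSign r) (rowForm r) := by
  fin_cases r
  · refine central_of_fixed (p := ![1, 0, 3, 2, 5, 4]) (e := ![1, -1, 1, -1, 1, -1]) (rowForm_transpose _)
      (by decide +kernel) (by decide +kernel) (forall_lt ?_) fun K hKT h => ?_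
    · simp [rowForm, antisymm]
    · obtain ⟨a, b, c, d, e, f, g, h', i, j, k, l, m, n, o, rfl⟩ := exists_eq_antisymm hKT
      have r02 := h 0 2
      have r03 := h 0 3
      have r04 := h 0 4
      have r05 := h 0 5
      have r12 := h 1 2
      have r13 := h 1 3
      have r14 := h 1 4
      have r15 := h 1 5
      have r24 := h 2 4
      have r25 := h 2 5
      have r34 := h 3 4
      have r35 := h 3 5
      simp [antisymm] at r02 r03 r04 r05 r12 r13 r14 r15 r24 r25 r34 r35
      obtain rfl : f = -c := by linarith only [r03, r12]
      obtain rfl : b = g := by linarith only [r02, r13]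
      obtain rfl : h' = -e := by linarith only [r05, r14]
      obtain rfl : d = i := by linarith only [r04, r15]
      obtain rfl : m = -l := by linarith only [r25, r34]
      obtain rfl : k = n := by linarith only [r24, r35]
      refine forall_lt ⟨⟨?_, ?_, ?_, ?_, ?_⟩, ⟨?_, ?_, ?_, ?_⟩, ⟨?_, ?_, ?_⟩, ⟨?_, ?_⟩, ?_⟩ <;>
        simp [rowForm, antisymm, mul_apply, Fin.sum_univ_six]
  · refine central_of_fixed (p := ![1, 0, 2, 3, 5, 4]) (e := ![1, 1, 1, -1, 1, -1]) (rowForm_transpose _)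
      (by decide +kernel) (by decide +kernel) (forall_lt ?_) fun K hKT h => ?_
    · simp [rowForm, antisymm]
    · obtain ⟨a, b, c, d, e, f, g, h', i, j, k, l, m, n, o, rfl⟩ := exists_eq_antisymm hKT
      have r01 := h 0 1
      have r02 := h 0 2
      have r03 := h 0 3
      have r04 := h 0 4
      have r05 := h 0 5
      have r12 := h 1 2
      have r13 := h 1 3
      have r14 := h 1 4
      have r15 := h 1 5
      have r23 := h 2 3
      have r24 := h 2 4
      have r25 := h 2 5
      have r34 := h 3 4
      have r35 := h 3 5
      simp [antisymm] at r01 r02 r03 r04 r05 r12 r13 r14 r15 r23 r24 r25 r34 r35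
      obtain rfl : a = 0 := by linarith only [r01]
      obtain rfl : d = 0 := by linarith only [r04, r15]
      obtain rfl : e = 0 := by linarith only [r05, r14]
      obtain rfl : b = f := by linarith only [r02, r12]
      obtain rfl : g = -c := by linarith only [r03, r13]
      obtain rfl : h' = 0 := by linarith only [r05, r14]
      obtain rfl : i = 0 := by linarith only [r04, r15]
      obtain rfl : j = 0 := by linarith only [r23]
      obtain rfl : k = 0 := by linarith only [r24, r25]
      obtain rfl : l = 0 := by linarith only [r24, r25]
      obtain rfl : m = 0 := by linarith only [r34, r35]
      obtain rfl : n = 0 := by linarith only [r34, r35]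
      refine forall_lt ⟨⟨?_, ?_, ?_, ?_, ?_⟩, ⟨?_, ?_, ?_, ?_⟩, ⟨?_, ?_, ?_⟩, ⟨?_, ?_⟩, ?_⟩ <;>
        simp [rowForm, antisymm, mul_apply, Fin.sum_univ_six] <;> ring
  · refine central_of_fixed (p := ![1, 2, 0, 3, 5, 4]) (e := ![1, 1, 1, 1, 1, -1]) (rowForm_transpose _)
      (by decide +kernel) (by decide +kernel) (forall_lt ?_) fun K hKT h => ?_
    · simp [rowForm, antisymm]
    · obtain ⟨a, b, c, d, e, f, g, h', i, j, k, l, m, n, o, rfl⟩ := exists_eq_antisymm hKT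
      have r01 := h 0 1
      have r02 := h 0 2
      have r03 := h 0 3
      have r04 := h 0 4
      have r05 := h 0 5
      have r12 := h 1 2
      have r13 := h 1 3
      have r14 := h 1 4
      have r15 := h 1 5
      have r23 := h 2 3
      have r24 := h 2 4
      have r25 := h 2 5
      have r34 := h 3 4
      have r35 := h 3 5
      simp [antisymm] at r01 r02 r03 r04 r05 r12 r13 r14 r15 r23 r24 r25 r34 r35
      obtain rfl : b = -a := by linarith only [r01, r12, r02]
      obtain rfl : d = 0 := by linarith only [r04, r15, r24, r05, r14, r25]
      obtain rfl : e = 0 := by linarith only [r04, r15, r24, r05, r14, r25]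
      obtain rfl : a = f := by linarith only [r01, r12, r02]
      obtain rfl : c = g := by linarith only [r03, r13, r23]
      obtain rfl : h' = 0 := by linarith only [r04, r15, r24, r05, r14, r25]
      obtain rfl : i = 0 := by linarith only [r04, r15, r24, r05, r14, r25]
      obtain rfl : c = j := by linarith only [r03, r13, r23]
      obtain rfl : k = 0 := by linarith only [r04, r15, r24, r05, r14, r25]
      obtain rfl : l = 0 := by linarith only [r04, r15, r24, r05, r14, r25]
      obtain rfl : m = 0 := by linarith only [r34, r35]
      obtain rfl : n = 0 := by linarith only [r34, r35]
      refine forall_lt ⟨⟨?_, ?_, ?_, ?_, ?_⟩, ⟨?_, ?_, ?_, ?_⟩, ⟨?_, ?_, ?_⟩, ⟨?_, ?_⟩, ?_⟩ <;>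
        simp [rowForm, antisymm, mul_apply, Fin.sum_univ_six] <;> ring
  · refine central_of_fixed (p := ![1, 2, 3, 0, 5, 4]) (e := ![1, 1, 1, 1, -1, -1]) (rowForm_transpose _)
      (by decide +kernel) (by decide +kernel) (forall_lt ?_) fun K hKT h => ?_
    · simp [rowForm, antisymm]
    · obtain ⟨a, b, c, d, e, f, g, h', i, j, k, l, m, n, o, rfl⟩ := exists_eq_antisymm hKT
      have r01 := h 0 1
      have r02 := h 0 2
      have r03 := h 0 3
      have r04 := h 0 4
      have r05 := h 0 5
      have r12 := h 1 2
      have r13 := h 1 3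
      have r14 := h 1 4
      have r15 := h 1 5
      have r23 := h 2 3
      have r24 := h 2 4
      have r25 := h 2 5
      have r34 := h 3 4
      have r35 := h 3 5
      have r45 := h 4 5
      simp [antisymm] at r01 r02 r03 r04 r05 r12 r13 r14 r15 r23 r24 r25 r34 r35 r45
      obtain rfl : b = 0 := by linarith only [r02, r13]
      obtain rfl : c = -a := by linarith only [r01, r12, r23, r03]
      obtain rfl : a = f := by linarith only [r01, r12, r23, r03]
      obtain rfl : g = 0 := by linarith only [r02, r13]
      obtain rfl : h' = -e := by linarith only [r05, r14, r25, r34]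
      obtain rfl : i = -d := by linarith only [r04, r15, r24, r35]
      obtain rfl : a = j := by linarith only [r01, r12, r23, r03]
      obtain rfl : d = k := by linarith only [r04, r15, r24, r35]
      obtain rfl : e = l := by linarith only [r05, r14, r25, r34]
      obtain rfl : m = -e := by linarith only [r05, r14, r25, r34]
      obtain rfl : n = -d := by linarith only [r04, r15, r24, r35]
      obtain rfl : o = 0 := by linarith only [r45]
      refine forall_lt ⟨⟨?_, ?_, ?_, ?_, ?_⟩, ⟨?_, ?_, ?_, ?_⟩, ⟨?_, ?_, ?_⟩, ⟨?_, ?_⟩, ?_⟩ <;>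
        simp [rowForm, antisymm, mul_apply, Fin.sum_univ_six] <;> ring
  · refine central_of_fixed (p := ![1, 2, 0, 4, 3, 5]) (e := ![1, 1, 1, 1, 1, -1]) (rowForm_transpose _)
      (by decide +kernel) (by decide +kernel) (forall_lt ?_) fun K hKT h => ?_
    · simp [rowForm, antisymm]
    · obtain ⟨a, b, c, d, e, f, g, h', i, j, k, l, m, n, o, rfl⟩ := exists_eq_antisymm hKT
      have r01 := h 0 1
      have r02 := h 0 2
      have r03 := h 0 3
      have r04 := h 0 4
      have r05 := h 0 5
      have r12 := h 1 2
      have r13 := h 1 3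
      have r14 := h 1 4
      have r15 := h 1 5
      have r23 := h 2 3
      have r24 := h 2 4
      have r25 := h 2 5
      have r34 := h 3 4
      have r35 := h 3 5
      have r45 := h 4 5
      simp [antisymm] at r01 r02 r03 r04 r05 r12 r13 r14 r15 r23 r24 r25 r34 r35 r45
      obtain rfl : b = -a := by linarith only [r01, r12, r02]
      obtain rfl : c = d := by linarith only [r03, r14, r23, r04, r13, r24]
      obtain rfl : e = 0 := by linarith only [r05, r15, r25]
      obtain rfl : a = f := by linarith only [r01, r12, r02]
      obtain rfl : c = g := by linarith only [r03, r14, r23, r04, r13, r24]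
      obtain rfl : c = h' := by linarith only [r03, r14, r23, r04, r13, r24]
      obtain rfl : i = 0 := by linarith only [r05, r15, r25]
      obtain rfl : c = j := by linarith only [r03, r14, r23, r04, r13, r24]
      obtain rfl : c = k := by linarith only [r03, r14, r23, r04, r13, r24]
      obtain rfl : l = 0 := by linarith only [r05, r15, r25]
      obtain rfl : m = 0 := by linarith only [r34]
      obtain rfl : o = -n := by linarith only [r35, r45]
      refine forall_lt ⟨⟨?_, ?_, ?_, ?_, ?_⟩, ⟨?_, ?_, ?_, ?_⟩, ⟨?_, ?_, ?_⟩, ⟨?_, ?_⟩, ?_⟩ <;>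
        simp [rowForm, antisymm, mul_apply, Fin.sum_univ_six] <;> ring
  · refine central_of_fixed (p := ![1, 2, 0, 4, 5, 3]) (e := ![1, 1, 1, 1, 1, 1]) (rowForm_transpose _)
      (by decide +kernel) (by decide +kernel) (forall_lt ?_) fun K hKT h => ?_
    · simp [rowForm, antisymm]
    · obtain ⟨a, b, c, d, e, f, g, h', i, j, k, l, m, n, o, rfl⟩ := exists_eq_antisymm hKT
      have r01 := h 0 1
      have r02 := h 0 2
      have r03 := h 0 3
      have r04 := h 0 4
      have r05 := h 0 5
      have r12 := h 1 2
      have r13 := h 1 3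
      have r14 := h 1 4
      have r15 := h 1 5
      have r23 := h 2 3
      have r24 := h 2 4
      have r25 := h 2 5
      have r34 := h 3 4
      have r35 := h 3 5
      have r45 := h 4 5
      simp [antisymm] at r01 r02 r03 r04 r05 r12 r13 r14 r15 r23 r24 r25 r34 r35 r45
      obtain rfl : b = -a := by linarith only [r01, r12, r02]
      obtain rfl : a = f := by linarith only [r01, r12, r02]
      obtain rfl : e = g := by linarith only [r05, r13, r24]
      obtain rfl : c = h' := by linarith only [r03, r14, r25]
      obtain rfl : d = i := by linarith only [r04, r15, r23]
      obtain rfl : d = j := by linarith only [r04, r15, r23]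
      obtain rfl : e = k := by linarith only [r05, r13, r24]
      obtain rfl : c = l := by linarith only [r03, r14, r25]
      obtain rfl : n = -m := by linarith only [r34, r45, r35]
      obtain rfl : m = o := by linarith only [r34, r45, r35]
      refine forall_lt ⟨⟨?_, ?_, ?_, ?_, ?_⟩, ⟨?_, ?_, ?_, ?_⟩, ⟨?_, ?_, ?_⟩, ⟨?_, ?_⟩, ?_⟩ <;>
        simp [rowForm, antisymm, mul_apply, Fin.sum_univ_six] <;> ring
  · refine central_of_fixed (p := ![1, 2, 3, 4, 5, 0]) (e := ![1, 1, 1, 1, 1, -1]) (rowForm_transpose _)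
      (by decide +kernel) (by decide +kernel) (forall_lt ?_) fun K hKT h => ?_
    · simp [rowForm, antisymm]
    · obtain ⟨a, b, c, d, e, f, g, h', i, j, k, l, m, n, o, rfl⟩ := exists_eq_antisymm hKT
      have r01 := h 0 1
      have r02 := h 0 2
      have r03 := h 0 3
      have r04 := h 0 4
      have r05 := h 0 5
      have r12 := h 1 2
      have r13 := h 1 3
      have r14 := h 1 4
      have r15 := h 1 5
      have r23 := h 2 3
      have r24 := h 2 4
      have r25 := h 2 5
      have r34 := h 3 4
      have r35 := h 3 5
      have r45 := h 4 5
      simp [antisymm] at r01 r02 r03 r04 r05 r12 r13 r14 r15 r23 r24 r25 r34 r35 r45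
      obtain rfl : b = d := by linarith only [r02, r13, r24, r35, r04, r15]
      obtain rfl : a = e := by linarith only [r01, r12, r23, r34, r45, r05]
      obtain rfl : a = f := by linarith only [r01, r12, r23, r34, r45, r05]
      obtain rfl : b = g := by linarith only [r02, r13, r24, r35, r04, r15]
      obtain rfl : c = h' := by linarith only [r03, r14, r25]
      obtain rfl : b = i := by linarith only [r02, r13, r24, r35, r04, r15]
      obtain rfl : a = j := by linarith only [r01, r12, r23, r34, r45, r05]
      obtain rfl : b = k := by linarith only [r02, r13, r24, r35, r04, r15]
      obtain rfl : c = l := by linarith only [r03, r14, r25]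
      obtain rfl : a = m := by linarith only [r01, r12, r23, r34, r45, r05]
      obtain rfl : b = n := by linarith only [r02, r13, r24, r35, r04, r15]
      obtain rfl : a = o := by linarith only [r01, r12, r23, r34, r45, r05]
      refine forall_lt ⟨⟨?_, ?_, ?_, ?_, ?_⟩, ⟨?_, ?_, ?_, ?_⟩, ⟨?_, ?_, ?_⟩, ⟨?_, ?_⟩, ?_⟩ <;>
        simp [rowForm, antisymm, mul_apply, Fin.sum_univ_six] <;> ring
  · refine central_of_fixed (p := ![1, 2, 3, 4, 0, 5]) (e := ![1, 1, 1, 1, 1, 1]) (rowForm_transpose _)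
      (by decide +kernel) (by decide +kernel) (forall_lt ?_) fun K hKT h => ?_
    · simp [rowForm, antisymm]
    · obtain ⟨a, b, c, d, e, f, g, h', i, j, k, l, m, n, o, rfl⟩ := exists_eq_antisymm hKT
      have r01 := h 0 1
      have r02 := h 0 2
      have r03 := h 0 3
      have r04 := h 0 4
      have r05 := h 0 5
      have r12 := h 1 2
      have r13 := h 1 3
      have r14 := h 1 4
      have r15 := h 1 5
      have r23 := h 2 3
      have r24 := h 2 4
      have r25 := h 2 5
      have r34 := h 3 4
      have r35 := h 3 5
      have r45 := h 4 5
      simp [antisymm] at r01 r02 r03 r04 r05 r12 r13 r14 r15 r23 r24 r25 r34 r35 r45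
      obtain rfl : c = -b := by linarith only [r02, r13, r24, r03, r14]
      obtain rfl : d = -a := by linarith only [r01, r12, r23, r34, r04]
      obtain rfl : a = f := by linarith only [r01, r12, r23, r34, r04]
      obtain rfl : b = g := by linarith only [r02, r13, r24, r03, r14]
      obtain rfl : h' = -b := by linarith only [r02, r13, r24, r03, r14]
      obtain rfl : e = i := by linarith only [r05, r15, r25, r35, r45]
      obtain rfl : a = j := by linarith only [r01, r12, r23, r34, r04]
      obtain rfl : b = k := by linarith only [r02, r13, r24, r03, r14]
      obtain rfl : e = l := by linarith only [r05, r15, r25, r35, r45]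
      obtain rfl : a = m := by linarith only [r01, r12, r23, r34, r04]
      obtain rfl : e = n := by linarith only [r05, r15, r25, r35, r45]
      obtain rfl : e = o := by linarith only [r05, r15, r25, r35, r45]
      refine forall_lt ⟨⟨?_, ?_, ?_, ?_, ?_⟩, ⟨?_, ?_, ?_, ?_⟩, ⟨?_, ?_, ?_⟩, ⟨?_, ?_⟩, ?_⟩ <;>
        simp [rowForm, antisymm, mul_apply, Fin.sum_univ_six] <;> ring
  · refine central_of_fixed (p := ![1, 2, 3, 0, 4, 5]) (e := ![1, 1, 1, 1, 1, -1]) (rowForm_transpose _)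
      (by decide +kernel) (by decide +kernel) (forall_lt ?_) fun K hKT h => ?_
    · simp [rowForm, antisymm]
    · obtain ⟨a, b, c, d, e, f, g, h', i, j, k, l, m, n, o, rfl⟩ := exists_eq_antisymm hKT
      have r01 := h 0 1
      have r02 := h 0 2
      have r03 := h 0 3
      have r04 := h 0 4
      have r05 := h 0 5
      have r12 := h 1 2
      have r13 := h 1 3
      have r14 := h 1 4
      have r15 := h 1 5
      have r23 := h 2 3
      have r24 := h 2 4
      have r25 := h 2 5
      have r34 := h 3 4
      have r35 := h 3 5
      have r45 := h 4 5
      simp [antisymm] at r01 r02 r03 r04 r05 r12 r13 r14 r15 r23 r24 r25 r34 r35 r45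
      obtain rfl : b = 0 := by linarith only [r02, r13]
      obtain rfl : c = -a := by linarith only [r01, r12, r23, r03]
      obtain rfl : a = f := by linarith only [r01, r12, r23, r03]
      obtain rfl : g = 0 := by linarith only [r02, r13]
      obtain rfl : d = h' := by linarith only [r04, r14, r24, r34]
      obtain rfl : i = -e := by linarith only [r05, r15, r25, r35]
      obtain rfl : a = j := by linarith only [r01, r12, r23, r03]
      obtain rfl : d = k := by linarith only [r04, r14, r24, r34]
      obtain rfl : e = l := by linarith only [r05, r15, r25, r35]
      obtain rfl : d = m := by linarith only [r04, r14, r24, r34]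
      obtain rfl : n = -e := by linarith only [r05, r15, r25, r35]
      obtain rfl : o = 0 := by linarith only [r45]
      refine forall_lt ⟨⟨?_, ?_, ?_, ?_, ?_⟩, ⟨?_, ?_, ?_, ?_⟩, ⟨?_, ?_, ?_⟩, ⟨?_, ?_⟩, ?_⟩ <;>
        simp [rowForm, antisymm, mul_apply, Fin.sum_univ_six] <;> ring

/-! ### Expectation values in coordinates -/

/-- A Pauli operator has a single nonzero entry in each row, in the column shifted by a fixed `x` in
`(ℤ/2)²`. Its expectation value is therefore a sum of four terms. -/
lemma ev_toOp_of_monomial (ψ : Ket) {A : IntOp} {x : Fin 2 × Fin 2}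
    {g : Matrix (Fin 2) (Fin 2) GaussianInt} (h : ∀ p q, A p q = if q = p + x then g p.1 p.2 else 0) :
    ev ψ (IntOp.toOp A) = ∑ p, star (ψ p) * (GaussianInt.toComplex (g p.1 p.2) * ψ (p + x)) := by
  simp [ev, dotProduct, mulVec, toOp_apply, h, apply_ite GaussianInt.toComplex, ite_mul]

lemma cs_apply_of_monomial (ψ : Ket) {i j : Fin 6} (hij : i ≠ j) (x : Fin 2 × Fin 2)
    (g : Matrix (Fin 2) (Fin 2) GaussianInt)
    (h : ∀ p q, (gammaInt i * (gammaInt j)ᴴ) p q = if q = p + x then g p.1 p.2 else 0) :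
    cs ψ i j = (Complex.I * ∑ p, star (ψ p) * (GaussianInt.toComplex (g p.1 p.2) * ψ (p + x))).re := by
  rw [cs, if_neg hij, bil_eq_toOp, ev_toOp_of_monomial ψ h]

lemma sum_two_qubit (f : Fin 2 × Fin 2 → ℂ) :
    ∑ p, f p = f (0, 0) + f (0, 1) + f (1, 0) + f (1, 1) := by
  rw [Fintype.sum_prod_type]
  simp only [Fin.sum_univ_two]
  ring

lemma cs_ket (a₁ a₂ b₁ b₂ c₁ c₂ d₁ d₂ : ℝ) : cs (ket ⟨a₁, a₂⟩ ⟨b₁, b₂⟩ ⟨c₁, c₂⟩ ⟨d₁, d₂⟩) = antisymm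
    (2 * (a₁ * c₂ - a₂ * c₁) - 2 * (b₁ * d₂ - b₂ * d₁))
    (-2 * (a₁ * d₂ - a₂ * d₁) - 2 * (b₁ * c₂ - b₂ * c₁))
    (-2 * (a₁ * d₁ + a₂ * d₂) + 2 * (b₁ * c₁ + b₂ * c₂))
    (2 * (a₁ * c₁ + a₂ * c₂) + 2 * (b₁ * d₁ + b₂ * d₂))
    ((a₁ ^ 2 + a₂ ^ 2) + (b₁ ^ 2 + b₂ ^ 2) - (c₁ ^ 2 + c₂ ^ 2) - (d₁ ^ 2 + d₂ ^ 2))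
    (2 * (a₁ * b₂ - a₂ * b₁) + 2 * (c₁ * d₂ - c₂ * d₁))
    (2 * (a₁ * b₁ + a₂ * b₂) + 2 * (c₁ * d₁ + c₂ * d₂))
    ((a₁ ^ 2 + a₂ ^ 2) - (b₁ ^ 2 + b₂ ^ 2) - (c₁ ^ 2 + c₂ ^ 2) + (d₁ ^ 2 + d₂ ^ 2))
    (-2 * (a₁ * c₁ + a₂ * c₂) + 2 * (b₁ * d₁ + b₂ * d₂))
    ((a₁ ^ 2 + a₂ ^ 2) - (b₁ ^ 2 + b₂ ^ 2) + (c₁ ^ 2 + c₂ ^ 2) - (d₁ ^ 2 + d₂ ^ 2))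
    (-2 * (a₁ * b₁ + a₂ * b₂) + 2 * (c₁ * d₁ + c₂ * d₂))
    (2 * (a₁ * d₁ + a₂ * d₂) + 2 * (b₁ * c₁ + b₂ * c₂))
    (2 * (a₁ * b₂ - a₂ * b₁) - 2 * (c₁ * d₂ - c₂ * d₁))
    (-2 * (a₁ * d₂ - a₂ * d₁) + 2 * (b₁ * c₂ - b₂ * c₁))
    (2 * (a₁ * c₂ - a₂ * c₁) + 2 * (b₁ * d₂ - b₂ * d₁)) := by
  refine ext_of_lt (cs_transpose _) (antisymm_transpose ..) (forall_lt
    ⟨⟨?_, ?_, ?_, ?_, ?_⟩, ⟨?_, ?_, ?_, ?_⟩, ⟨?_, ?_, ?_⟩, ⟨?_, ?_⟩, ?_⟩)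
  · rw [cs_apply_of_monomial _ (by decide) (1, 0) !![⟨-1, 0⟩, ⟨1, 0⟩; ⟨1, 0⟩, ⟨-1, 0⟩] (by decide +kernel),
      sum_two_qubit]
    simp [antisymm, ket, GaussianInt.toComplex_def]
    ring
  · rw [cs_apply_of_monomial _ (by decide) (1, 1) !![⟨1, 0⟩, ⟨1, 0⟩; ⟨-1, 0⟩, ⟨-1, 0⟩] (by decide +kernel),
      sum_two_qubit]
    simp [antisymm, ket, GaussianInt.toComplex_def]
    ring
  · rw [cs_apply_of_monomial _ (by decide) (1, 1) !![⟨0, 1⟩, ⟨0, -1⟩; ⟨0, -1⟩, ⟨0, 1⟩] (by decide +kernel),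
      sum_two_qubit]
    simp [antisymm, ket, GaussianInt.toComplex_def]
    ring
  · rw [cs_apply_of_monomial _ (by decide) (1, 0) !![⟨0, -1⟩, ⟨0, -1⟩; ⟨0, -1⟩, ⟨0, -1⟩] (by decide +kernel),
      sum_two_qubit]
    simp [antisymm, ket, GaussianInt.toComplex_def]
    ring
  · rw [cs_apply_of_monomial _ (by decide) (0, 0) !![⟨0, -1⟩, ⟨0, -1⟩; ⟨0, 1⟩, ⟨0, 1⟩] (by decide +kernel),
      sum_two_qubit]
    simp [antisymm, ket, GaussianInt.toComplex_def]
    ring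
  · rw [cs_apply_of_monomial _ (by decide) (0, 1) !![⟨-1, 0⟩, ⟨1, 0⟩; ⟨-1, 0⟩, ⟨1, 0⟩] (by decide +kernel),
      sum_two_qubit]
    simp [antisymm, ket, GaussianInt.toComplex_def]
    ring
  · rw [cs_apply_of_monomial _ (by decide) (0, 1) !![⟨0, -1⟩, ⟨0, -1⟩; ⟨0, -1⟩, ⟨0, -1⟩] (by decide +kernel),
      sum_two_qubit]
    simp [antisymm, ket, GaussianInt.toComplex_def]
    ring
  · rw [cs_apply_of_monomial _ (by decide) (0, 0) !![⟨0, -1⟩, ⟨0, 1⟩; ⟨0, 1⟩, ⟨0, -1⟩] (by decide +kernel),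
      sum_two_qubit]
    simp [antisymm, ket, GaussianInt.toComplex_def]
    ring
  · rw [cs_apply_of_monomial _ (by decide) (1, 0) !![⟨0, 1⟩, ⟨0, -1⟩; ⟨0, 1⟩, ⟨0, -1⟩] (by decide +kernel),
      sum_two_qubit]
    simp [antisymm, ket, GaussianInt.toComplex_def]
    ring
  · rw [cs_apply_of_monomial _ (by decide) (0, 0) !![⟨0, -1⟩, ⟨0, 1⟩; ⟨0, -1⟩, ⟨0, 1⟩] (by decide +kernel),
      sum_two_qubit]
    simp [antisymm, ket, GaussianInt.toComplex_def]
    ring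
  · rw [cs_apply_of_monomial _ (by decide) (0, 1) !![⟨0, 1⟩, ⟨0, 1⟩; ⟨0, -1⟩, ⟨0, -1⟩] (by decide +kernel),
      sum_two_qubit]
    simp [antisymm, ket, GaussianInt.toComplex_def]
    ring
  · rw [cs_apply_of_monomial _ (by decide) (1, 1) !![⟨0, -1⟩, ⟨0, -1⟩; ⟨0, -1⟩, ⟨0, -1⟩] (by decide +kernel),
      sum_two_qubit]
    simp [antisymm, ket, GaussianInt.toComplex_def]
    ring
  · rw [cs_apply_of_monomial _ (by decide) (0, 1) !![⟨-1, 0⟩, ⟨1, 0⟩; ⟨1, 0⟩, ⟨-1, 0⟩] (by decide +kernel),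
      sum_two_qubit]
    simp [antisymm, ket, GaussianInt.toComplex_def]
    ring
  · rw [cs_apply_of_monomial _ (by decide) (1, 1) !![⟨1, 0⟩, ⟨-1, 0⟩; ⟨1, 0⟩, ⟨-1, 0⟩] (by decide +kernel),
      sum_two_qubit]
    simp [antisymm, ket, GaussianInt.toComplex_def]
    ring
  · rw [cs_apply_of_monomial _ (by decide) (1, 0) !![⟨-1, 0⟩, ⟨-1, 0⟩; ⟨1, 0⟩, ⟨1, 0⟩] (by decide +kernel),
      sum_two_qubit]
    simp [antisymm, ket, GaussianInt.toComplex_def]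
    ring

lemma isState_ket {a₁ a₂ b₁ b₂ c₁ c₂ d₁ d₂ : ℝ}
    (h : a₁ ^ 2 + a₂ ^ 2 + b₁ ^ 2 + b₂ ^ 2 + c₁ ^ 2 + c₂ ^ 2 + d₁ ^ 2 + d₂ ^ 2 = 1) :
    IsState (ket ⟨a₁, a₂⟩ ⟨b₁, b₂⟩ ⟨c₁, c₂⟩ ⟨d₁, d₂⟩) := by
  rw [IsState, dotProduct, sum_two_qubit]
  apply Complex.ext
  · simp [ket]
    linarith
  · simp [ket]
    ring

/-! ### The states of the table -/

/-- The unit vector `ψ` belongs to row `r`. -/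
def HasRow (ψ : Ket) (r : Fin 9) : Prop :=
  IsState ψ ∧ ∃ π ε, signedDet π ε = 1 ∧ SignedConj π ε (cs ψ) (rowForm r)

/-- Determinant one must be established directly here: `signedDet_eq_one` would require a state
whose complex structure is `rowForm r`, and none is known yet. The number `z` is the common value of
the sign of the permutation, computed from its inversions, and of the product of the signs. -/
lemma exists_special_signedConj (r : Fin 9) {a b c d e f g h i j k l m n o : ℝ} (p : Fin 6 → Fin 6)
    (s : Fin 6 → ℝ) (z : ℤ) (hp : Function.Injective p) (hs : ∀ i, s i * s i = 1)
    (hpd : ∏ y, ∏ x ∈ Finset.Iio y, (if p x < p y then 1 else -1) = z) (hsd : ∏ i, s i = z)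
    (H : (rowForm r (p 0) (p 1) = s 0 * s 1 * a ∧ rowForm r (p 0) (p 2) = s 0 * s 2 * b ∧
      rowForm r (p 0) (p 3) = s 0 * s 3 * c ∧ rowForm r (p 0) (p 4) = s 0 * s 4 * d ∧
      rowForm r (p 0) (p 5) = s 0 * s 5 * e) ∧ (rowForm r (p 1) (p 2) = s 1 * s 2 * f ∧
      rowForm r (p 1) (p 3) = s 1 * s 3 * g ∧ rowForm r (p 1) (p 4) = s 1 * s 4 * h ∧
      rowForm r (p 1) (p 5) = s 1 * s 5 * i) ∧ (rowForm r (p 2) (p 3) = s 2 * s 3 * j ∧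
      rowForm r (p 2) (p 4) = s 2 * s 4 * k ∧ rowForm r (p 2) (p 5) = s 2 * s 5 * l) ∧
      (rowForm r (p 3) (p 4) = s 3 * s 4 * m ∧ rowForm r (p 3) (p 5) = s 3 * s 5 * n) ∧
      rowForm r (p 4) (p 5) = s 4 * s 5 * o) :
    ∃ π ε, signedDet π ε = 1 ∧
      SignedConj π ε (antisymm a b c d e f g h i j k l m n o) (rowForm r) := by
  obtain ⟨π, ε, hπ, hε, h⟩ := exists_signedConj_antisymm r p s hp hs H
  refine ⟨π, ε, ?_, h⟩
  have h1 : ((Equiv.Perm.sign π : ℤˣ) : ℤ) = z := by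
    rw [Equiv.Perm.sign_eq_prod_prod_Iio, ← hpd]
    simp only [hπ, Units.coe_prod, apply_ite Units.val, Units.val_one, Units.val_neg]
  have h2 : ((∏ i, ε i : ℤˣ) : ℤ) = z := by
    have : ((((∏ i, ε i : ℤˣ) : ℤ) : ℤ) : ℝ) = z := by
      rw [← hsd]; push_cast; exact Finset.prod_congr rfl fun i _ => hε i
    exact_mod_cast this
  have h3 : Equiv.Perm.sign π = ∏ i, ε i := Units.ext (h1.trans h2.symm)
  rw [signedDet, h3, Int.units_mul_self]

lemma phase_eq : phase = ⟨√2 / 2, √2 / 2⟩ := by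
  have h : Complex.I * Real.pi / 4 = ((Real.pi / 4 : ℝ) : ℂ) * Complex.I := by push_cast; ring
  rw [phase, h, Complex.exp_mul_I, ← Complex.ofReal_cos, ← Complex.ofReal_sin,
    Real.cos_pi_div_four, Real.sin_pi_div_four]
  apply Complex.ext <;> simp

lemma two_sqrt_mul_self : √2 * √2 = 2 := Real.mul_self_sqrt (by norm_num)

lemma three_sqrt_mul_self : √3 * √3 = 3 := Real.mul_self_sqrt (by norm_num)

lemma inv_sqrt_two : (√2)⁻¹ = √2 / 2 := by
  rw [inv_eq_iff_eq_inv, inv_div, eq_div_iff (by positivity)]; exact two_sqrt_mul_self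

lemma inv_sqrt_three : (√3)⁻¹ = √3 / 3 := by
  rw [inv_eq_iff_eq_inv, inv_div, eq_div_iff (by positivity)]; exact three_sqrt_mul_self

lemma inv_sqrt_six : (√6)⁻¹ = √2 * √3 / 6 := by
  have : √6 = √2 * √3 := by rw [← Real.sqrt_mul (by norm_num)]; norm_num
  rw [this, mul_inv, inv_sqrt_two, inv_sqrt_three]; ring

lemma hasRow_zero_zero : HasRow (tensor zero zero) 0 := by
  have : tensor zero zero = ket ⟨1, 0⟩ ⟨0, 0⟩ ⟨0, 0⟩ ⟨0, 0⟩ := by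
    ext ⟨p, q⟩; fin_cases p <;> fin_cases q <;> simp [tensor, zero, ket, Complex.ext_iff]
  rw [this]
  refine ⟨isState_ket (by norm_num), ?_⟩
  rw [cs_ket]
  exact exists_special_signedConj 0 ![0, 2, 4, 5, 3, 1] ![1, 1, 1, 1, 1, 1] 1 (by decide)
    (by simp [Fin.forall_fin_succ]) (by decide +kernel) (by simp [Fin.prod_univ_six]) (by simp [rowForm, antisymm])

/-- Expectation values are quadratic in the amplitudes, so these three products suffice and the
nested roots never need to be simplified. -/
lemma hZero_facts : ∃ x y : ℝ, hZero = ![⟨x, 0⟩, ⟨y, 0⟩] ∧ x * x = (2 + √2) / 4 ∧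
    y * y = (2 - √2) / 4 ∧ x * y = √2 / 4 := by
  have h2 : √2 < 2 := by rw [Real.sqrt_lt' (by norm_num)]; norm_num
  have h3 : 0 ≤ √2 := by positivity
  refine ⟨√((2 + √2) / 4), √((2 - √2) / 4), rfl, Real.mul_self_sqrt (by linarith),
    Real.mul_self_sqrt (by linarith), ?_⟩
  rw [← Real.sqrt_mul (by linarith), show (2 + √2) / 4 * ((2 - √2) / 4) = (√2 / 4) * (√2 / 4) by
    linear_combination (-1 / 8 : ℝ) * two_sqrt_mul_self, Real.sqrt_mul_self (by positivity)]

lemma tZero_facts : ∃ x y : ℝ, tZero = ![⟨x, 0⟩, ⟨√2 / 2 * y, √2 / 2 * y⟩] ∧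
    tOne = ![⟨-y, 0⟩, ⟨√2 / 2 * x, √2 / 2 * x⟩] ∧ x * x = (3 + √3) / 6 ∧
    y * y = (3 - √3) / 6 ∧ x * y = √2 * √3 / 6 := by
  have h2 : √3 < 3 := by rw [Real.sqrt_lt' (by norm_num)]; norm_num
  have h3 : 0 ≤ √3 := by positivity
  refine ⟨√((3 + √3) / 6), √((3 - √3) / 6), ?_, ?_, Real.mul_self_sqrt (by linarith),
    Real.mul_self_sqrt (by linarith), ?_⟩
  · ext i; fin_cases i <;> simp [tZero, phase_eq, Complex.ext_iff]
  · ext i; fin_cases i <;> simp [tOne, phase_eq, Complex.ext_iff]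
  rw [← Real.sqrt_mul (by linarith), show (3 + √3) / 6 * ((3 - √3) / 6) =
    (√2 * √3 / 6) * (√2 * √3 / 6) by
    linear_combination (-1 / 36 - √2 * √2 / 36 : ℝ) * three_sqrt_mul_self -
      (1 / 12 : ℝ) * two_sqrt_mul_self, Real.sqrt_mul_self (by positivity)]

lemma hasRow_hZero_zero : HasRow (tensor hZero zero) 1 := by
  obtain ⟨x, y, h, hx, hy, hxy⟩ := hZero_facts
  have : tensor hZero zero = ket ⟨x, 0⟩ ⟨0, 0⟩ ⟨y, 0⟩ ⟨0, 0⟩ := by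
    rw [h]; ext ⟨p, q⟩; fin_cases p <;> fin_cases q <;> simp [tensor, zero, ket, Complex.ext_iff]
  rw [this]
  refine ⟨isState_ket (by linarith), ?_⟩
  rw [cs_ket]
  refine exists_special_signedConj 1 ![0, 1, 4, 5, 2, 3] ![1, 1, 1, 1, 1, 1] 1 (by decide)
    (by simp [Fin.forall_fin_succ]) (by decide +kernel) (by simp [Fin.prod_univ_six]) ?_
  simp [rowForm, antisymm, inv_sqrt_two]
  grind

lemma hasRow_tZero_zero : HasRow (tensor tZero zero) 2 := by
  obtain ⟨x, y, h, -, hx, hy, hxy⟩ := tZero_facts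
  have : tensor tZero zero = ket ⟨x, 0⟩ ⟨0, 0⟩ ⟨√2 / 2 * y, √2 / 2 * y⟩ ⟨0, 0⟩ := by
    rw [h]; ext ⟨p, q⟩; fin_cases p <;> fin_cases q <;> simp [tensor, zero, ket, Complex.ext_iff]
  rw [this]
  have h2 := two_sqrt_mul_self
  refine ⟨isState_ket (by grind), ?_⟩
  rw [cs_ket]
  refine exists_special_signedConj 2 ![0, 1, 4, 5, 3, 2] ![1, 1, 1, 1, 1, -1] (-1) (by decide)
    (by simp [Fin.forall_fin_succ]) (by decide +kernel) (by simp [Fin.prod_univ_six]) ?_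
  simp [rowForm, antisymm, inv_sqrt_three]
  grind

lemma hasRow_hZero_hZero : HasRow (tensor hZero hZero) 3 := by
  obtain ⟨x, y, h, hx, hy, hxy⟩ := hZero_facts
  have : tensor hZero hZero = ket ⟨(2 + √2) / 4, 0⟩ ⟨√2 / 4, 0⟩ ⟨√2 / 4, 0⟩ ⟨(2 - √2) / 4, 0⟩ := by
    rw [h]; ext ⟨p, q⟩
    fin_cases p <;> fin_cases q <;> simp [tensor, ket, Complex.ext_iff] <;> linarith
  rw [this]
  have h2 := two_sqrt_mul_self
  refine ⟨isState_ket (by grind), ?_⟩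
  rw [cs_ket]
  refine exists_special_signedConj 3 ![4, 1, 3, 5, 0, 2] ![1, 1, 1, -1, -1, -1] (-1) (by decide)
    (by simp [Fin.forall_fin_succ]) (by decide +kernel) (by simp [Fin.prod_univ_six]) ?_
  simp [rowForm, antisymm, inv_sqrt_two]
  grind

lemma hasRow_tZero_hZero : HasRow (tensor tZero hZero) 4 := by
  obtain ⟨x, y, h, -, hx, hy, hxy⟩ := tZero_facts
  obtain ⟨x', y', h', hx', hy', hxy'⟩ := hZero_facts
  have : tensor tZero hZero = ket ⟨x * x', 0⟩ ⟨x * y', 0⟩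
      ⟨√2 / 2 * (y * x'), √2 / 2 * (y * x')⟩ ⟨√2 / 2 * (y * y'), √2 / 2 * (y * y')⟩ := by
    rw [h, h']; ext ⟨p, q⟩
    fin_cases p <;> fin_cases q <;> simp [tensor, ket, Complex.ext_iff] <;> ring_nf
  rw [this]
  have h2 := two_sqrt_mul_self
  refine ⟨isState_ket (by grind), ?_⟩
  rw [cs_ket]
  refine exists_special_signedConj 4 ![0, 3, 4, 5, 2, 1] ![1, 1, -1, -1, -1, 1] (-1) (by decide)
    (by simp [Fin.forall_fin_succ]) (by decide +kernel) (by simp [Fin.prod_univ_six]) ?_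
  simp [rowForm, antisymm, inv_sqrt_two, inv_sqrt_three, inv_sqrt_six]
  grind

lemma hasRow_tZero_tZero : HasRow (tensor tZero tZero) 5 := by
  obtain ⟨x, y, h, -, hx, hy, hxy⟩ := tZero_facts
  have h2 := two_sqrt_mul_self
  have h3 := three_sqrt_mul_self
  have : tensor tZero tZero = ket ⟨(3 + √3) / 6, 0⟩ ⟨√3 / 6, √3 / 6⟩ ⟨√3 / 6, √3 / 6⟩
      ⟨0, (3 - √3) / 6⟩ := by
    rw [h]; ext ⟨p, q⟩
    fin_cases p <;> fin_cases q <;> simp [tensor, ket, Complex.ext_iff] <;> grind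
  rw [this]
  refine ⟨isState_ket (by grind), ?_⟩
  rw [cs_ket]
  refine exists_special_signedConj 5 ![0, 3, 5, 4, 2, 1] ![1, 1, -1, 1, -1, 1] 1 (by decide)
    (by simp [Fin.forall_fin_succ]) (by decide +kernel) (by simp [Fin.prod_univ_six]) ?_
  simp [rowForm, antisymm, inv_sqrt_three]
  grind

lemma hasRow_tMinus : HasRow tMinus 6 := by
  obtain ⟨x, y, h, h', hx, hy, hxy⟩ := tZero_facts
  have h2 := two_sqrt_mul_self
  have h3 := three_sqrt_mul_self
  have : tMinus = ket ⟨√2 * √3 / 6, 0⟩ ⟨√2 * √3 / 6, √2 * √3 / 6⟩ ⟨√2 * √3 / 6, √2 * √3 / 6⟩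
      ⟨0, -(√2 * √3 / 6)⟩ := by
    rw [tMinus, h, h']; ext ⟨p, q⟩
    fin_cases p <;> fin_cases q <;>
      simp [tensor, ket, Complex.ext_iff, inv_sqrt_two] <;> grind
  rw [this]
  refine ⟨isState_ket (by grind), ?_⟩
  rw [cs_ket]
  refine exists_special_signedConj 6 ![0, 1, 3, 5, 4, 2] ![1, 1, 1, 1, -1, -1] 1 (by decide)
    (by simp [Fin.forall_fin_succ]) (by decide +kernel) (by simp [Fin.prod_univ_six]) ?_
  simp [rowForm, antisymm]
  grind

lemma smul_ket (k : ℝ) (a b c d : ℂ) :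
    (k : ℂ) • ket a b c d = ket (k * a) (k * b) (k * c) (k * d) := by
  ext ⟨p, q⟩; fin_cases p <;> fin_cases q <;> simp [ket]

lemma hasRow_g4two : HasRow g4two 6 := by
  obtain ⟨k, hk⟩ : ∃ k, k = 1 / √6 := ⟨_, rfl⟩
  have hk2 : k * k = 1 / 6 := by
    rw [hk, ← mul_div_mul_comm, Real.mul_self_sqrt (by norm_num)]; norm_num
  have : g4two = ket ⟨2 * k, 0⟩ ⟨k, 0⟩ ⟨k, 0⟩ ⟨0, 0⟩ := by
    rw [g4two, ← hk, smul_ket]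
    congr <;> simp [Complex.ext_iff, mul_comm]
  rw [this]
  refine ⟨isState_ket (by grind), ?_⟩
  rw [cs_ket]
  refine exists_special_signedConj 6 ![0, 2, 4, 3, 5, 1] ![1, 1, -1, 1, 1, 1] (-1) (by decide)
    (by simp [Fin.forall_fin_succ]) (by decide +kernel) (by simp [Fin.prod_univ_six]) ?_
  simp [rowForm, antisymm]
  grind

lemma one_div_two_sqrt_sq (n : ℝ) (hn : 0 < n) :
    (1 / (2 * √n)) * (1 / (2 * √n)) = 1 / (4 * n) := by
  rw [← mul_div_mul_comm, mul_mul_mul_comm, Real.mul_self_sqrt hn.le]; norm_num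

lemma hasRow_g20one : HasRow g20one 8 := by
  obtain ⟨k, hk⟩ : ∃ k, k = 1 / (2 * √2) := ⟨_, rfl⟩
  have hk2 : k * k = 1 / (4 * 2) := by rw [hk]; exact one_div_two_sqrt_sq 2 (by norm_num)
  have : g20one = ket ⟨0, k⟩ ⟨0, -k⟩ ⟨-k, -(2 * k)⟩ ⟨k, 0⟩ := by
    rw [g20one, ← hk, smul_ket]
    congr <;> simp [Complex.ext_iff, mul_comm]
  rw [this]
  refine ⟨isState_ket (by grind), ?_⟩
  rw [cs_ket]
  refine exists_special_signedConj 8 ![0, 2, 1, 4, 3, 5] ![1, -1, 1, 1, 1, -1] 1 (by decide)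
    (by simp [Fin.forall_fin_succ]) (by decide +kernel) (by simp [Fin.prod_univ_six]) ?_
  simp [rowForm, antisymm]
  grind

lemma hasRow_g20two : HasRow g20two 8 := by
  obtain ⟨k, hk⟩ : ∃ k, k = 1 / (2 * √10) := ⟨_, rfl⟩
  have hk2 : k * k = 1 / (4 * 10) := by rw [hk]; exact one_div_two_sqrt_sq 10 (by norm_num)
  have : g20two = ket ⟨-(2 * k), k⟩ ⟨-(2 * k), k⟩ ⟨k, 2 * k⟩ ⟨5 * k, 0⟩ := by
    rw [g20two, ← hk, smul_ket]
    congr <;> simp [Complex.ext_iff, mul_comm]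
  rw [this]
  refine ⟨isState_ket (by grind), ?_⟩
  rw [cs_ket]
  refine exists_special_signedConj 8 ![0, 2, 1, 5, 3, 4] ![1, 1, 1, 1, 1, -1] (-1) (by decide)
    (by simp [Fin.forall_fin_succ]) (by decide +kernel) (by simp [Fin.prod_univ_six]) ?_
  simp [rowForm, antisymm]
  grind

lemma hasRow_g20three : HasRow g20three 8 := by
  obtain ⟨k, hk⟩ : ∃ k, k = 1 / (2 * √2) := ⟨_, rfl⟩
  have hk2 : k * k = 1 / (4 * 2) := by rw [hk]; exact one_div_two_sqrt_sq 2 (by norm_num)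
  have : g20three = ket ⟨0, -k⟩ ⟨2 * k, k⟩ ⟨-k, 0⟩ ⟨k, 0⟩ := by
    rw [g20three, ← hk, smul_ket]
    congr <;> simp [Complex.ext_iff, mul_comm]
  rw [this]
  refine ⟨isState_ket (by grind), ?_⟩
  rw [cs_ket]
  refine exists_special_signedConj 8 ![0, 2, 1, 5, 3, 4] ![1, 1, -1, -1, -1, 1] (-1) (by decide)
    (by simp [Fin.forall_fin_succ]) (by decide +kernel) (by simp [Fin.prod_univ_six]) ?_
  simp [rowForm, antisymm]
  grind

lemma hasRow_g20four : HasRow g20four 8 := by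
  obtain ⟨k, hk⟩ : ∃ k, k = 1 / (2 * √2) := ⟨_, rfl⟩
  have hk2 : k * k = 1 / (4 * 2) := by rw [hk]; exact one_div_two_sqrt_sq 2 (by norm_num)
  have : g20four = ket ⟨2 * k, -k⟩ ⟨0, -k⟩ ⟨k, 0⟩ ⟨k, 0⟩ := by
    rw [g20four, ← hk, smul_ket]
    congr <;> simp [Complex.ext_iff, mul_comm]
  rw [this]
  refine ⟨isState_ket (by grind), ?_⟩
  rw [cs_ket]
  refine exists_special_signedConj 8 ![0, 2, 1, 4, 3, 5] ![1, -1, -1, -1, -1, 1] 1 (by decide)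
    (by simp [Fin.forall_fin_succ]) (by decide +kernel) (by simp [Fin.prod_univ_six]) ?_
  simp [rowForm, antisymm]
  grind

/-! ### The states of the eighth row -/

/-- The real numbers `u = √5`, `v = √(10 + 2√5)`, `w = √(10 - 2√5)`, which span the field of
`√(10 + 2√5)`, and the moduli of the amplitudes of the states in row eight. -/
structure PentagonNumbers (u v w A B C D : ℝ) : Prop where
  u_eq : u = √5
  v_eq : v = √(10 + 2 * √5)
  w_eq : w = √(10 - 2 * √5)
  A_eq : A = √((5 - u - w) / 20)
  B_eq : B = √((5 + u - v) / 20)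
  C_eq : C = √((5 - u + w) / 20)
  D_eq : D = √((5 + u + v) / 20)

namespace PentagonNumbers

variable {u v w A B C D : ℝ}

/-- Crude bounds are enough to make the radicands positive and to select the right root when squares
are compared. -/
lemma bounds (h : PentagonNumbers u v w A B C D) :
    2 < u ∧ u < 9 / 4 ∧ 7 / 2 < v ∧ v < 4 ∧ 0 < w ∧ w < 5 / 2 := by
  obtain ⟨rfl, rfl, rfl, -, -, -, -⟩ := h
  have h1 : (2 : ℝ) < √5 := Real.lt_sqrt_of_sq_lt (by norm_num)
  have h2 : √5 < 9 / 4 := by rw [Real.sqrt_lt' (by norm_num)]; norm_num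
  refine ⟨h1, h2, Real.lt_sqrt_of_sq_lt (by linarith), ?_, Real.sqrt_pos.mpr (by linarith), ?_⟩
  · rw [Real.sqrt_lt' (by norm_num)]; linarith
  · rw [Real.sqrt_lt' (by norm_num)]; linarith

lemma u_mul_u (h : PentagonNumbers u v w A B C D) : u * u = 5 := by
  rw [h.u_eq]; exact Real.mul_self_sqrt (by norm_num)

lemma v_mul_v (h : PentagonNumbers u v w A B C D) : v * v = 10 + 2 * u := by
  rw [h.v_eq, h.u_eq]; exact Real.mul_self_sqrt (by positivity)

lemma w_mul_w (h : PentagonNumbers u v w A B C D) : w * w = 10 - 2 * u := by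
  have := h.bounds
  rw [h.w_eq, ← h.u_eq]; exact Real.mul_self_sqrt (by linarith)

/-- Together with the products `u v` and `u w`, this makes the span of `1, u, v, w` closed under
multiplication. Polynomial identities in these numbers then become linear in their products. -/
lemma v_mul_w (h : PentagonNumbers u v w A B C D) : v * w = 4 * u := by
  obtain ⟨h1, h2, h3, h4, h5, h6⟩ := h.bounds
  have : (v * w) ^ 2 = (4 * u) ^ 2 := by
    linear_combination w * w * h.v_mul_v + (10 + 2 * u) * h.w_mul_w - 20 * h.u_mul_u
  exact (pow_left_inj₀ (by positivity) (by positivity) two_ne_zero).mp this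

lemma u_mul_v (h : PentagonNumbers u v w A B C D) : u * v = v + 2 * w := by
  obtain ⟨h1, h2, h3, h4, h5, h6⟩ := h.bounds
  apply mul_left_cancel₀ (show v ≠ 0 by positivity)
  linear_combination (u - 1) * h.v_mul_v - 2 * h.v_mul_w + 2 * h.u_mul_u

lemma u_mul_w (h : PentagonNumbers u v w A B C D) : u * w = 2 * v - w := by
  obtain ⟨h1, h2, h3, h4, h5, h6⟩ := h.bounds
  apply mul_left_cancel₀ (show w ≠ 0 by positivity)
  linear_combination (u + 1) * h.w_mul_w - 2 * h.v_mul_w - 2 * h.u_mul_u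

lemma A_pos (h : PentagonNumbers u v w A B C D) : 0 < A := by
  obtain ⟨h1, h2, h3, h4, h5, h6⟩ := h.bounds
  rw [h.A_eq]; exact Real.sqrt_pos.mpr (by linarith)

lemma B_pos (h : PentagonNumbers u v w A B C D) : 0 < B := by
  obtain ⟨h1, h2, h3, h4, h5, h6⟩ := h.bounds
  rw [h.B_eq]; exact Real.sqrt_pos.mpr (by linarith)

lemma C_pos (h : PentagonNumbers u v w A B C D) : 0 < C := by
  obtain ⟨h1, h2, h3, h4, h5, h6⟩ := h.bounds
  rw [h.C_eq]; exact Real.sqrt_pos.mpr (by linarith)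

lemma D_pos (h : PentagonNumbers u v w A B C D) : 0 < D := by
  obtain ⟨h1, h2, h3, h4, h5, h6⟩ := h.bounds
  rw [h.D_eq]; exact Real.sqrt_pos.mpr (by linarith)

lemma A_mul_A (h : PentagonNumbers u v w A B C D) : A * A = (5 - u - w) / 20 := by
  obtain ⟨h1, h2, h3, h4, h5, h6⟩ := h.bounds
  rw [h.A_eq]; exact Real.mul_self_sqrt (by linarith)

lemma B_mul_B (h : PentagonNumbers u v w A B C D) : B * B = (5 + u - v) / 20 := by
  obtain ⟨h1, h2, h3, h4, h5, h6⟩ := h.bounds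
  rw [h.B_eq]; exact Real.mul_self_sqrt (by linarith)

lemma C_mul_C (h : PentagonNumbers u v w A B C D) : C * C = (5 - u + w) / 20 := by
  obtain ⟨h1, h2, h3, h4, h5, h6⟩ := h.bounds
  rw [h.C_eq]; exact Real.mul_self_sqrt (by linarith)

lemma D_mul_D (h : PentagonNumbers u v w A B C D) : D * D = (5 + u + v) / 20 := by
  obtain ⟨h1, h2, h3, h4, h5, h6⟩ := h.bounds
  rw [h.D_eq]; exact Real.mul_self_sqrt (by linarith)

lemma A_mul_C (h : PentagonNumbers u v w A B C D) : A * C = (v - w) / 20 := by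
  obtain ⟨h1, h2, h3, h4, h5, h6⟩ := h.bounds
  have hA := h.A_pos
  have hC := h.C_pos
  refine (pow_left_inj₀ (by positivity) (by linarith) two_ne_zero).mp ?_
  linear_combination C * C * h.A_mul_A + (5 - u - w) / 20 * h.C_mul_C + h.u_mul_u / 400 -
    h.w_mul_w / 200 - h.v_mul_v / 400 + h.v_mul_w / 200

lemma B_mul_D (h : PentagonNumbers u v w A B C D) : B * D = (v + w) / 20 := by
  obtain ⟨h1, h2, h3, h4, h5, h6⟩ := h.bounds
  have hA := h.B_pos
  have hC := h.D_pos
  refine (pow_left_inj₀ (by positivity) (by linarith) two_ne_zero).mp ?_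
  linear_combination D * D * h.B_mul_B + (5 + u - v) / 20 * h.D_mul_D + h.u_mul_u / 400 -
    h.w_mul_w / 400 - h.v_mul_v / 200 - h.v_mul_w / 200

lemma sqrt_two_mul_eq {x y z x' y' : ℝ} (hx : 0 ≤ x) (hy : 0 ≤ y) (hz : 0 ≤ z) (hx' : x * x = x')
    (hy' : y * y = y') (h : 2 * (x' * y') = z * z) : √2 * (x * y) = z := by
  refine (pow_left_inj₀ (by positivity) hz two_ne_zero).mp ?_
  rw [← hx', ← hy'] at h
  linear_combination h + (x * y) ^ 2 * two_sqrt_mul_self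

/-- The mixed products lie in the span of `u, v, w` only after multiplication by `√2`. The relative
phase `e^{iπ/4}` of the amplitudes supplies exactly this factor in the expectation values. -/
lemma A_mul_B (h : PentagonNumbers u v w A B C D) : √2 * (A * B) = (-2 * u + v + w) / 20 := by
  -- Positivity of `-2u + v + w` needs a better lower bound on `w` than the one in `bounds`.
  obtain ⟨h1, h2, h3, h4, h5, h6⟩ := h.bounds
  have h7 : 3 / 2 ≤ w := by
    rw [h.w_eq, ← h.u_eq]; exact Real.le_sqrt_of_sq_le (by linarith)
  refine sqrt_two_mul_eq h.A_pos.le h.B_pos.le (by linarith) h.A_mul_A h.B_mul_B ?_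
  linarith [h.u_mul_u, h.v_mul_v, h.w_mul_w, h.v_mul_w, h.u_mul_v, h.u_mul_w]

lemma A_mul_D (h : PentagonNumbers u v w A B C D) : √2 * (A * D) = (2 * u - v + w) / 20 := by
  obtain ⟨h1, h2, h3, h4, h5, h6⟩ := h.bounds
  refine sqrt_two_mul_eq h.A_pos.le h.D_pos.le (by linarith) h.A_mul_A h.D_mul_D ?_
  linarith [h.u_mul_u, h.v_mul_v, h.w_mul_w, h.v_mul_w, h.u_mul_v, h.u_mul_w]

lemma B_mul_C (h : PentagonNumbers u v w A B C D) : √2 * (B * C) = (2 * u + v - w) / 20 := by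
  obtain ⟨h1, h2, h3, h4, h5, h6⟩ := h.bounds
  refine sqrt_two_mul_eq h.B_pos.le h.C_pos.le (by linarith) h.B_mul_B h.C_mul_C ?_
  linarith [h.u_mul_u, h.v_mul_v, h.w_mul_w, h.v_mul_w, h.u_mul_v, h.u_mul_w]

lemma C_mul_D (h : PentagonNumbers u v w A B C D) : √2 * (C * D) = (2 * u + v + w) / 20 := by
  obtain ⟨h1, h2, h3, h4, h5, h6⟩ := h.bounds
  refine sqrt_two_mul_eq h.C_pos.le h.D_pos.le (by linarith) h.C_mul_C h.D_mul_D ?_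
  linarith [h.u_mul_u, h.v_mul_v, h.w_mul_w, h.v_mul_w, h.u_mul_v, h.u_mul_w]

end PentagonNumbers

lemma fourthRoot_div {x x' y : ℝ} (hx : 0 ≤ x) (h : x * x = x') (hy : 10 * x' * (10 * x') = y) :
    fourthRoot y / √10 = x := by
  have hx' : 0 ≤ x' := by rw [← h]; positivity
  rw [fourthRoot, ← hy, Real.sqrt_mul_self (by positivity), Real.sqrt_mul (by norm_num), ← h,
    Real.sqrt_mul_self hx, mul_div_cancel_left₀ _ (by positivity)]

lemma one_div_sqrt_eq {x x' y : ℝ} (hx : 0 < x) (h : x * x = x') (hy : x' * y = 1) :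
    1 / √y = x := by
  have hy' : y = x⁻¹ * x⁻¹ := by
    rw [← h] at hy
    field_simp
    linarith
  rw [hy', Real.sqrt_mul_self (by positivity), one_div, inv_inv]

lemma half_sqrt_eq {x x' y : ℝ} (hx : 0 ≤ x) (h : x * x = x') (hy : 4 * x' = y) :
    1 / 2 * √y = x := by
  rw [← hy, ← h, show 4 * (x * x) = (2 * x) * (2 * x) by ring, Real.sqrt_mul_self (by positivity)]
  ring

namespace PentagonNumbers

variable {u v w A B C D : ℝ}

lemma sqrt_add (h : PentagonNumbers u v w A B C D) : √(5 + 2 * √5) = (v + w) / 2 := by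
  obtain ⟨h1, h2, h3, h4, h5, h6⟩ := h.bounds
  rw [← h.u_eq, show 5 + 2 * u = (v + w) / 2 * ((v + w) / 2) by
    linarith [h.v_mul_v, h.w_mul_w, h.v_mul_w], Real.sqrt_mul_self (by linarith)]

lemma sqrt_sub (h : PentagonNumbers u v w A B C D) : √(5 - 2 * √5) = (v - w) / 2 := by
  obtain ⟨h1, h2, h3, h4, h5, h6⟩ := h.bounds
  rw [← h.u_eq, show 5 - 2 * u = (v - w) / 2 * ((v - w) / 2) by
    linarith [h.v_mul_v, h.w_mul_w, h.v_mul_w], Real.sqrt_mul_self (by linarith)]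

lemma inv_sqrt_five (h : PentagonNumbers u v w A B C D) : (√5)⁻¹ = u / 5 := by
  obtain ⟨h1, h2, h3, h4, h5, h6⟩ := h.bounds
  rw [← h.u_eq, inv_eq_iff_eq_inv, inv_div, eq_div_iff (by positivity)]; exact h.u_mul_u

lemma sqrt_five_mul_add (h : PentagonNumbers u v w A B C D) :
    √(5 * (5 + 2 * √5)) = (3 * v + w) / 2 := by
  obtain ⟨h1, h2, h3, h4, h5, h6⟩ := h.bounds
  rw [Real.sqrt_mul (by norm_num), h.sqrt_add, ← h.u_eq]
  linarith [h.u_mul_v, h.u_mul_w]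

lemma sqrt_five_mul_sub (h : PentagonNumbers u v w A B C D) :
    √(5 * (5 - 2 * √5)) = (3 * w - v) / 2 := by
  obtain ⟨h1, h2, h3, h4, h5, h6⟩ := h.bounds
  rw [Real.sqrt_mul (by norm_num), h.sqrt_sub, ← h.u_eq]
  linarith [h.u_mul_v, h.u_mul_w]

lemma sqrt_gamma (h : PentagonNumbers u v w A B C D) : √(250 + 110 * √5) = 4 * v + 3 * w := by
  obtain ⟨h1, h2, h3, h4, h5, h6⟩ := h.bounds
  rw [← h.u_eq, show 250 + 110 * u = (4 * v + 3 * w) * (4 * v + 3 * w) by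
    linarith [h.v_mul_v, h.w_mul_w, h.v_mul_w], Real.sqrt_mul_self (by linarith)]

/-- The nine constants in the amplitudes take only four values: `A = β₋ = γ₊`, `B = α₋ = δ₋`, `C =
β₊ = γ₋ = ε` and `D = α₊ = δ₊`. The four states of the row distribute the same moduli differently.
-/
lemma alpha_neg (h : PentagonNumbers u v w A B C D) :
    fourthRoot (10 + 3 * √5 - 2 * √(5 * (5 + 2 * √5))) / √10 = B := by
  refine fourthRoot_div h.B_pos.le h.B_mul_B ?_
  rw [h.sqrt_five_mul_add, ← h.u_eq]
  linarith [h.u_mul_u, h.v_mul_v, h.w_mul_w, h.v_mul_w, h.u_mul_v, h.u_mul_w]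

lemma alpha_pos (h : PentagonNumbers u v w A B C D) :
    fourthRoot (10 + 3 * √5 + 2 * √(5 * (5 + 2 * √5))) / √10 = D := by
  refine fourthRoot_div h.D_pos.le h.D_mul_D ?_
  rw [h.sqrt_five_mul_add, ← h.u_eq]
  linarith [h.u_mul_u, h.v_mul_v, h.w_mul_w, h.v_mul_w, h.u_mul_v, h.u_mul_w]

lemma beta_neg (h : PentagonNumbers u v w A B C D) :
    fourthRoot (10 - 3 * √5 - 2 * √(5 * (5 - 2 * √5))) / √10 = A := by
  refine fourthRoot_div h.A_pos.le h.A_mul_A ?_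
  rw [h.sqrt_five_mul_sub, ← h.u_eq]
  linarith [h.u_mul_u, h.v_mul_v, h.w_mul_w, h.v_mul_w, h.u_mul_v, h.u_mul_w]

lemma beta_pos (h : PentagonNumbers u v w A B C D) :
    fourthRoot (10 - 3 * √5 + 2 * √(5 * (5 - 2 * √5))) / √10 = C := by
  refine fourthRoot_div h.C_pos.le h.C_mul_C ?_
  rw [h.sqrt_five_mul_sub, ← h.u_eq]
  linarith [h.u_mul_u, h.v_mul_v, h.w_mul_w, h.v_mul_w, h.u_mul_v, h.u_mul_w]

lemma gamma_pos (h : PentagonNumbers u v w A B C D) :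
    1 / √(5 * (3 + √5) + √(250 + 110 * √5)) = A := by
  refine one_div_sqrt_eq h.A_pos h.A_mul_A ?_
  rw [h.sqrt_gamma, ← h.u_eq]
  linarith [h.u_mul_u, h.v_mul_v, h.w_mul_w, h.v_mul_w, h.u_mul_v, h.u_mul_w]

lemma gamma_neg (h : PentagonNumbers u v w A B C D) :
    1 / √(5 * (3 + √5) - √(250 + 110 * √5)) = C := by
  refine one_div_sqrt_eq h.C_pos h.C_mul_C ?_
  rw [h.sqrt_gamma, ← h.u_eq]
  linarith [h.u_mul_u, h.v_mul_v, h.w_mul_w, h.v_mul_w, h.u_mul_v, h.u_mul_w]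

lemma delta_pos (h : PentagonNumbers u v w A B C D) :
    1 / 2 * √((5 + √5 + √(2 * (5 + √5))) / 5) = D := by
  refine half_sqrt_eq h.D_pos.le h.D_mul_D ?_
  rw [show 2 * (5 + √5) = 10 + 2 * √5 by ring, ← h.v_eq, ← h.u_eq]
  ring

lemma delta_neg (h : PentagonNumbers u v w A B C D) :
    1 / 2 * √(1 + 1 / √5 - 1 / 5 * √(2 * (5 + √5))) = B := by
  refine half_sqrt_eq h.B_pos.le h.B_mul_B ?_
  rw [show 2 * (5 + √5) = 10 + 2 * √5 by ring, ← h.v_eq, one_div, h.inv_sqrt_five]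
  ring

lemma epsilon (h : PentagonNumbers u v w A B C D) :
    1 / 2 * √((5 - √5 + √(10 - 2 * √5)) / 5) = C := by
  refine half_sqrt_eq h.C_pos.le h.C_mul_C ?_
  rw [← h.w_eq, ← h.u_eq]
  ring

end PentagonNumbers

lemma exists_pentagonNumbers : ∃ u v w A B C D, PentagonNumbers u v w A B C D :=
  ⟨_, _, _, _, _, _, _, rfl, rfl, rfl, rfl, rfl, rfl, rfl⟩

lemma ket_phase (x y z t : ℝ) : ket (x * phase) (y * phase) (Complex.I * z) t =
    ket ⟨√2 / 2 * x, √2 / 2 * x⟩ ⟨√2 / 2 * y, √2 / 2 * y⟩ ⟨0, z⟩ ⟨t, 0⟩ := by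
  rw [phase_eq]
  congr <;> simp [Complex.ext_iff, mul_comm]

lemma cs_ket_phase (x y z t : ℝ) : cs (ket (x * phase) (y * phase) (Complex.I * z) t) = antisymm
    (√2 * (x * z) + √2 * (y * t)) (√2 * (x * t) - √2 * (y * z)) (-√2 * (x * t) + √2 * (y * z))
    (√2 * (x * z) + √2 * (y * t)) (x * x + y * y - z * z - t * t) (-2 * (z * t)) (2 * (x * y))
    (x * x - y * y - z * z + t * t) (-√2 * (x * z) + √2 * (y * t)) (x * x - y * y + z * z - t * t)
    (-2 * (x * y)) (√2 * (x * t) + √2 * (y * z)) (2 * (z * t)) (√2 * (x * t) + √2 * (y * z))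
    (√2 * (x * z) - √2 * (y * t)) := by
  have h2 := two_sqrt_mul_self
  rw [ket_phase, cs_ket]
  congr 1 <;> grind

lemma isState_ket_phase {x y z t : ℝ} (h : x * x + y * y + z * z + t * t = 1) :
    IsState (ket (x * phase) (y * phase) (Complex.I * z) t) := by
  have h2 := two_sqrt_mul_self
  rw [ket_phase]
  exact isState_ket (by grind)

lemma hasRow_g16one : HasRow g16one 7 := by
  obtain ⟨u, v, w, A, B, C, D, h⟩ := exists_pentagonNumbers
  have : g16one = ket ((-B : ℝ) * phase) (D * phase) (Complex.I * A) C := by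
    rw [g16one, h.alpha_neg, h.alpha_pos, h.gamma_pos, h.gamma_neg]; push_cast; rfl
  rw [this]
  refine ⟨isState_ket_phase (by linarith [h.A_mul_A, h.B_mul_B, h.C_mul_C, h.D_mul_D]), ?_⟩
  rw [cs_ket_phase]
  refine exists_special_signedConj 7 ![5, 0, 3, 4, 2, 1] ![1, -1, 1, -1, -1, -1] 1 (by decide)
    (by simp [Fin.forall_fin_succ]) (by decide +kernel) (by simp [Fin.prod_univ_six]) ?_
  simp [rowForm, antisymm, h.sqrt_add, h.sqrt_sub, h.inv_sqrt_five]
  refine ⟨⟨?_, ?_, ?_, ?_, ?_⟩, ⟨?_, ?_, ?_, ?_⟩, ⟨?_, ?_, ?_⟩, ⟨?_, ?_⟩, ?_⟩ <;>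
    linarith [h.A_mul_A, h.B_mul_B, h.C_mul_C, h.D_mul_D, h.A_mul_B, h.A_mul_C, h.A_mul_D,
      h.B_mul_C, h.B_mul_D, h.C_mul_D]

lemma hasRow_g16two : HasRow g16two 7 := by
  obtain ⟨u, v, w, A, B, C, D, h⟩ := exists_pentagonNumbers
  have : g16two = ket ((-A : ℝ) * phase) ((-C : ℝ) * phase) (Complex.I * D) B := by
    rw [g16two, h.beta_neg, h.beta_pos, h.delta_pos, h.delta_neg]; push_cast; rfl
  rw [this]
  refine ⟨isState_ket_phase (by linarith [h.A_mul_A, h.B_mul_B, h.C_mul_C, h.D_mul_D]), ?_⟩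
  rw [cs_ket_phase]
  refine exists_special_signedConj 7 ![5, 0, 1, 3, 4, 2] ![1, 1, -1, 1, 1, 1] (-1) (by decide)
    (by simp [Fin.forall_fin_succ]) (by decide +kernel) (by simp [Fin.prod_univ_six]) ?_
  simp [rowForm, antisymm, h.sqrt_add, h.sqrt_sub, h.inv_sqrt_five]
  refine ⟨⟨?_, ?_, ?_, ?_, ?_⟩, ⟨?_, ?_, ?_, ?_⟩, ⟨?_, ?_, ?_⟩, ⟨?_, ?_⟩, ?_⟩ <;>
    linarith [h.A_mul_A, h.B_mul_B, h.C_mul_C, h.D_mul_D, h.A_mul_B, h.A_mul_C, h.A_mul_D,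
      h.B_mul_C, h.B_mul_D, h.C_mul_D]

lemma hasRow_g16three : HasRow g16three 7 := by
  obtain ⟨u, v, w, A, B, C, D, h⟩ := exists_pentagonNumbers
  have : g16three = ket (C * phase) ((-A : ℝ) * phase) (Complex.I * (-B : ℝ)) D := by
    rw [g16three, h.beta_neg, h.beta_pos, h.delta_pos, h.delta_neg]; push_cast
    rw [mul_neg, neg_mul Complex.I]
  rw [this]
  refine ⟨isState_ket_phase (by linarith [h.A_mul_A, h.B_mul_B, h.C_mul_C, h.D_mul_D]), ?_⟩
  rw [cs_ket_phase]
  refine exists_special_signedConj 7 ![5, 0, 4, 2, 1, 3] ![1, 1, -1, 1, 1, 1] (-1) (by decide)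
    (by simp [Fin.forall_fin_succ]) (by decide +kernel) (by simp [Fin.prod_univ_six]) ?_
  simp [rowForm, antisymm, h.sqrt_add, h.sqrt_sub, h.inv_sqrt_five]
  refine ⟨⟨?_, ?_, ?_, ?_, ?_⟩, ⟨?_, ?_, ?_, ?_⟩, ⟨?_, ?_, ?_⟩, ⟨?_, ?_⟩, ?_⟩ <;>
    linarith [h.A_mul_A, h.B_mul_B, h.C_mul_C, h.D_mul_D, h.A_mul_B, h.A_mul_C, h.A_mul_D,
      h.B_mul_C, h.B_mul_D, h.C_mul_D]

lemma hasRow_g16four : HasRow g16four 7 := by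
  obtain ⟨u, v, w, A, B, C, D, h⟩ := exists_pentagonNumbers
  have : g16four = ket ((-D : ℝ) * phase) ((-B : ℝ) * phase) (Complex.I * (-C : ℝ)) A := by
    rw [g16four, h.alpha_neg, h.alpha_pos, h.gamma_pos, h.epsilon]; push_cast
    rw [mul_neg, neg_mul Complex.I]
  rw [this]
  refine ⟨isState_ket_phase (by linarith [h.A_mul_A, h.B_mul_B, h.C_mul_C, h.D_mul_D]), ?_⟩
  rw [cs_ket_phase]
  refine exists_special_signedConj 7 ![5, 0, 2, 1, 3, 4] ![1, -1, 1, -1, -1, -1] 1 (by decide)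
    (by simp [Fin.forall_fin_succ]) (by decide +kernel) (by simp [Fin.prod_univ_six]) ?_
  simp [rowForm, antisymm, h.sqrt_add, h.sqrt_sub, h.inv_sqrt_five]
  refine ⟨⟨?_, ?_, ?_, ?_, ?_⟩, ⟨?_, ?_, ?_, ?_⟩, ⟨?_, ?_, ?_⟩, ⟨?_, ?_⟩, ?_⟩ <;>
    linarith [h.A_mul_A, h.B_mul_B, h.C_mul_C, h.D_mul_D, h.A_mul_B, h.A_mul_C, h.A_mul_D,
      h.B_mul_C, h.B_mul_D, h.C_mul_D]

theorem hasRow_of_mem_tableStates {i : Fin 9} {ψ : Ket} (h : ψ ∈ tableStates i) : HasRow ψ i := by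
  fin_cases i <;> simp [tableStates] at h
  · rw [h]; exact hasRow_zero_zero
  · rw [h]; exact hasRow_hZero_zero
  · rw [h]; exact hasRow_tZero_zero
  · rw [h]; exact hasRow_hZero_hZero
  · rw [h]; exact hasRow_tZero_hZero
  · rw [h]; exact hasRow_tZero_tZero
  · rcases h with rfl | rfl
    · exact hasRow_tMinus
    · exact hasRow_g4two
  · rcases h with rfl | rfl | rfl | rfl
    · exact hasRow_g16one
    · exact hasRow_g16two
    · exact hasRow_g16three
    · exact hasRow_g16four
  · rcases h with rfl | rfl | rfl | rfl
    · exact hasRow_g20one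
    · exact hasRow_g20two
    · exact hasRow_g20three
    · exact hasRow_g20four

/-! ### Stabilizer states -/

lemma IsClifford.conjTranspose {C : Op} (hC : IsClifford C) : IsClifford Cᴴ := by
  refine ⟨Unitary.star_mem hC.1, fun P hP => ?_⟩
  obtain ⟨Q, hQ, rfl⟩ := hC.exists_preimage hP
  rw [conjTranspose_conjTranspose, Matrix.mul_assoc C, ← Matrix.mul_assoc Cᴴ C,
    conjTranspose_mul_of_unitary hC.1, Matrix.one_mul, Matrix.mul_assoc,
    conjTranspose_mul_of_unitary hC.1, Matrix.mul_one]
  exact hQ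

lemma IsStabilizerState.mulVec {C : Op} (hC : IsClifford C) {s : Ket} (hs : IsStabilizerState s) :
    IsStabilizerState (C *ᵥ s) := by
  obtain ⟨hs, S, hP, hcomm, hcard, hfix⟩ := hs
  refine ⟨hs.mulVec hC.1, ?_⟩
  let U : unitaryGroup (Fin 2 × Fin 2) ℂ := ⟨C, hC.1⟩
  refine ⟨S.map (MulAut.conj U).toMonoidHom, ?_, ?_, ?_, ?_⟩
  · rintro _ ⟨g, hg, rfl⟩
    exact hC.2 _ (hP g hg)
  · rintro _ ⟨g, hg, rfl⟩ _ ⟨h, hh, rfl⟩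
    rw [← map_mul, ← map_mul, hcomm g hg h hh]
  · rw [← hcard]
    exact Nat.card_congr (S.equivMapOfInjective _ (MulAut.conj U).injective).toEquiv.symm
  · rintro _ ⟨g, hg, rfl⟩
    change (C * (g : Op) * Cᴴ) *ᵥ (C *ᵥ s) = C *ᵥ s
    rw [mulVec_mulVec, Matrix.mul_assoc, conjTranspose_mul_of_unitary hC.1, Matrix.mul_one,
      ← mulVec_mulVec, hfix g hg]

lemma toOp_injective : Function.Injective IntOp.toOp := by
  intro A B h
  ext p q
  · have := congrFun (congrFun h p) q
    exact congrArg Zsqrtd.re (GaussianInt.toComplex_inj.mp this)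
  · have := congrFun (congrFun h p) q
    exact congrArg Zsqrtd.im (GaussianInt.toComplex_inj.mp this)

lemma pauliInt_mem (x k a₁ a₂ b₁ b₂ : Fin 2) :
    IntOp.toOp (pauliInt x k a₁ a₂ b₁ b₂) ∈ pauliGroup :=
  mem_pauliGroup_iff.mpr ⟨x, k, a₁, a₂, b₁, b₂, rfl⟩

/-- The group generated by `Z ⊗ 1` and `1 ⊗ Z`. -/
def diagonalSubgroup : Subgroup (unitaryGroup (Fin 2 × Fin 2) ℂ) where
  carrier := {g | ∃ b₁ b₂, (g : Op) = IntOp.toOp (pauliInt 0 0 0 0 b₁ b₂)}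
  one_mem' := ⟨0, 0, by
    have : pauliInt 0 0 0 0 0 0 = 1 := by decide +kernel
    rw [this, map_one]; rfl⟩
  mul_mem' := by
    rintro g h ⟨b₁, b₂, hg⟩ ⟨c₁, c₂, hh⟩
    have key : ∀ b₁ b₂ c₁ c₂, ∃ d₁ d₂, pauliInt 0 0 0 0 b₁ b₂ * pauliInt 0 0 0 0 c₁ c₂ =
      pauliInt 0 0 0 0 d₁ d₂ := by decide +kernel
    obtain ⟨d₁, d₂, hd⟩ := key b₁ b₂ c₁ c₂
    refine ⟨d₁, d₂, ?_⟩
    rw [← hd, map_mul, ← hg, ← hh]; rfl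
  inv_mem' := by
    rintro g ⟨b₁, b₂, hg⟩
    have key : ∀ b₁ b₂, (pauliInt 0 0 0 0 b₁ b₂)ᴴ = pauliInt 0 0 0 0 b₁ b₂ := by decide +kernel
    refine ⟨b₁, b₂, ?_⟩
    change ((g : Op))ᴴ = _
    rw [hg, ← toOp_conjTranspose, key]

lemma isStabilizerState_zero_zero : IsStabilizerState (tensor zero zero) := by
  refine ⟨hasRow_zero_zero.1, diagonalSubgroup, ?_, ?_, ?_, ?_⟩
  · rintro g ⟨b₁, b₂, hg⟩
    rw [hg]; exact pauliInt_mem ..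
  · rintro g ⟨b₁, b₂, hg⟩ h ⟨c₁, c₂, hh⟩
    have key : ∀ b₁ b₂ c₁ c₂, pauliInt 0 0 0 0 b₁ b₂ * pauliInt 0 0 0 0 c₁ c₂ =
      pauliInt 0 0 0 0 c₁ c₂ * pauliInt 0 0 0 0 b₁ b₂ := by decide +kernel
    apply Subtype.ext
    change (g : Op) * h = h * g
    rw [hg, hh, ← map_mul, key, map_mul]
  · let f : Fin 2 × Fin 2 → diagonalSubgroup := fun b =>
      ⟨⟨IntOp.toOp (pauliInt 0 0 0 0 b.1 b.2), pauli_unitary _ (pauliInt_mem ..)⟩, b.1, b.2, rfl⟩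
    have hf : Function.Bijective f := by
      constructor
      · intro b c h
        have h1 : IntOp.toOp (pauliInt 0 0 0 0 b.1 b.2) = IntOp.toOp (pauliInt 0 0 0 0 c.1 c.2) :=
          congrArg (fun g : diagonalSubgroup => ((g : unitaryGroup (Fin 2 × Fin 2) ℂ) : Op)) h
        have key : ∀ b c : Fin 2 × Fin 2,
            pauliInt 0 0 0 0 b.1 b.2 = pauliInt 0 0 0 0 c.1 c.2 → b = c := by decide +kernel
        exact key b c (toOp_injective h1)
      · rintro ⟨g, b₁, b₂, hg⟩
        exact ⟨(b₁, b₂), Subtype.ext (Subtype.ext hg.symm)⟩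
    rw [← Nat.card_congr (Equiv.ofBijective f hf)]
    simp
  · rintro g ⟨b₁, b₂, hg⟩
    rw [hg]
    have key : ∀ b₁ b₂ p, pauliInt 0 0 0 0 b₁ b₂ p (0, 0) = if p = (0, 0) then 1 else 0 := by
      decide +kernel
    ext p
    rw [mulVec, dotProduct, sum_two_qubit]
    simp only [toOp_apply, key]
    fin_cases p <;> simp [tensor, zero]

/-! #### The complex structures of stabilizer states -/

/-- Modulo phases, the fifteen nontrivial Pauli operators correspond to the fifteen pairs of
coordinates. -/
lemma pauli_eq_smul_one_or_bil {P : Op} (hP : P ∈ pauliGroup) :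
    (∃ n : ℕ, P = Complex.I ^ n • (1 : Op)) ∨
      ∃ (n : ℕ) (i j : Fin 6), i ≠ j ∧ P = Complex.I ^ n • bil i j := by
  obtain ⟨n, a₁, a₂, b₁, b₂, rfl⟩ := exists_I_pow_of_mem_pauliGroup hP
  have key : ∀ a₁ a₂ b₁ b₂, pauliInt 0 0 a₁ a₂ b₁ b₂ = 1 ∨ ∃ (m : Fin 4) (i j : Fin 6), i ≠ j ∧
      pauliInt 0 0 a₁ a₂ b₁ b₂ = (⟨0, 1⟩ : GaussianInt) ^ (m : ℕ) • (gammaInt i * (gammaInt j)ᴴ) := by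
    decide +kernel
  rcases key a₁ a₂ b₁ b₂ with h | ⟨m, i, j, hij, h⟩
  · exact Or.inl ⟨n, by rw [h, map_one]⟩
  · refine Or.inr ⟨n + m, i, j, hij, ?_⟩
    have h2 : GaussianInt.toComplex ⟨0, 1⟩ = Complex.I := by simp [GaussianInt.toComplex_def]
    have h3 : ∀ (c : GaussianInt) (A : IntOp),
        IntOp.toOp (c • A) = GaussianInt.toComplex c • IntOp.toOp A := fun c A => by
      ext p q; simp [toOp_apply]
    rw [h, h3, map_pow, h2, ← bil_eq_toOp, smul_smul, pow_add]

/-- An operator fixing `s` has expectation value one. The phase in front of `bil i j` has modulus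
one, so the corresponding real entry is `±1`. -/
lemma sq_cs_eq_one {s : Ket} (hs : IsState s) {n : ℕ} {i j : Fin 6} (hij : i ≠ j)
    (h : (Complex.I ^ n • bil i j) *ᵥ s = s) : cs s i j ^ 2 = 1 := by
  have h1 : Complex.I ^ n * ev s (bil i j) = 1 := by
    rw [← ev_smul, ev, h]; exact hs
  have h2 := congrArg norm h1
  have h3 := congrArg norm (coe_cs s hij)
  simp only [norm_mul, norm_pow, Complex.norm_I, one_pow, one_mul, norm_one] at h2 h3
  rw [h2, Complex.norm_real] at h3
  rw [← sq_abs, ← Real.norm_eq_abs, h3, one_pow]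

lemma sum_sq_row {J : Matrix (Fin 6) (Fin 6) ℝ} (hT : Jᵀ = -J) (hJ : J * J = -1) (a : Fin 6) :
    ∑ x, J a x ^ 2 = 1 := by
  have h := congrFun (congrFun hJ a) a
  rw [mul_apply] at h
  have h2 : ∑ x, J a x * J x a = -∑ x, J a x ^ 2 := by
    rw [← Finset.sum_neg_distrib]
    exact Finset.sum_congr rfl fun x _ => by rw [apply_swap_of_transpose hT x a]; ring
  rw [h2] at h
  simpa using h

/-- The rows of `J` are unit vectors, so an entry `±1` leaves nothing for the rest of its row. -/
lemma eq_zero_of_sq_eq_one {J : Matrix (Fin 6) (Fin 6) ℝ} (hT : Jᵀ = -J) (hJ : J * J = -1)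
    {a b c : Fin 6} (hab : J a b ^ 2 = 1) (hc : c ≠ b) : J a c = 0 := by
  have h := sum_sq_row hT hJ a
  rw [← Finset.add_sum_erase _ _ (Finset.mem_univ b), hab] at h
  have h2 : ∑ x ∈ Finset.univ.erase b, J a x ^ 2 = 0 := by linarith
  rw [Finset.sum_eq_zero_iff_of_nonneg fun x _ => sq_nonneg _] at h2
  simpa using h2 c (by simp [hc])

lemma sq_swap {J : Matrix (Fin 6) (Fin 6) ℝ} (hT : Jᵀ = -J) (a b : Fin 6) :
    J b a ^ 2 = J a b ^ 2 := by
  rw [apply_swap_of_transpose hT b a]; ring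

/-- A stabilizer state gives two disjoint pairs with entries `±1`. -/
lemma IsStabilizerState.exists_pairs {s : Ket} (hs : IsStabilizerState s) :
    ∃ i j k l, i ≠ j ∧ k ≠ l ∧ i ≠ k ∧ i ≠ l ∧ j ≠ k ∧ j ≠ l ∧ cs s i j ^ 2 = 1 ∧
      cs s k l ^ 2 = 1 := by
  obtain ⟨hs, S, hP, -, hcard, hfix⟩ := hs
  have hs0 := ne_zero_of_isState hs
  have hscal : ∀ c : ℂ, c • s = s → c = 1 := by
    intro c hc
    have : (c - 1) • s = 0 := by rw [sub_smul, hc, one_smul, sub_self]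
    exact sub_eq_zero.mp ((smul_eq_zero.mp this).resolve_right hs0)
  have hfin : Finite S := Nat.finite_of_card_ne_zero (by omega)
  have := Fintype.ofFinite S
  classical
  -- A group of order four contains two distinct elements other than the identity.
  have h3 : 1 < (Finset.univ.erase (1 : S)).card := by
    rw [Finset.card_erase_of_mem (Finset.mem_univ _), Finset.card_univ, ← Nat.card_eq_fintype_card,
      hcard]; norm_num
  obtain ⟨⟨g, hg⟩, hg1, ⟨h, hh⟩, hh1, hgh⟩ := Finset.one_lt_card.mp h3
  have edge : ∀ g (hg : g ∈ S), (⟨g, hg⟩ : S) ∈ Finset.univ.erase (1 : S) →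
      ∃ (n : ℕ) (i j : Fin 6), i ≠ j ∧ (g : Op) = Complex.I ^ n • bil i j := by
    intro g hg hg1
    refine (pauli_eq_smul_one_or_bil (hP g hg)).resolve_left ?_
    rintro ⟨n, hn⟩
    have h1 := hfix g hg
    rw [hn, smul_mulVec, one_mulVec] at h1
    rw [hscal _ h1, one_smul] at hn
    exact (Finset.mem_erase.mp hg1).1 (Subtype.ext (Subtype.ext hn))
  obtain ⟨n, i, j, hij, hgb⟩ := edge g hg hg1
  obtain ⟨m, k, l, hkl, hhb⟩ := edge h hh hh1
  have hi := sq_cs_eq_one hs hij (by rw [← hgb]; exact hfix g hg)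
  have hk := sq_cs_eq_one hs hkl (by rw [← hhb]; exact hfix h hh)
  have hT := cs_transpose s
  have hJ := cs_mul_self hs
  -- Proportional Pauli operators that both fix `s` are equal, so `g` and `h` belong to different
  -- pairs. Pairs sharing just one coordinate are excluded by the unit rows.
  have hne : ∀ c : ℂ, bil k l ≠ c • bil i j := by
    intro c hc
    have h1 : (h : Op) = (Complex.I ^ m * c * (Complex.I ^ n)⁻¹) • (g : Op) := by
      rw [hhb, hgb, hc, smul_smul, smul_smul]
      congr 1
      have : Complex.I ^ n ≠ 0 := pow_ne_zero _ Complex.I_ne_zero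
      field_simp
    have h2 := hfix h hh
    rw [h1, smul_mulVec, hfix g hg] at h2
    rw [hscal _ h2, one_smul] at h1
    exact hgh (Subtype.ext (Subtype.ext h1.symm))
  have hcontra : ∀ {a b c : Fin 6}, cs s a b ^ 2 = 1 → cs s a c ^ 2 = 1 → b = c := by
    intro a b c hab hac
    by_contra hbc
    rw [eq_zero_of_sq_eq_one hT hJ hab (Ne.symm hbc)] at hac
    norm_num at hac
  have hi' := hi
  rw [← sq_swap hT] at hi'
  have hk' := hk
  rw [← sq_swap hT] at hk'
  refine ⟨i, j, k, l, hij, hkl, ?_, ?_, ?_, ?_, hi, hk⟩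
  · rintro rfl
    obtain rfl := hcontra hi hk
    exact hne 1 (one_smul _ _).symm
  · rintro rfl
    obtain rfl := hcontra hi hk'
    exact hne (-1) (by rw [bil_swap hij, neg_one_smul])
  · rintro rfl
    obtain rfl := hcontra hi' hk
    exact hne (-1) (by rw [bil_swap hij, neg_one_smul])
  · rintro rfl
    obtain rfl := hcontra hi' hk'
    exact hne 1 (one_smul _ _).symm

/-- The fifteen perfect matchings of six points, each given by an even permutation that maps the
pairs `01`, `23`, `45` to the pairs of the matching. -/
def matchPerm : Fin 15 → Equiv.Perm (Fin 6) :=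
  ![1, c[3, 4, 5], c[3, 5, 4], c[1, 2, 3], c[1, 2, 5], c[1, 2, 4], c[1, 3, 2], c[1, 3, 5],
    c[1, 3, 4], c[1, 4, 3], c[1, 4, 2], c[1, 4, 5], c[1, 5, 3], c[1, 5, 2], c[1, 5, 4]]

/-- Labels of the sixty stabilizer states: a matching and two signs. -/
abbrev StabilizerLabel : Type := Fin 15 × ℤˣ × ℤˣ

/-- The third sign is the product of the other two because a signed permutation between complex
structures of states has determinant one and `matchPerm` is even. -/
def labelSign (k : StabilizerLabel) : Fin 6 → ℤˣ := ![k.2.1, 1, k.2.2, 1, k.2.1 * k.2.2, 1]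

/-- The complex structure of a stabilizer state. -/
def labelForm (k : StabilizerLabel) : Matrix (Fin 6) (Fin 6) ℤ :=
  (k.2.1 : ℤ) • planeRotation (matchPerm k.1 0) (matchPerm k.1 1) +
    (k.2.2 : ℤ) • planeRotation (matchPerm k.1 2) (matchPerm k.1 3) +
    (k.2.1 * k.2.2 : ℤ) • planeRotation (matchPerm k.1 4) (matchPerm k.1 5)

lemma planeRotation_map {π : Equiv.Perm (Fin 6)} (a b i j : Fin 6) :
    planeRotation (π a) (π b) (π i) (π j) = planeRotation a b i j := by
  simp [planeRotation]

lemma signedConj_labelForm (k : StabilizerLabel) :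
    SignedConj (matchPerm k.1) (labelSign k) (rowForm 0) ((labelForm k).map Int.cast) := by
  obtain ⟨m, δ₁, δ₂⟩ := k
  intro i j
  have h : (rowForm 0) i j = ((planeRotation 0 1 + planeRotation 2 3 + planeRotation 4 5) i j : ℤ) := by
    fin_cases i <;> fin_cases j <;> simp [rowForm, antisymm, planeRotation]
  have key : ∀ (δ₁ δ₂ : ℤˣ) (i j : Fin 6), δ₁ * planeRotation 0 1 i j +
      δ₂ * planeRotation 2 3 i j + δ₁ * δ₂ * planeRotation 4 5 i j =
      ((![δ₁, 1, δ₂, 1, δ₁ * δ₂, 1] i * ![δ₁, 1, δ₂, 1, δ₁ * δ₂, 1] j : ℤˣ) : ℤ) *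
        (planeRotation 0 1 + planeRotation 2 3 + planeRotation 4 5) i j := by decide +kernel
  rw [h, map_apply, labelForm]
  simp only [Matrix.add_apply, Matrix.smul_apply, planeRotation_map, smul_eq_mul]
  exact_mod_cast key δ₁ δ₂ i j

lemma signedDet_label (k : StabilizerLabel) : signedDet (matchPerm k.1) (labelSign k) = 1 := by
  obtain ⟨m, δ₁, δ₂⟩ := k
  have h : ∀ m, Equiv.Perm.sign (matchPerm m) = 1 := by decide +kernel
  rw [signedDet, h, one_mul, Fin.prod_univ_six]
  simp [labelSign, mul_mul_mul_comm]

lemma HasRow.exists_clifford {ψ : Ket} {r : Fin 9} (h : HasRow ψ r) :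
    ∃ C, IsClifford C ∧ cs (C *ᵥ ψ) = rowForm r := by
  obtain ⟨hψ, π, ε, hdet, hsc⟩ := h
  obtain ⟨C, hC, hC'⟩ := realizable_of_signedDet hdet
  exact ⟨C, hC, (hC'.signedConj ψ).eq hsc⟩

lemma exists_stabilizerState (k : StabilizerLabel) :
    ∃ s, IsStabilizerState s ∧ cs s = (labelForm k).map Int.cast := by
  obtain ⟨C, hC, hCr⟩ := hasRow_zero_zero.exists_clifford
  obtain ⟨D, hD, hD'⟩ := realizable_of_signedDet (signedDet_label k)
  refine ⟨D *ᵥ (C *ᵥ tensor zero zero), (isStabilizerState_zero_zero.mulVec hC).mulVec hD, ?_⟩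
  have h := hD'.signedConj (C *ᵥ tensor zero zero)
  rw [hCr] at h
  exact h.eq (signedConj_labelForm k)

/-- The pair `ab` is one of the pairs `ij`, `kl`, or disjoint from both. -/
def Compatible (i j k l a b : Fin 6) : Prop :=
  (a = i ∧ b = j ∨ a = j ∧ b = i) ∨ (a = k ∧ b = l ∨ a = l ∧ b = k) ∨
    ((a ≠ i ∧ a ≠ j) ∧ (a ≠ k ∧ a ≠ l) ∧ ∀ x, x = b ∨ x = a ∨ (x = i ∨ x = j) ∨ x = k ∨ x = l)

instance (i j k l a b : Fin 6) : Decidable (Compatible i j k l a b) := by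
  unfold Compatible; infer_instance

/-- For the remaining pair, the two known pairs force every other entry in row `a` to vanish, so the
unit row puts `±1` at `b`. -/
lemma sq_eq_one_of_compatible {J : Matrix (Fin 6) (Fin 6) ℝ} (hT : Jᵀ = -J) (hJ : J * J = -1)
    {i j k l a b : Fin 6} (h1 : J i j ^ 2 = 1) (h2 : J k l ^ 2 = 1) (h : Compatible i j k l a b) :
    J a b ^ 2 = 1 := by
  have h1' := h1
  have h2' := h2
  rw [← sq_swap hT] at h1' h2'
  rcases h with (⟨rfl, rfl⟩ | ⟨rfl, rfl⟩) | (⟨rfl, rfl⟩ | ⟨rfl, rfl⟩) | ⟨⟨hi, hj⟩, ⟨hk, hl⟩, hx⟩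
  · exact h1
  · exact h1'
  · exact h2
  · exact h2'
  have h := sum_sq_row hT hJ a
  rwa [Finset.sum_eq_single b ?_ (by simp)] at h
  intro x _ hxb
  rw [sq_eq_zero_iff]
  rcases (hx x).resolve_left hxb with rfl | (rfl | rfl) | rfl | rfl
  · have := apply_swap_of_transpose hT x x
    linarith
  · rw [apply_swap_of_transpose hT, eq_zero_of_sq_eq_one hT hJ h1 hj, neg_zero]
  · rw [apply_swap_of_transpose hT, eq_zero_of_sq_eq_one hT hJ h1' hi, neg_zero]
  · rw [apply_swap_of_transpose hT, eq_zero_of_sq_eq_one hT hJ h2 hl, neg_zero]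
  · rw [apply_swap_of_transpose hT, eq_zero_of_sq_eq_one hT hJ h2' hk, neg_zero]

lemma signedConj_of_matching {J : Matrix (Fin 6) (Fin 6) ℝ} (hT : Jᵀ = -J) (hJ : J * J = -1)
    (τ : Equiv.Perm (Fin 6)) {δ₁ δ₂ δ₃ : ℤˣ} (h₁ : J (τ 0) (τ 1) = (δ₁ : ℤ))
    (h₂ : J (τ 2) (τ 3) = (δ₂ : ℤ)) (h₃ : J (τ 4) (τ 5) = (δ₃ : ℤ)) :
    SignedConj τ ![δ₁, 1, δ₂, 1, δ₃, 1] (rowForm 0) J := by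
  have sq : ∀ {a b : Fin 6} {δ : ℤˣ}, J a b = (δ : ℤ) → J a b ^ 2 = 1 := by
    intro a b δ h
    rw [h]; norm_cast; simp [Int.units_sq]
  have zero : ∀ {a b : Fin 6} {δ : ℤˣ}, J a b = (δ : ℤ) → (∀ c, c ≠ b → J a c = 0) ∧
      ∀ c, c ≠ a → J b c = 0 := fun h =>
    ⟨fun c => eq_zero_of_sq_eq_one hT hJ (sq h), fun c =>
      eq_zero_of_sq_eq_one hT hJ ((sq_swap hT _ _).trans (sq h))⟩
  have diag : ∀ a, J a a = 0 := fun a => by linarith [apply_swap_of_transpose hT a a]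
  have h₁' := apply_swap_of_transpose hT (τ 1) (τ 0)
  have h₂' := apply_swap_of_transpose hT (τ 3) (τ 2)
  have h₃' := apply_swap_of_transpose hT (τ 5) (τ 4)
  rw [h₁] at h₁'
  rw [h₂] at h₂'
  rw [h₃] at h₃'
  intro i j
  fin_cases i <;> fin_cases j <;>
    simp [rowForm, antisymm, h₁, h₂, h₃, h₁', h₂', h₃', diag, (zero h₁).1, (zero h₁).2, (zero h₂).1,
      (zero h₂).2, (zero h₃).1, (zero h₃).2]

lemma IsStabilizerState.exists_label {s : Ket} (hs : IsStabilizerState s) :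
    ∃ k : StabilizerLabel, cs s = (labelForm k).map Int.cast := by
  obtain ⟨i, j, k, l, hij, hkl, hik, hil, hjk, hjl, h1, h2⟩ := hs.exists_pairs
  have hT := cs_transpose s
  have hJ := cs_mul_self hs.1
  have key : ∀ i j k l : Fin 6, i ≠ j → k ≠ l → i ≠ k → i ≠ l → j ≠ k → j ≠ l → ∃ m : Fin 15,
      Compatible i j k l (matchPerm m 0) (matchPerm m 1) ∧
      Compatible i j k l (matchPerm m 2) (matchPerm m 3) ∧
      Compatible i j k l (matchPerm m 4) (matchPerm m 5) := by decide +kernel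
  obtain ⟨m, m1, m2, m3⟩ := key i j k l hij hkl hik hil hjk hjl
  have unit : ∀ {x : ℝ}, x ^ 2 = 1 → ∃ δ : ℤˣ, x = (δ : ℤ) := by
    intro x hx
    rcases mul_self_eq_one_iff.mp ((sq x).symm.trans hx) with rfl | rfl
    · exact ⟨1, by simp⟩
    · exact ⟨-1, by simp⟩
  obtain ⟨δ₁, h₁⟩ := unit (sq_eq_one_of_compatible hT hJ h1 h2 m1)
  obtain ⟨δ₂, h₂⟩ := unit (sq_eq_one_of_compatible hT hJ h1 h2 m2)
  obtain ⟨δ₃, h₃⟩ := unit (sq_eq_one_of_compatible hT hJ h1 h2 m3)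
  have hsc := signedConj_of_matching hT hJ _ h₁ h₂ h₃
  obtain ⟨C, hC, hCr⟩ := hasRow_zero_zero.exists_clifford
  -- Orientation now determines the third sign from the first two.
  have hdet := signedDet_eq_one (hasRow_zero_zero.1.mulVec hC.1) hs.1 (hCr ▸ hsc)
  have hsign : ∀ m, Equiv.Perm.sign (matchPerm m) = 1 := by decide +kernel
  rw [signedDet, hsign, one_mul, Fin.prod_univ_six] at hdet
  have hmul : ∀ a b c : ℤˣ, ![a, 1, b, 1, c, 1] 0 * ![a, 1, b, 1, c, 1] 1 * ![a, 1, b, 1, c, 1] 2 *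
      ![a, 1, b, 1, c, 1] 3 * ![a, 1, b, 1, c, 1] 4 * ![a, 1, b, 1, c, 1] 5 = 1 → c = a * b := by
    decide
  have h3 := hmul _ _ _ hdet
  subst h3
  exact ⟨(m, δ₁, δ₂), hsc.eq (signedConj_labelForm (m, δ₁, δ₂))⟩

/-! ### Clifford invariance of the stabilizer fidelity -/

lemma star_mulVec_dotProduct_mulVec {C : Op} (hC : C ∈ unitaryGroup (Fin 2 × Fin 2) ℂ) (ψ s : Ket) :
    star (C *ᵥ ψ) ⬝ᵥ (C *ᵥ s) = star ψ ⬝ᵥ s := by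
  rw [star_mulVec, ← dotProduct_mulVec, mulVec_mulVec, conjTranspose_mul_of_unitary hC, one_mulVec]

lemma conjTranspose_mulVec_mulVec {C : Op} (hC : C ∈ unitaryGroup (Fin 2 × Fin 2) ℂ) (ψ : Ket) :
    Cᴴ *ᵥ (C *ᵥ ψ) = ψ := by
  rw [mulVec_mulVec, conjTranspose_mul_of_unitary hC, one_mulVec]

lemma mulVec_conjTranspose_mulVec {C : Op} (hC : C ∈ unitaryGroup (Fin 2 × Fin 2) ℂ) (ψ : Ket) :
    C *ᵥ (Cᴴ *ᵥ ψ) = ψ := by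
  rw [mulVec_mulVec, mul_conjTranspose_of_unitary hC, one_mulVec]

lemma density_mulVec_eq (C : Op) (ψ : Ket) : density (C *ᵥ ψ) = C * density ψ * Cᴴ := by
  rw [density, density, mul_vecMulVec, vecMulVec_mul, star_mulVec]

lemma stabilizerOverlaps_mulVec {C : Op} (hC : IsClifford C) (ψ : Ket) :
    stabilizerOverlaps (C *ᵥ ψ) = stabilizerOverlaps ψ := by
  ext x
  constructor
  · rintro ⟨s, hs, rfl⟩
    refine ⟨Cᴴ *ᵥ s, hs.mulVec hC.conjTranspose, ?_⟩
    rw [← star_mulVec_dotProduct_mulVec hC.1 ψ, mulVec_conjTranspose_mulVec hC.1]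
  · rintro ⟨s, hs, rfl⟩
    exact ⟨C *ᵥ s, hs.mulVec hC, by rw [star_mulVec_dotProduct_mulVec hC.1]⟩

lemma stabilizerFidelity_mulVec {C : Op} (hC : IsClifford C) (ψ : Ket) :
    stabilizerFidelity (C *ᵥ ψ) = stabilizerFidelity ψ := by
  rw [stabilizerFidelity, stabilizerOverlaps_mulVec hC, stabilizerFidelity]

lemma nearestStabilizerStates_mulVec {C : Op} (hC : IsClifford C) (ψ : Ket) :
    nearestStabilizerStates (C *ᵥ ψ) = (fun ρ => C * ρ * Cᴴ) '' nearestStabilizerStates ψ := by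
  ext ρ
  constructor
  · rintro ⟨s, hs, hx, rfl⟩
    refine ⟨density (Cᴴ *ᵥ s), ⟨Cᴴ *ᵥ s, hs.mulVec hC.conjTranspose, ?_, rfl⟩, ?_⟩
    · rw [← star_mulVec_dotProduct_mulVec hC.1 ψ, mulVec_conjTranspose_mulVec hC.1, hx,
        stabilizerFidelity_mulVec hC]
    · simp only [← density_mulVec_eq, mulVec_conjTranspose_mulVec hC.1]
  · rintro ⟨_, ⟨s, hs, hx, rfl⟩, rfl⟩
    refine ⟨C *ᵥ s, hs.mulVec hC, ?_, (density_mulVec_eq C s).symm⟩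
    rw [star_mulVec_dotProduct_mulVec hC.1, stabilizerFidelity_mulVec hC, hx]

lemma ncard_nearestStabilizerStates_mulVec {C : Op} (hC : IsClifford C) (ψ : Ket) :
    (nearestStabilizerStates (C *ᵥ ψ)).ncard = (nearestStabilizerStates ψ).ncard := by
  rw [nearestStabilizerStates_mulVec hC]
  refine Set.ncard_image_of_injective _ fun ρ σ h => ?_
  have key : ∀ ρ : Op, Cᴴ * (C * ρ * Cᴴ) * C = ρ := fun ρ => by
    rw [Matrix.mul_assoc C, ← Matrix.mul_assoc Cᴴ, conjTranspose_mul_of_unitary hC.1, Matrix.one_mul,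
      Matrix.mul_assoc, conjTranspose_mul_of_unitary hC.1, Matrix.mul_one]
  rw [← key ρ, ← key σ]
  exact congrArg (fun ρ => Cᴴ * ρ * C) h

/-! ### Overlaps with labelled stabilizer states -/

/-- The pairing of an antisymmetric matrix with the complex structure of a stabilizer state. -/
def labelValue {R : Type*} [CommRing R] (J : Matrix (Fin 6) (Fin 6) R) (k : StabilizerLabel) : R :=
  ((k.2.1 : ℤ) : R) * J (matchPerm k.1 0) (matchPerm k.1 1) +
    ((k.2.2 : ℤ) : R) * J (matchPerm k.1 2) (matchPerm k.1 3) +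
    ((k.2.1 * k.2.2 : ℤ) : R) * J (matchPerm k.1 4) (matchPerm k.1 5)

lemma sum_mul_planeRotation {J : Matrix (Fin 6) (Fin 6) ℝ} (hT : Jᵀ = -J) {a b : Fin 6}
    (hab : a ≠ b) : ∑ i, ∑ j, J i j * (planeRotation a b i j : ℤ) = 2 * J a b := by
  have h : ∀ i j, J i j * (planeRotation a b i j : ℤ) =
      (if i = a then if j = b then J i j else 0 else 0) -
        (if i = b then if j = a then J i j else 0 else 0) := by
    intro i j
    rw [planeRotation]
    split_ifs with h1 h2 h3 <;> simp_all
  simp only [h, Finset.sum_sub_distrib]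
  have h2 : ∀ a b : Fin 6, ∑ i, ∑ j, (if i = a then if j = b then J i j else 0 else 0) = J a b := by
    intro a b
    rw [Finset.sum_eq_single a (fun i _ hi => by simp [hi]) (by simp)]
    simp
  rw [h2, h2, apply_swap_of_transpose hT b a]
  ring

lemma sum_mul_labelForm {J : Matrix (Fin 6) (Fin 6) ℝ} (hT : Jᵀ = -J) (k : StabilizerLabel) :
    ∑ i, ∑ j, J i j * (labelForm k).map Int.cast i j = 2 * labelValue J k := by
  have ne : ∀ {a b : Fin 6}, a ≠ b → matchPerm k.1 a ≠ matchPerm k.1 b :=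
    fun h => (matchPerm k.1).injective.ne h
  have h1 := sum_mul_planeRotation hT (ne (show (0 : Fin 6) ≠ 1 by decide))
  have h2 := sum_mul_planeRotation hT (ne (show (2 : Fin 6) ≠ 3 by decide))
  have h3 := sum_mul_planeRotation hT (ne (show (4 : Fin 6) ≠ 5 by decide))
  have h : ∀ i j, J i j * (labelForm k).map Int.cast i j =
      ((k.2.1 : ℤ) : ℝ) * (J i j * (planeRotation (matchPerm k.1 0) (matchPerm k.1 1) i j : ℤ)) +
      ((k.2.2 : ℤ) : ℝ) * (J i j * (planeRotation (matchPerm k.1 2) (matchPerm k.1 3) i j : ℤ)) +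
      ((k.2.1 * k.2.2 : ℤ) : ℝ) *
        (J i j * (planeRotation (matchPerm k.1 4) (matchPerm k.1 5) i j : ℤ)) := by
    intro i j
    simp only [map_apply, labelForm, Matrix.add_apply, Matrix.smul_apply, smul_eq_mul]
    push_cast
    ring
  simp only [h, Finset.sum_add_distrib, ← Finset.mul_sum, h1, h2, h3, labelValue]
  ring

lemma overlap_label {φ s : Ket} (hφ : IsState φ) (hs : IsState s) {k : StabilizerLabel}
    (h : cs s = (labelForm k).map Int.cast) :
    ‖star φ ⬝ᵥ s‖ ^ 2 = (1 + labelValue (cs φ) k) / 4 := by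
  rw [overlap_eq hφ hs, h, sum_mul_labelForm (cs_transpose φ)]
  ring

lemma density_smul {c : ℂ} (hc : star c * c = 1) (ψ : Ket) : density (c • ψ) = density ψ := by
  rw [density, star_smul, vecMulVec_smul, smul_vecMulVec, smul_smul, hc, one_smul, density]

lemma density_eq_iff {s t : Ket} (hs : IsState s) (ht : IsState t) :
    density s = density t ↔ cs s = cs t := by
  constructor
  · intro h
    obtain ⟨c, hc, rfl⟩ := eq_smul_of_density_eq hs ht h
    rw [cs_smul, norm_eq_one_of_star_mul hc, one_smul]
  · intro h
    obtain ⟨c, hc, rfl⟩ := eq_smul_of_cs_eq hs ht h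
    exact density_smul hc t

lemma labelForm_injective : Function.Injective labelForm := by
  have key : ∀ k l : StabilizerLabel, labelForm k = labelForm l → k = l := by decide +kernel
  exact fun k l => key k l

/-- Every stabilizer state has a label, every label occurs, and labels separate density operators.
The supremum is therefore a maximum over sixty numbers, and counting nearest states amounts to
counting maximising labels. -/
lemma stabilizer_data_of_labels {φ : Ket} (hφ : IsState φ) {S : Finset StabilizerLabel} {M : ℝ}
    (hS : S.Nonempty) (heq : ∀ k ∈ S, labelValue (cs φ) k = M)
    (hlt : ∀ k ∉ S, labelValue (cs φ) k < M) :
    IsGreatest (stabilizerOverlaps φ) ((1 + M) / 4) ∧ stabilizerFidelity φ = (1 + M) / 4 ∧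
      (nearestStabilizerStates φ).ncard = S.card := by
  have hgr : IsGreatest (stabilizerOverlaps φ) ((1 + M) / 4) := by
    constructor
    · obtain ⟨k, hk⟩ := hS
      obtain ⟨s, hs, hsk⟩ := exists_stabilizerState k
      exact ⟨s, hs, by rw [overlap_label hφ hs.1 hsk, heq k hk]⟩
    · rintro _ ⟨s, hs, rfl⟩
      obtain ⟨k, hk⟩ := hs.exists_label
      rw [overlap_label hφ hs.1 hk]
      have : labelValue (cs φ) k ≤ M := by
        by_cases h : k ∈ S
        · exact (heq k h).le
        · exact (hlt k h).le
      linarith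
  have hF : stabilizerFidelity φ = (1 + M) / 4 := hgr.csSup_eq
  refine ⟨hgr, hF, ?_⟩
  choose f hf hfk using exists_stabilizerState
  have himage : nearestStabilizerStates φ = (fun k => density (f k)) '' (S : Set StabilizerLabel) := by
    ext ρ
    constructor
    · rintro ⟨s, hs, hx, rfl⟩
      obtain ⟨k, hk⟩ := hs.exists_label
      refine ⟨k, ?_, (density_eq_iff (hf k).1 hs.1).mpr ((hfk k).trans hk.symm)⟩
      rw [hF, overlap_label hφ hs.1 hk] at hx
      by_contra h
      linarith [hlt k h]
    · rintro ⟨k, hk, rfl⟩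
      exact ⟨f k, hf k, by rw [overlap_label hφ (hf k).1 (hfk k), heq k hk, hF], rfl⟩
  rw [himage, Set.ncard_image_of_injective, Set.ncard_coe_finset]
  intro k l h
  have h1 := (density_eq_iff (hf k).1 (hf l).1).mp h
  rw [hfk, hfk] at h1
  exact labelForm_injective (Matrix.map_injective Int.cast_injective h1)

/-! ### The stabilizer fidelities in the table -/

/-- The antisymmetric integer matrix with the given entries above the diagonal. -/
def intForm (v : Fin 15 → ℤ) : Matrix (Fin 6) (Fin 6) ℤ :=
  !![0, v 0, v 1, v 2, v 3, v 4; -v 0, 0, v 5, v 6, v 7, v 8; -v 1, -v 5, 0, v 9, v 10, v 11;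
    -v 2, -v 6, -v 9, 0, v 12, v 13; -v 3, -v 7, -v 10, -v 12, 0, v 14;
    -v 4, -v 8, -v 11, -v 13, -v 14, 0]

lemma intForm_swap (v : Fin 15 → ℤ) (i j : Fin 6) : intForm v j i = -intForm v i j := by
  fin_cases i <;> fin_cases j <;> simp [intForm]

lemma labelValue_sum {n : ℕ} (c : Fin n → ℝ) (N : Fin n → Matrix (Fin 6) (Fin 6) ℤ)
    {J : Matrix (Fin 6) (Fin 6) ℝ} (h : J = ∑ t, c t • (N t).map Int.cast) (k : StabilizerLabel) :
    labelValue J k = ∑ t, c t * (labelValue (N t) k : ℤ) := by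
  rw [h]
  simp only [labelValue, Matrix.sum_apply, Matrix.smul_apply, map_apply, smul_eq_mul, Finset.mul_sum,
    ← Finset.sum_add_distrib]
  refine Finset.sum_congr rfl fun t _ => ?_
  push_cast
  ring

/-- A lower bound for `1000 * c * d`, given integers `lo ≤ 1000 * c ≤ hi`. -/
def lowerBound (lo hi d : ℤ) : ℤ := if 0 ≤ d then lo * d else hi * d

lemma lowerBound_le {lo hi : ℤ} {c : ℝ} (h : (lo : ℝ) ≤ 1000 * c ∧ 1000 * c ≤ hi) (d : ℤ) :
    (lowerBound lo hi d : ℝ) ≤ 1000 * (c * d) := by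
  rw [lowerBound]
  split_ifs with hd
  · have : (0 : ℝ) ≤ d := by exact_mod_cast hd
    push_cast
    nlinarith [h.1]
  · have : (d : ℝ) ≤ 0 := by exact_mod_cast (not_le.mp hd).le
    push_cast
    nlinarith [h.2]

/-- With `cs φ` a real combination of integer forms, a label contributes `∑ c t * y t` with integers
`y t`. The maximising labels share one integer vector `y`. All others are already beaten when each
`c t` is known only up to bounds in thousandths, so `hk` is a finite integer check. -/
lemma stabilizer_data_of_bounds {n : ℕ} {φ : Ket} (hφ : IsState φ) (c : Fin n → ℝ)
    (v : Fin n → Fin 15 → ℤ) (lo hi y : Fin n → ℤ)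
    (h : ∀ i j, i < j → cs φ i j = ∑ t, c t * (intForm (v t) i j : ℤ))
    (hc : ∀ t, (lo t : ℝ) ≤ 1000 * c t ∧ 1000 * c t ≤ hi t)
    (hk : ∀ k, (∀ t, labelValue (intForm (v t)) k = y t) ∨
      0 < ∑ t, lowerBound (lo t) (hi t) (y t - labelValue (intForm (v t)) k)) {m : ℕ}
    (hm : (Finset.univ.filter fun k => ∀ t, labelValue (intForm (v t)) k = y t).card = m)
    (hm0 : m ≠ 0) :
    IsGreatest (stabilizerOverlaps φ) ((1 + ∑ t, c t * y t) / 4) ∧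
      stabilizerFidelity φ = (1 + ∑ t, c t * y t) / 4 ∧ (nearestStabilizerStates φ).ncard = m := by
  have hsum : cs φ = ∑ t, c t • (intForm (v t)).map Int.cast := by
    refine ext_of_lt (cs_transpose φ) ?_ fun i j hij => ?_
    · ext i j
      simp [Matrix.sum_apply, intForm_swap _ i j]
    · simp [h i j hij, Matrix.sum_apply]
  rw [← hm]
  refine stabilizer_data_of_labels hφ (Finset.card_ne_zero.mp (hm ▸ hm0)) (fun k hkS => ?_)
    fun k hkS => ?_
  · rw [labelValue_sum c _ hsum]
    exact Finset.sum_congr rfl fun t _ => by rw [(Finset.mem_filter.mp hkS).2 t]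
  · rw [labelValue_sum c _ hsum]
    have h1 := (hk k).resolve_left fun h => hkS (Finset.mem_filter.mpr ⟨Finset.mem_univ _, h⟩)
    have h2 : (0 : ℝ) < ∑ t, (lowerBound (lo t) (hi t) (y t - labelValue (intForm (v t)) k) : ℝ) := by
      exact_mod_cast h1
    have h3 := h2.trans_le (Finset.sum_le_sum fun t _ => lowerBound_le (hc t) _)
    simp only [← Finset.mul_sum, Int.cast_sub, mul_sub, Finset.sum_sub_distrib] at h3
    linarith

lemma sqrt_bounds {x lo hi : ℝ} (hhi : 0 ≤ hi) (h1 : lo ^ 2 ≤ x) (h2 : x ≤ hi ^ 2) :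
    lo ≤ √x ∧ √x ≤ hi :=
  ⟨Real.le_sqrt_of_sq_le h1, Real.sqrt_le_iff.mpr ⟨hhi, h2⟩⟩

lemma inv_sqrt_bounds {x : ℝ} {lo hi : ℤ} (hhi : 0 ≤ hi) (h1 : (lo / 1000 : ℝ) ^ 2 ≤ x⁻¹)
    (h2 : x⁻¹ ≤ (hi / 1000 : ℝ) ^ 2) : (lo : ℝ) ≤ 1000 * (√x)⁻¹ ∧ 1000 * (√x)⁻¹ ≤ hi := by
  rw [← Real.sqrt_inv]
  have h := sqrt_bounds (by positivity) h1 h2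
  constructor <;> linarith [h.1, h.2]

lemma sqrt_five_bounds : 2.236 ≤ √5 ∧ √5 ≤ 2.2361 :=
  sqrt_bounds (by norm_num) (by norm_num) (by norm_num)

lemma inv_sqrt_five : (√5)⁻¹ = √5 / 5 := by
  rw [inv_eq_iff_eq_inv, inv_div, eq_div_iff (by positivity)]
  exact Real.mul_self_sqrt (by norm_num)

/-- The statement about the nearest stabilizer states for a state with the complex structure of
a given row. -/
def HasStabilizerData (φ : Ket) (r : Fin 9) : Prop :=
  IsGreatest (stabilizerOverlaps φ) (stabilizerFidelity φ) ∧
    stabilizerFidelity φ = tableFidelity r ∧ (nearestStabilizerStates φ).ncard = tableCount r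

lemma hasStabilizerData_of_eq {φ : Ket} {r : Fin 9} {F : ℝ} {m : ℕ}
    (h : IsGreatest (stabilizerOverlaps φ) F ∧ stabilizerFidelity φ = F ∧
      (nearestStabilizerStates φ).ncard = m) (hF : F = tableFidelity r) (hm : m = tableCount r) :
    HasStabilizerData φ r :=
  ⟨h.2.1 ▸ h.1, h.2.1.trans hF, h.2.2.trans hm⟩

/-- In this and the next eight lemmas the distinct irrational entries of the standard form serve as
the coefficients. The three final vectors are the bounds on a thousand times the coefficients and
the integer pairings of an optimal label. -/
lemma hasStabilizerData_one {φ : Ket} (hφ : IsState φ) (h : cs φ = rowForm 0) :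
    HasStabilizerData φ 0 := by
  refine hasStabilizerData_of_eq (stabilizer_data_of_bounds (m := 1) hφ
      ![1]
      ![![1, 0, 0, 0, 0, 0, 0, 0, 0, 1, 0, 0, 0, 0, 1]]
      ![1000] ![1000] ![3]
      (forall_lt ?_) ?_ (by decide +kernel) (by decide +kernel) (by norm_num)) ?_ rfl
  · simp [h, rowForm, antisymm, intForm]
  · intro t
    fin_cases t
    · norm_num
  · simp [tableFidelity]
    norm_num

lemma hasStabilizerData_h_zero {φ : Ket} (hφ : IsState φ) (h : cs φ = rowForm 1) :
    HasStabilizerData φ 1 := by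
  refine hasStabilizerData_of_eq (stabilizer_data_of_bounds (m := 2) hφ
      ![(√2)⁻¹, 1]
      ![![0, 1, 1, 0, 0, 1, -1, 0, 0, 0, 0, 0, 0, 0, 0],
        ![0, 0, 0, 0, 0, 0, 0, 0, 0, 0, 0, 0, 0, 0, 1]]
      ![707, 1000] ![708, 1000] ![2, 1]
      (forall_lt ?_) ?_ (by decide +kernel) (by decide +kernel) (by norm_num)) ?_ rfl
  · simp [h, rowForm, antisymm, intForm, Fin.sum_univ_succ]
  · intro t
    fin_cases t
    · exact inv_sqrt_bounds (by norm_num) (by norm_num) (by norm_num)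
    · norm_num
  · simp [tableFidelity, Fin.sum_univ_succ, inv_sqrt_two]
    ring

lemma hasStabilizerData_t_zero {φ : Ket} (hφ : IsState φ) (h : cs φ = rowForm 2) :
    HasStabilizerData φ 2 := by
  refine hasStabilizerData_of_eq (stabilizer_data_of_bounds (m := 3) hφ
      ![(√3)⁻¹, 1]
      ![![1, -1, 1, 0, 0, 1, 1, 0, 0, 1, 0, 0, 0, 0, 0],
        ![0, 0, 0, 0, 0, 0, 0, 0, 0, 0, 0, 0, 0, 0, 1]]
      ![577, 1000] ![578, 1000] ![2, 1]
      (forall_lt ?_) ?_ (by decide +kernel) (by decide +kernel) (by norm_num)) ?_ rfl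
  · simp [h, rowForm, antisymm, intForm, Fin.sum_univ_succ]
  · intro t
    fin_cases t
    · exact inv_sqrt_bounds (by norm_num) (by norm_num) (by norm_num)
    · norm_num
  · simp [tableFidelity, Fin.sum_univ_succ, inv_sqrt_three]
    ring

lemma hasStabilizerData_h_h {φ : Ket} (hφ : IsState φ) (h : cs φ = rowForm 3) :
    HasStabilizerData φ 3 := by
  refine hasStabilizerData_of_eq (stabilizer_data_of_bounds (m := 4) hφ
      ![2⁻¹, (√2)⁻¹]
      ![![1, 0, -1, 0, 0, 1, 0, 0, 0, 1, 0, 0, 0, 0, 0],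
        ![0, 0, 0, 1, 0, 0, 0, 0, -1, 0, 1, 0, 0, -1, 0]]
      ![500, 707] ![500, 708] ![1, 2]
      (forall_lt ?_) ?_ (by decide +kernel) (by decide +kernel) (by norm_num)) ?_ rfl
  · simp [h, rowForm, antisymm, intForm, Fin.sum_univ_succ]
  · intro t
    fin_cases t
    · norm_num
    · exact inv_sqrt_bounds (by norm_num) (by norm_num) (by norm_num)
  · simp [tableFidelity, Fin.sum_univ_succ, inv_sqrt_two]
    ring

lemma hasStabilizerData_t_h {φ : Ket} (hφ : IsState φ) (h : cs φ = rowForm 4) :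
    HasStabilizerData φ 4 := by
  refine hasStabilizerData_of_eq (stabilizer_data_of_bounds (m := 6) hφ
      ![(√3)⁻¹, (√6)⁻¹, (√2)⁻¹]
      ![![1, -1, 0, 0, 0, 1, 0, 0, 0, 0, 0, 0, 0, 0, 0],
        ![0, 0, 1, 1, 0, 0, 1, 1, 0, 1, 1, 0, 0, 0, 0],
        ![0, 0, 0, 0, 0, 0, 0, 0, 0, 0, 0, 0, 0, -1, 1]]
      ![577, 408, 707] ![578, 409, 708] ![1, 1, 1]
      (forall_lt ?_) ?_ (by decide +kernel) (by decide +kernel) (by norm_num)) ?_ rfl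
  · simp [h, rowForm, antisymm, intForm, Fin.sum_univ_succ]
  · intro t
    fin_cases t
    · exact inv_sqrt_bounds (by norm_num) (by norm_num) (by norm_num)
    · exact inv_sqrt_bounds (by norm_num) (by norm_num) (by norm_num)
    · exact inv_sqrt_bounds (by norm_num) (by norm_num) (by norm_num)
  · simp [tableFidelity, Fin.sum_univ_succ, inv_sqrt_three, inv_sqrt_six, inv_sqrt_two]
    ring

lemma hasStabilizerData_t_t {φ : Ket} (hφ : IsState φ) (h : cs φ = rowForm 5) :
    HasStabilizerData φ 5 := by
  refine hasStabilizerData_of_eq (stabilizer_data_of_bounds (m := 9) hφ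
      ![(√3)⁻¹, 3⁻¹]
      ![![1, -1, 0, 0, 0, 1, 0, 0, 0, 0, 0, 0, 1, -1, 1],
        ![0, 0, 1, 1, 1, 0, 1, 1, 1, 1, 1, 1, 0, 0, 0]]
      ![577, 333] ![578, 334] ![2, 1]
      (forall_lt ?_) ?_ (by decide +kernel) (by decide +kernel) (by norm_num)) ?_ rfl
  · simp [h, rowForm, antisymm, intForm, Fin.sum_univ_succ]
  · intro t
    fin_cases t
    · exact inv_sqrt_bounds (by norm_num) (by norm_num) (by norm_num)
    · norm_num
  · simp [tableFidelity, Fin.sum_univ_succ, inv_sqrt_three]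
    ring

lemma hasStabilizerData_g4 {φ : Ket} (hφ : IsState φ) (h : cs φ = rowForm 6) :
    HasStabilizerData φ 6 := by
  refine hasStabilizerData_of_eq (stabilizer_data_of_bounds (m := 2) hφ
      ![3⁻¹]
      ![![2, 0, 1, 0, 2, 2, 0, 1, 0, 2, 0, 1, 2, 0, 2]]
      ![333] ![334] ![6]
      (forall_lt ?_) ?_ (by decide +kernel) (by decide +kernel) (by norm_num)) ?_ rfl
  · simp [h, rowForm, antisymm, intForm]
    norm_num
  · intro t
    fin_cases t
    · norm_num
  · simp [tableFidelity]
    norm_num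

lemma hasStabilizerData_g16 {φ : Ket} (hφ : IsState φ) (h : cs φ = rowForm 7) :
    HasStabilizerData φ 7 := by
  refine hasStabilizerData_of_eq (stabilizer_data_of_bounds (m := 5) hφ
      ![√(5 + 2 * √5) / 5, √(5 - 2 * √5) / 5, (√5)⁻¹]
      ![![1, 0, 0, -1, 0, 1, 0, 0, 0, 1, 0, 0, 1, 0, 0],
        ![0, -1, 1, 0, 0, 0, -1, 1, 0, 0, -1, 0, 0, 0, 0],
        ![0, 0, 0, 0, 1, 0, 0, 0, 1, 0, 0, 1, 0, 1, 1]]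
      ![615, 145, 447] ![616, 146, 448] ![2, 0, 1]
      (forall_lt ?_) ?_ (by decide +kernel) (by decide +kernel) (by norm_num)) ?_ rfl
  · simp [h, rowForm, antisymm, intForm, Fin.sum_univ_succ]
  · intro t
    fin_cases t
    · have h5 := sqrt_five_bounds
      have := sqrt_bounds (x := 5 + 2 * √5) (lo := 3.075) (hi := 3.08) (by norm_num)
        (by linarith [h5.1]) (by linarith [h5.2])
      norm_num
      constructor <;> linarith [this.1, this.2]
    · have h5 := sqrt_five_bounds
      have := sqrt_bounds (x := 5 - 2 * √5) (lo := 0.725) (hi := 0.73) (by norm_num)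
        (by linarith [h5.2]) (by linarith [h5.1])
      norm_num
      constructor <;> linarith [this.1, this.2]
    · exact inv_sqrt_bounds (by norm_num) (by norm_num) (by norm_num)
  · simp [tableFidelity, Fin.sum_univ_succ, inv_sqrt_five]
    ring

lemma hasStabilizerData_g20 {φ : Ket} (hφ : IsState φ) (h : cs φ = rowForm 8) :
    HasStabilizerData φ 8 := by
  refine hasStabilizerData_of_eq (stabilizer_data_of_bounds (m := 8) hφ
      ![2⁻¹]
      ![![1, 0, -1, 1, 1, 1, 0, 1, -1, 1, 1, 1, 1, -1, 0]]
      ![500] ![500] ![3]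
      (forall_lt ?_) ?_ (by decide +kernel) (by decide +kernel) (by norm_num)) ?_ rfl
  · simp [h, rowForm, antisymm, intForm]
  · intro t
    fin_cases t
    · norm_num
  · simp [tableFidelity]
    norm_num

theorem hasStabilizerData_of_cs {φ : Ket} {r : Fin 9} (hφ : IsState φ) (h : cs φ = rowForm r) :
    HasStabilizerData φ r := by
  fin_cases r
  · exact hasStabilizerData_one hφ h
  · exact hasStabilizerData_h_zero hφ h
  · exact hasStabilizerData_t_zero hφ h
  · exact hasStabilizerData_h_h hφ h
  · exact hasStabilizerData_t_h hφ h
  · exact hasStabilizerData_t_t hφ h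
  · exact hasStabilizerData_g4 hφ h
  · exact hasStabilizerData_g16 hφ h
  · exact hasStabilizerData_g20 hφ h

theorem HasRow.hasStabilizerData {ψ : Ket} {r : Fin 9} (h : HasRow ψ r) : HasStabilizerData ψ r := by
  obtain ⟨C, hC, hCr⟩ := h.exists_clifford
  have h1 := hasStabilizerData_of_cs (h.1.mulVec hC.1) hCr
  rwa [HasStabilizerData, stabilizerOverlaps_mulVec hC, stabilizerFidelity_mulVec hC,
    ncard_nearestStabilizerStates_mulVec hC] at h1

lemma tableFidelity_injective : Function.Injective tableFidelity := by
  have h2 := sqrt_bounds (x := 2) (lo := 1.4142) (hi := 1.4143) (by norm_num) (by norm_num)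
    (by norm_num)
  have h3 := sqrt_bounds (x := 3) (lo := 1.732) (hi := 1.7321) (by norm_num) (by norm_num)
    (by norm_num)
  have h5 := sqrt_five_bounds
  have h5' := sqrt_bounds (x := 5 + 2 * √5) (lo := 3.077) (hi := 3.078) (by norm_num)
    (by linarith [h5.1]) (by linarith [h5.2])
  -- These are lower bounds for a thousand times the fidelities. With the upper bounds they form
  -- pairwise disjoint intervals.
  obtain ⟨lo, hlo⟩ : ∃ lo : Fin 9 → ℤ, lo = ![1000, 853, 788, 728, 673, 622, 750, 669, 625] :=
    ⟨_, rfl⟩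
  obtain ⟨hi, hhi⟩ : ∃ hi : Fin 9 → ℤ, hi = ![1000, 854, 789, 729, 674, 623, 750, 670, 625] :=
    ⟨_, rfl⟩
  have hb : ∀ r, (lo r : ℝ) ≤ 1000 * tableFidelity r ∧ 1000 * tableFidelity r ≤ hi r := by
    subst hlo hhi
    intro r
    fin_cases r <;> simp only [tableFidelity] <;> simp <;> norm_num at h2 h3 h5 h5' ⊢ <;>
      constructor <;> nlinarith
  have hdisj : ∀ r s, hi r < lo s ∨ hi s < lo r ∨ r = s := by subst hlo hhi; decide
  intro r s hrs
  rcases hdisj r s with h | h | h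
  · have : (hi r : ℝ) < lo s := by exact_mod_cast h
    linarith [(hb r).2, (hb s).1]
  · have : (hi s : ℝ) < lo r := by exact_mod_cast h
    linarith [(hb s).2, (hb r).1]
  · exact h

/-! ### Non-degenerate eigenstates -/

lemma IsNondegenerateCliffordEigenstate.mulVec {D : Op} (hD : IsClifford D) {ψ : Ket}
    (h : IsNondegenerateCliffordEigenstate ψ) : IsNondegenerateCliffordEigenstate (D *ᵥ ψ) := by
  obtain ⟨hψ, C, c, hC, hc, hfin⟩ := h
  refine ⟨hψ.mulVec hD.1, D * C * Dᴴ, c, (hD.mul hC).mul hD.conjTranspose, ?_, ?_⟩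
  · rw [mem_eigenspace_iff] at hc ⊢
    rw [← mulVec_mulVec, conjTranspose_mulVec_mulVec hD.1, ← mulVec_mulVec, hc, mulVec_smul]
  · have hinj : Function.Injective (Matrix.toLin' D) := by
      intro x y hxy
      rw [toLin'_apply, toLin'_apply] at hxy
      rw [← conjTranspose_mulVec_mulVec hD.1 x, hxy, conjTranspose_mulVec_mulVec hD.1]
    have hmap : Module.End.eigenspace (toLin' (D * C * Dᴴ)) c =
        (Module.End.eigenspace (toLin' C) c).map (toLin' D) := by
      ext x
      rw [Submodule.mem_map, mem_eigenspace_iff]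
      constructor
      · intro hx
        refine ⟨Dᴴ *ᵥ x, ?_, mulVec_conjTranspose_mulVec hD.1 x⟩
        rw [mem_eigenspace_iff, ← conjTranspose_mulVec_mulVec hD.1 (C *ᵥ (Dᴴ *ᵥ x)), mulVec_mulVec x,
          mulVec_mulVec x, ← Matrix.mul_assoc, hx, mulVec_smul]
      · rintro ⟨y, hy, rfl⟩
        rw [mem_eigenspace_iff] at hy
        rw [toLin'_apply, ← mulVec_mulVec, conjTranspose_mulVec_mulVec hD.1, ← mulVec_mulVec, hy,
          mulVec_smul]
    rw [← hfin, (Submodule.equivMapOfInjective _ hinj (Module.End.eigenspace (toLin' C) c)).finrank_eq,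
      hmap]

/-- The state is moved to one whose complex structure is exactly the standard form, where
`central_rowForm` applies, and then moved back. -/
theorem HasRow.isNondegenerateCliffordEigenstate {ψ : Ket} {r : Fin 9} (h : HasRow ψ r) :
    IsNondegenerateCliffordEigenstate ψ := by
  obtain ⟨C, hC, hCr⟩ := h.exists_clifford
  obtain ⟨D, hD, hD'⟩ := realizable_of_signedDet (signedDet_rowPerm r)
  obtain ⟨c, hc⟩ := nondegenerate_of_central hD' (h.1.mulVec hC.1) (hCr ▸ central_rowForm r)
  rw [← conjTranspose_mulVec_mulVec hC.1 ψ]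
  exact IsNondegenerateCliffordEigenstate.mulVec hC.conjTranspose ⟨h.1.mulVec hC.1, D, c, hD, hc⟩

theorem IsNondegenerateCliffordEigenstate.isRow {ψ : Ket}
    (h : IsNondegenerateCliffordEigenstate ψ) : IsRow (cs ψ) := by
  obtain ⟨hψ, C, c, hC, hc, hfin⟩ := h
  obtain ⟨π, ε, hπ⟩ := hC.exists_implements
  exact isRow_of_central (cs_transpose ψ) (cs_mul_self hψ) (central_of_nondegenerate hπ hψ hc hfin)

lemma tableStates_nonempty (r : Fin 9) : (tableStates r).Nonempty := by
  fin_cases r <;> simp [tableStates]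

lemma HasRow.cliffordEquiv {ψ φ : Ket} {r : Fin 9} (h : HasRow ψ r) (hφ : IsState φ)
    {π : Equiv.Perm (Fin 6)} {ε : Fin 6 → ℤˣ} (h' : SignedConj π ε (cs φ) (rowForm r)) :
    CliffordEquiv ψ φ := by
  obtain ⟨hψ, π', ε', -, h⟩ := h
  exact cliffordEquiv_of_signedConj hψ hφ (h.trans h'.symm)

end TwoQubit

end

/-! ### The classification theorem -/

theorem mainTheorem9 :
    -- every state that is Clifford-equivalent to a listed one, and no other, is a
    -- non-degenerate eigenstate of a Clifford operation
    (∀ φ : TwoQubit.Ket, TwoQubit.IsNondegenerateCliffordEigenstate φ ↔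
      ∃ i : Fin 9, ∃ ψ ∈ TwoQubit.tableStates i, TwoQubit.CliffordEquiv ψ φ) ∧
    -- listed states are Clifford-equivalent exactly when they are in the same row
    (∀ i j : Fin 9, ∀ ψ ∈ TwoQubit.tableStates i, ∀ φ ∈ TwoQubit.tableStates j,
      (TwoQubit.CliffordEquiv ψ φ ↔ i = j)) ∧
    -- each listed state is itself such an eigenstate, with the given stabilizer fidelity
    -- (an attained maximum) and number of nearest stabilizer states
    (∀ i : Fin 9, ∀ ψ ∈ TwoQubit.tableStates i,
      TwoQubit.IsNondegenerateCliffordEigenstate ψ ∧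
      IsGreatest (TwoQubit.stabilizerOverlaps ψ) (TwoQubit.stabilizerFidelity ψ) ∧
      TwoQubit.stabilizerFidelity ψ = TwoQubit.tableFidelity i ∧
      (TwoQubit.nearestStabilizerStates ψ).ncard = TwoQubit.tableCount i) := by
  open TwoQubit in
  refine ⟨fun φ => ⟨fun h => ?_, ?_⟩, fun i j ψ hψ φ hφ => ⟨?_, ?_⟩, fun i ψ hψ => ?_⟩
  · obtain ⟨r, π, ε, hr⟩ := h.isRow
    obtain ⟨ψ, hψ⟩ := tableStates_nonempty r
    exact ⟨r, ψ, hψ, (hasRow_of_mem_tableStates hψ).cliffordEquiv h.1 hr⟩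
  · rintro ⟨r, ψ, hψ, C, hC, rfl⟩
    exact (hasRow_of_mem_tableStates hψ).isNondegenerateCliffordEigenstate.mulVec hC
  · rintro ⟨C, hC, rfl⟩
    -- The stabilizer fidelity is Clifford invariant and takes different values on different rows.
    have h1 := (hasRow_of_mem_tableStates hψ).hasStabilizerData.2.1
    have h2 := (hasRow_of_mem_tableStates hφ).hasStabilizerData.2.1
    rw [stabilizerFidelity_mulVec hC, h1] at h2
    exact tableFidelity_injective h2
  · rintro rfl
    obtain ⟨hs, π, ε, -, h⟩ := hasRow_of_mem_tableStates hφ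
    exact (hasRow_of_mem_tableStates hψ).cliffordEquiv hs h
  · have h := hasRow_of_mem_tableStates hψ
    exact ⟨h.isNondegenerateCliffordEigenstate, h.hasStabilizerData⟩
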